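/- **Setting.** Let $S$ be a smooth manifold and $\pi:N\to S$ a smooth vector bundle, whose total space $M=N$ serves as (a tubular neighbourhood, with normal bundle $N=NS$, of) the zero section $S\subset M$. Fix an integer $k_0\le -1$ and smooth vector bundles $\mathcal A,\mathcal B$ and $G_k$ ($k=-r,\dots,-1$, $k\neq k_0$) over $S$. Let $\mathcal E$ be the graded manifold over $M$ with $\mathcal E_{k_0}=\pi^*(\mathcal A\oplus\mathcal B)$ and $\mathcal E_k=\pi^*G_k$ for $k\ne k_0$, and let $\mathcal C^\infty(\mathcal E)=\Gamma(S(\mathcal E^*))$ be its graded commutative algebra of functions. Multi-vector fields on $\mathcal E$ carry the Schouten–Nijenhuis bracket, which is a graded Lie bracket for the shifted total degree $\|Z\|$ (an $l$-vector field of internal degree $|Z|$ has $\|Z\|=|Z|+l-1$). Let $Q=Q_++Q_-$ be a blended homological vector field: $Q_\pm$ are multi-vector fields with $\|Q_\pm\|=\pm1$ and $[Q_+,Q_+]=[Q_-,Q_-]=[Q_+,Q_-]=0$. A submanifold of $\mathcal E$ concentrated in degree $k_0$ (a subbundle of $\mathcal E_{k_0}$ over a submanifold of $M$) is *of coisotropic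 type* if $Q|_{\mathcal E_{k_0}}$ vanishes on its conormal bundle in $\mathcal E_{k_0}$: for all $l$ and all functions $F_1,\dots,F_l$ on $\mathcal E_{k_0}$ that vanish on the submanifold, $Q(F_1,\dots,F_l)$ vanishes on it. Suppose that $\mathcal A$ (over the zero section) is of coisotropic type. A *deformation* of $\mathcal A$ is a pair $(\sigma,\phi)\in\Gamma(N)\oplus\Gamma(\mathcal A^*\otimes\mathcal B)$ such that the graph of $\phi$, placed over the graph of $\sigma$, is of coisotropic type. Let $p:\mathcal A\to S$ be the projection and let $x,y,\xi,\eta$ denote coordinates on $S$ and linear coordinates on the fibres of $N$, $\mathcal A$, $\mathcal B$. A function on $\mathcal E_{k_0}$ is *polynomial* along $p^!N$ if it is a polynomial in $y$ and $\eta$ with coefficients in $\mathcal C^\infty(\mathcal A)$; it is *analytic* along $p^!N$ if on every fibre of $p^!N$ its Maclaurin series in $y$ converges to it everywhere. $Q$ is *analytic* along $p^!N$ if $Q|_{\mathcal E_{k_0}}(F_1,\dots,F_l)$ is analytic along $p^!N$ for all $l$ and all $F_1,\dots,F_l$ polynomial along $p^!N$. Let $\mathfrak a=\Gamma\big(S(\mathcal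 A^*)\otimes S(N[-1]\oplus\mathcal B[-1])\big)[1]$, let $I$ be its inclusion into the multi-vector fields on $\mathcal E$ as those of the local form $\sum F(x,\xi)\,\partial_{y^{j_1}}\wedge\cdots\wedge\partial_{\eta^{q_1}}\wedge\cdots$, and let $P$ be the projection of the multi-vector fields onto $\mathfrak a$ that restricts the coefficients to $\mathcal A$ and discards all terms containing a factor other than the $\partial_y,\partial_\eta$. Let $\mathfrak a_Q^P$ be $\mathfrak a$ with the higher derived brackets $$m_k(a_1,\dots,a_k)=P[\cdots[[Q,I(a_1)],I(a_2)],\cdots,I(a_k)],\qquad k\ge0 .$$ Let $\mathfrak a'\subset\mathfrak a$ be the part of multiplicity one, so that $\mathfrak a'_0=\Gamma(N)\oplus\Gamma(\mathcal A^*\otimes\mathcal B)$, and let $\bar{\mathfrak a}\subset\mathfrak a$ be the graded subspace with $\bar{\mathfrak a}_0=\mathfrak a'_0$ and $\bar{\mathfrak a}_k=\mathfrak a_k$ for $k\neq0$. A *Maurer–Cartan element* of $\bar{\mathfrak a}_Q^P$ is an element $v\in\bar{\mathfrak a}_0$ for which $\sum_{k\ge0}\frac1{k!}m_k(v,\dots,v)$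 converges (coefficientwise, at every point of $S$) to $0$. **Statement.** If $Q$ is analytic along $p^!N$, then $(\sigma,\phi)\mapsto-(\sigma,\phi)$ is a bijection from the set of deformations of $\mathcal A$ onto the set of Maurer–Cartan elements of $\bar{\mathfrak a}_Q^P$. -/

import Mathlib

open Bundle
open scoped Manifold ContDiff Topology

noncomputable section

namespace GradedQ

universe u v w

/-! ### The graded symmetric algebra of a graded vector space -/

section GSym

variable {κ : Type w} (deg : κ → ℕ) (W : κ → Type v)
  [∀ i, AddCommGroup (W i)] [∀ i, Module ℝ (W i)]

open Classical in
/-- The element `v` of the `i`-th summand, inside the tensor algebra of `⨁ i, W i`. -/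
def tgen (i : κ) : W i →ₗ[ℝ] TensorAlgebra ℝ (DirectSum κ W) :=
  (TensorAlgebra.ι ℝ).comp (DirectSum.lof ℝ κ W i)

/-- `v ⊗ w = (-1)^{|v||w|} w ⊗ v` for `v`, `w` homogeneous. -/
inductive GSymRel : TensorAlgebra ℝ (DirectSum κ W) → TensorAlgebra ℝ (DirectSum κ W) → Prop
  | comm (i j : κ) (x : W i) (y : W j) :
      GSymRel (tgen W i x * tgen W j y) ((-1 : ℝ) ^ (deg i * deg j) • (tgen W j y * tgen W i x))

/-- The graded symmetric algebra of `⨁ i, W i`, where `W i` sits in degree `deg i`. -/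
def GSym : Type (max v w) := RingQuot (GSymRel deg W)

instance : Ring (GSym deg W) := inferInstanceAs (Ring (RingQuot (GSymRel deg W)))

instance : Algebra ℝ (GSym deg W) := inferInstanceAs (Algebra ℝ (RingQuot (GSymRel deg W)))

/-- The generators of the graded symmetric algebra. -/
def GSym.gen (i : κ) : W i →ₗ[ℝ] GSym deg W :=
  (RingQuot.mkAlgHom ℝ (GSymRel deg W)).toLinearMap.comp (tgen W i)

open Classical in
/-- The universal property of the graded symmetric algebra. -/
def GSym.lift {R : Type*} [Ring R] [Algebra ℝ R] (f : ∀ i, W i →ₗ[ℝ] R)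
    (hf : ∀ i j x y, f i x * f j y = (-1 : ℝ) ^ (deg i * deg j) • (f j y * f i x)) :
    GSym deg W →ₐ[ℝ] R :=
  RingQuot.liftAlgHom ℝ ⟨TensorAlgebra.lift ℝ (DirectSum.toModule ℝ κ R f), by
    rintro _ _ ⟨i, j, x, y⟩
    simpa [tgen] using hf i j x y⟩

/-- The part of degree `m`: the span of the products of generators of total degree `m`. -/
def GSym.homog (m : ℤ) : Submodule ℝ (GSym deg W) :=
  Submodule.span ℝ {x | ∃ L : List (Σ i, W i),
    ((L.map fun a => deg a.1).sum : ℤ) = m ∧ x = (L.map fun a => GSym.gen deg W a.1 a.2).prod}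

variable {deg W}

theorem GSym.gen_mul_gen (i j : κ) (x : W i) (y : W j) :
    GSym.gen deg W i x * GSym.gen deg W j y =
      (-1 : ℝ) ^ (deg i * deg j) • (GSym.gen deg W j y * GSym.gen deg W i x) := by
  have h := RingQuot.mkAlgHom_rel ℝ (GSymRel.comm (deg := deg) i j x y)
  rw [map_mul, map_smul, map_mul] at h
  exact h

theorem GSym.lift_gen {R : Type*} [Ring R] [Algebra ℝ R] (f : ∀ i, W i →ₗ[ℝ] R)
    (hf : ∀ i j x y, f i x * f j y = (-1 : ℝ) ^ (deg i * deg j) • (f j y * f i x))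
    (i : κ) (x : W i) : GSym.lift deg W f hf (GSym.gen deg W i x) = f i x := by
  classical
  change RingQuot.liftAlgHom ℝ _ (RingQuot.mkAlgHom ℝ _ (tgen W i x)) = _
  rw [RingQuot.liftAlgHom_mkAlgHom_apply]
  simp [tgen]

theorem GSym.gen_mem_homog (i : κ) (x : W i) :
    GSym.gen deg W i x ∈ GSym.homog deg W (deg i) :=
  Submodule.subset_span ⟨[⟨i, x⟩], by simp, by simp⟩

theorem GSym.algebraMap_mem_homog (c : ℝ) :
    algebraMap ℝ (GSym deg W) c ∈ GSym.homog deg W 0 := by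
  rw [Algebra.algebraMap_eq_smul_one]
  exact Submodule.smul_mem _ _ (Submodule.subset_span ⟨[], by simp, by simp⟩)

end GSym

/-! ### Smooth vector bundles and their sections -/

variable {n : ℕ} {S : Type u} [TopologicalSpace S] [ChartedSpace (EuclideanSpace ℝ (Fin n)) S]

variable (n S) in
/-- A smooth real vector bundle of finite rank over `S`. -/
structure VB where
  F : Type v
  V : S → Type v
  [normF : NormedAddCommGroup F]
  [spaceF : NormedSpace ℝ F]
  [finF : FiniteDimensional ℝ F]
  [addV : ∀ s, AddCommGroup (V s)]
  [modV : ∀ s, Module ℝ (V s)]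
  [topV : ∀ s, TopologicalSpace (V s)]
  [topTotal : TopologicalSpace (TotalSpace F V)]
  [fiberBundle : FiberBundle F V]
  [vectorBundle : VectorBundle ℝ F V]
  [smoothBundle : ContMDiffVectorBundle ∞ F V (𝓡 n)]

attribute [instance] VB.normF VB.spaceF VB.finF VB.addV VB.modV VB.topV VB.topTotal
  VB.fiberBundle VB.vectorBundle VB.smoothBundle

/-- The total space of a vector bundle; it is a manifold modelled on `(𝓡 n).prod 𝓘(ℝ, E.F)`. -/
abbrev VB.Tot (E : VB.{u, v} n S) : Type (max u v) := TotalSpace E.F E.V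

/-- Smooth sections. -/
structure Sec (E : VB.{u, v} n S) where
  toFun : ∀ s, E.V s
  smooth : ContMDiff (𝓡 n) ((𝓡 n).prod 𝓘(ℝ, E.F)) ∞ fun s => (⟨s, toFun s⟩ : E.Tot)

/-- Smooth sections of the dual bundle, i.e. smooth fibrewise linear functions. -/
structure DualSec (E : VB.{u, v} n S) where
  toFun : ∀ s, Module.Dual ℝ (E.V s)
  smooth : ContMDiff ((𝓡 n).prod 𝓘(ℝ, E.F)) 𝓘(ℝ) ∞ fun x : E.Tot => toFun x.proj x.2

/-- Smooth sections of `A^* ⊗ B = Hom(A, B)`, i.e. smooth bundle maps over the identity. -/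
structure HomSec (A B : VB.{u, v} n S) where
  toFun : ∀ s, A.V s →ₗ[ℝ] B.V s
  smooth : ContMDiff ((𝓡 n).prod 𝓘(ℝ, A.F)) ((𝓡 n).prod 𝓘(ℝ, B.F)) ∞
    fun x : A.Tot => (⟨x.proj, toFun x.proj x.2⟩ : B.Tot)

/-! ### Smooth functions on a graded manifold

Given a smooth map `p : M → S` and vector bundles `E i` over `S`, put in degree `- deg i`, the
pull-back of `E` along `p` is a graded manifold with body `M`.  Its functions are the smooth
sections of the bundle with fibre `GSym (E^*)` at `p x`. -/

section Functions

variable {κ : Type w} (deg : κ → ℕ) (E : κ → VB.{u, v} n S)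

/-- The fibre at `s` of the graded symmetric algebra bundle of `E^*`. -/
abbrev Fib (s : S) : Type (max v w) := GSym deg fun i => Module.Dual ℝ ((E i).V s)

variable {H X M : Type*} [NormedAddCommGroup X] [NormedSpace ℝ X] [TopologicalSpace H]
  (I : ModelWithCorners ℝ X H) [TopologicalSpace M] [ChartedSpace H M] (p : M → S)

/-- Smooth functions on the body, and smooth sections of the dual bundles. -/
def basicFun : Set (∀ x, Fib deg E (p x)) :=
  {f | ∃ h : M → ℝ, ContMDiff I 𝓘(ℝ) ∞ h ∧ f = fun x => algebraMap ℝ _ (h x)} ∪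
  {f | ∃ (i : κ) (a : DualSec (E i)), f = fun x => GSym.gen deg _ i (a.toFun (p x))}

/-- A family of elements of the fibres is smooth if near every point it is a polynomial in smooth
functions on the body and smooth sections of the dual bundles. -/
def IsSmoothFam (f : ∀ x, Fib deg E (p x)) : Prop :=
  ∀ x, ∃ g ∈ Algebra.adjoin ℝ (basicFun deg E I p), ∀ᶠ y in 𝓝 x, f y = g y

/-- The smooth functions of degree `m`. -/
def homFun (m : ℤ) : Submodule ℝ (∀ x, Fib deg E (p x)) where
  carrier := {f | IsSmoothFam deg E I p f ∧ ∀ x, f x ∈ GSym.homog deg _ m}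
  zero_mem' := ⟨fun _ => ⟨0, zero_mem _, Filter.Eventually.of_forall fun _ => rfl⟩,
    fun _ => zero_mem _⟩
  add_mem' := by
    rintro f g ⟨hf, hf'⟩ ⟨hg, hg'⟩
    refine ⟨fun x => ?_, fun x => add_mem (hf' x) (hg' x)⟩
    obtain ⟨a, ha, ha'⟩ := hf x
    obtain ⟨b, hb, hb'⟩ := hg x
    refine ⟨a + b, add_mem ha hb, ?_⟩
    filter_upwards [ha', hb'] with y h1 h2
    simp [h1, h2]
  smul_mem' := by
    rintro c f ⟨hf, hf'⟩
    refine ⟨fun x => ?_, fun x => Submodule.smul_mem _ c (hf' x)⟩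
    obtain ⟨a, ha, ha'⟩ := hf x
    refine ⟨c • a, Subalgebra.smul_mem _ ha c, ?_⟩
    filter_upwards [ha'] with y h1
    simp [h1]

theorem IsSmoothFam.of_basic {f : ∀ x, Fib deg E (p x)} (hf : f ∈ basicFun deg E I p) :
    IsSmoothFam deg E I p f :=
  fun _ => ⟨f, Algebra.subset_adjoin hf, Filter.Eventually.of_forall fun _ => rfl⟩

end Functions

/-! ### The graded manifold near a submanifold concentrated in one degree -/

variable (n S) in
/-- A submanifold `A` over `S`, concentrated in degree `k₀ = -j₀`, of a graded manifold `E`, after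
the choice of a tubular neighbourhood `N` of `S` (which becomes the body of `E`), of a complement
`B` of `A` in `E_{k₀}|_S`, and of an identification of `E` with the pull-back of `E|_S` along
`N → S`.  So `E_{k₀}` is the pull-back of `A ⊕ B`, and `E_{-k}` the pull-back of `G k` for
`k ∈ {1, …, r}`, `k ≠ j₀`. -/
structure Setup where
  N : VB.{u, v} n S
  A : VB.{u, v} n S
  B : VB.{u, v} n S
  r : ℕ
  j₀ : ℕ
  one_le_j₀ : 1 ≤ j₀
  G : {k : ℕ // 1 ≤ k ∧ k ≤ r ∧ k ≠ j₀} → VB.{u, v} n S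

/-- The labels of the summands of `E`. -/
inductive Idx (r j₀ : ℕ) : Type
  | a : Idx r j₀
  | b : Idx r j₀
  | g : {k : ℕ // 1 ≤ k ∧ k ≤ r ∧ k ≠ j₀} → Idx r j₀

namespace Setup

variable (D : Setup.{u, v} n S)

/-- The summands of the graded vector bundle `E|_S`. -/
def E : Idx D.r D.j₀ → VB.{u, v} n S
  | .a => D.A
  | .b => D.B
  | .g k => D.G k

/-- The degrees of the linear coordinates on the summands of `E`. -/
def deg : Idx D.r D.j₀ → ℕ
  | .a => D.j₀
  | .b => D.j₀
  | .g k => k.1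

/-- The body of `E`. -/
abbrev M : Type (max u v) := D.N.Tot

/-- The fibre over `s` of the algebra bundle of `E`. -/
abbrev FibE (s : S) : Type v := Fib D.deg D.E s

/-- The graded symmetric algebra of the dual of a vector space `V` put in degree `k₀`. -/
abbrev FibV (V : Type v) [AddCommGroup V] [Module ℝ V] : Type v :=
  GSym (fun _ : Unit => D.j₀) fun _ : Unit => Module.Dual ℝ V

/-- The fibre over `s` of the algebra bundle of `A`. -/
abbrev FibA (s : S) : Type v := Fib (fun _ : Unit => D.j₀) (fun _ : Unit => D.A) s

/-- Families of elements of the fibres of the algebra bundle of `E`. -/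
abbrev FunE : Type (max u v) := ∀ x : D.M, D.FibE x.proj

/-- Families of elements of the fibres of the algebra bundle of `A`. -/
abbrev FunA : Type (max u v) := ∀ s : S, D.FibA s

/-- `C^∞(E)` in degree `m`. -/
def smoothE (m : ℤ) : Submodule ℝ D.FunE :=
  homFun D.deg D.E ((𝓡 n).prod 𝓘(ℝ, D.N.F)) (fun x : D.M => x.proj) m

/-- `C^∞(A)` in degree `m`. -/
def smoothA (m : ℤ) : Submodule ℝ D.FunA :=
  homFun (fun _ : Unit => D.j₀) (fun _ : Unit => D.A) (𝓡 n) (fun s : S => s) m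

variable {D} in
theorem gen_mul_gen' {V : Type v} [AddCommGroup V] [Module ℝ V] (x y : Module.Dual ℝ V) :
    (GSym.gen (fun _ : Unit => D.j₀) (fun _ : Unit => Module.Dual ℝ V) () x) *
      GSym.gen _ (fun _ : Unit => Module.Dual ℝ V) () y =
    (-1 : ℝ) ^ (D.j₀ * D.j₀) •
      (GSym.gen _ (fun _ : Unit => Module.Dual ℝ V) () y *
        GSym.gen _ (fun _ : Unit => Module.Dual ℝ V) () x) :=
  GSym.gen_mul_gen (deg := fun _ : Unit => D.j₀) (W := fun _ : Unit => Module.Dual ℝ V) () () x y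

/-- The linear coordinates on the fibre of the pull-back of `A`. -/
def genA (s : S) : Module.Dual ℝ (D.A.V s) →ₗ[ℝ] D.FibE s :=
  GSym.gen D.deg (fun i => Module.Dual ℝ ((D.E i).V s)) .a

/-- The linear coordinates on the fibre of the pull-back of `B`. -/
def genB (s : S) : Module.Dual ℝ (D.B.V s) →ₗ[ℝ] D.FibE s :=
  GSym.gen D.deg (fun i => Module.Dual ℝ ((D.E i).V s)) .b

/-- The linear coordinates on the fibre of the pull-back of `G k`. -/
def genG (s : S) (k : {k : ℕ // 1 ≤ k ∧ k ≤ D.r ∧ k ≠ D.j₀}) :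
    Module.Dual ℝ ((D.G k).V s) →ₗ[ℝ] D.FibE s :=
  GSym.gen D.deg (fun i => Module.Dual ℝ ((D.E i).V s)) (.g k)

/-- The pull-back of functions on the fibre of `E` over `s` along the linear map
`(a, b, 0) : V → A_s ⊕ B_s ⊕ ⨁ G_s`, where `V` is in degree `k₀`. -/
def pull (s : S) {V : Type v} [AddCommGroup V] [Module ℝ V] (a : V →ₗ[ℝ] D.A.V s)
    (b : V →ₗ[ℝ] D.B.V s) : D.FibE s →ₐ[ℝ] D.FibV V :=
  GSym.lift _ _
    (fun i => match i with
      | .a => (GSym.gen _ (fun _ : Unit => Module.Dual ℝ V) ()).comp a.dualMap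
      | .b => (GSym.gen _ (fun _ : Unit => Module.Dual ℝ V) ()).comp b.dualMap
      | .g _ => 0) (by
    rintro (_ | _ | i) (_ | _ | j) x y
    all_goals first
      | exact gen_mul_gen' _ _
      | simp)

/-- The pull-back of functions along the projection of the fibre of `E` onto that of `A`. -/
def inclA (s : S) : D.FibA s →ₐ[ℝ] D.FibE s :=
  GSym.lift _ _ (fun _ => D.genA s)
    fun _ _ x y => GSym.gen_mul_gen (deg := D.deg)
      (W := fun i => Module.Dual ℝ ((D.E i).V s)) .a .a x y

/-- The restriction to the fibre of `E_{k₀}`, followed by the pull-back along the projection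
`E → E_{k₀}`: it replaces the linear coordinates on the other summands by zero. -/
def toK₀ (s : S) : D.FibE s →ₐ[ℝ] D.FibE s :=
  GSym.lift _ _
    (fun i => match i with
      | .a => D.genA s
      | .b => D.genB s
      | .g _ => 0) (by
    rintro (_ | _ | i) (_ | _ | j) x y
    all_goals first
      | exact GSym.gen_mul_gen (deg := D.deg)
          (W := fun i => Module.Dual ℝ ((D.E i).V s)) _ _ x y
      | simp)

/-- Homogeneous smooth functions on `E`. -/
structure HFun where
  deg : ℤ
  val : D.FunE
  mem : val ∈ D.smoothE deg

/-- Functions pulled back from `C^∞(A)` along `E → A`. -/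
def fromA : Set D.FunE :=
  {f | ∃ g : D.FunA, IsSmoothFam (fun _ : Unit => D.j₀) (fun _ : Unit => D.A) (𝓡 n)
    (fun s : S => s) g ∧ ∀ x : D.M, f x = D.inclA x.proj (g x.proj)}

/-- Functions on `E` that come from `E_{k₀}`. -/
def fromK₀ : Set D.FunE := {f | ∀ x : D.M, D.toK₀ x.proj (f x) = f x}

/-- The smooth fibrewise linear functions on `N ⊕ B`, i.e. the linear coordinates `y` and `η`. -/
abbrev Lin : Type (max u v) := DualSec D.N ⊕ DualSec D.B

variable {D}

/-- The degree of a linear coordinate. -/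
def linDeg : D.Lin → ℤ
  | .inl _ => 0
  | .inr _ => D.j₀

/-- A linear coordinate as a function on `E`. -/
def linVal : D.Lin → D.FunE
  | .inl f => fun x => algebraMap ℝ _ (f.toFun x.proj x.2)
  | .inr f => fun x => D.genB x.proj (f.toFun x.proj)

/-- A linear coordinate as a homogeneous smooth function on `E`. -/
def linFun (f : D.Lin) : D.HFun where
  deg := linDeg f
  val := linVal f
  mem := by
    cases f with
    | inl f =>
      exact ⟨IsSmoothFam.of_basic _ _ _ _ (Or.inl ⟨_, f.smooth, rfl⟩),
        fun _ => GSym.algebraMap_mem_homog _⟩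
    | inr f =>
      exact ⟨IsSmoothFam.of_basic _ _ _ _ (Or.inr ⟨Idx.b, f, rfl⟩),
        fun x => GSym.gen_mem_homog (deg := D.deg)
          (W := fun i => Module.Dual ℝ ((D.E i).V x.proj)) .b (f.toFun x.proj)⟩

/-! ### Multi-vector fields and the Schouten bracket

A multi-vector field `Z` of shifted total degree `d` is encoded by the multi-brackets
`(f₁, …, f_l) ↦ Z(f₁, …, f_l) = [⋯[[Z, f₁], f₂], ⋯, f_l]`, simultaneously for all `l`; those with
`l` arguments form its component of multiplicity `l`.  A function `f` has shifted degree
`|f| - 1`. -/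

/-- The sum of the shifted degrees. -/
def wt (L : List D.HFun) : ℤ := (L.map fun f => f.deg - 1).sum

variable (D) in
/-- Multi-brackets of shifted degree `d` on `C^∞(E)`. -/
structure Coch (d : ℤ) where
  toFun : List D.HFun → D.FunE
  mem : ∀ L, toFun L ∈ D.smoothE (d + 1 + wt L)

instance (d : ℤ) : Inhabited (Coch D d) := ⟨⟨fun _ => 0, fun _ => zero_mem _⟩⟩

/-- The values of a multi-bracket are homogeneous functions. -/
def Coch.app {d : ℤ} (Z : Coch D d) (L : List D.HFun) : D.HFun := ⟨d + 1 + wt L, Z.toFun L, Z.mem L⟩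

/-- Multi-vector fields of shifted degree `d`: graded symmetric multi-derivations of `C^∞(E)`, with
respect to the shifted degrees of functions, with finitely many multiplicities. -/
structure Coch.IsMultiVectorField {d : ℤ} (Z : Coch D d) : Prop where
  linear : ∀ (L : List D.HFun) (c : ℝ) (f g h : D.HFun), f.deg = h.deg → g.deg = h.deg →
    h.val = c • f.val + g.val →
      Z.toFun (L ++ [h]) = c • Z.toFun (L ++ [f]) + Z.toFun (L ++ [g])
  symm : ∀ (L L' : List D.HFun) (f g : D.HFun),
    Z.toFun (L ++ f :: g :: L') =
      (-1 : ℝ) ^ ((f.deg - 1) * (g.deg - 1)) • Z.toFun (L ++ g :: f :: L')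
  leibniz : ∀ (L : List D.HFun) (f g h : D.HFun), h.deg = f.deg + g.deg → h.val = f.val * g.val →
    Z.toFun (L ++ [h]) = Z.toFun (L ++ [f]) * g.val +
      (-1 : ℝ) ^ ((d + wt L) * f.deg) • (f.val * Z.toFun (L ++ [g]))
  finite : ∃ m : ℕ, ∀ L : List D.HFun, m < L.length → Z.toFun L = 0

/-- All the ways `(T, R)` to unshuffle a list into two, with their Koszul signs. -/
def splits : List D.HFun → List (ℝ × List D.HFun × List D.HFun)
  | [] => [(1, [], [])]
  | f :: L => (splits L).map (fun t => (t.1, f :: t.2.1, t.2.2)) ++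
      (splits L).map fun t => ((-1 : ℝ) ^ ((f.deg - 1) * wt t.2.1) * t.1, t.2.1, f :: t.2.2)

/-- `(Z ∘ Y)(L) = ∑ ± Z(Y(T), R)` over all the unshuffles `(T, R)` of `L`. -/
def comp {d e : ℤ} (Z : Coch D d) (Y : Coch D e) (L : List D.HFun) : D.FunE :=
  ((splits L).map fun t => t.1 • Z.toFun (Y.app t.2.1 :: t.2.2)).sum

theorem wt_splits (L : List D.HFun) : ∀ t ∈ splits L, wt t.2.1 + wt t.2.2 = wt L := by
  induction L with
  | nil => simp [splits, wt]
  | cons f L ih =>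
    intro t ht
    simp only [splits, List.mem_append, List.mem_map] at ht
    rcases ht with ⟨t', h, rfl⟩ | ⟨t', h, rfl⟩ <;>
    · have := ih t' h
      simp only [wt, List.map_cons, List.sum_cons] at this ⊢
      linarith

theorem comp_mem {d e : ℤ} (Z : Coch D d) (Y : Coch D e) (L : List D.HFun) :
    comp Z Y L ∈ D.smoothE (d + e + 1 + wt L) := by
  refine list_sum_mem fun x hx => ?_
  obtain ⟨t, ht, rfl⟩ := List.mem_map.1 hx
  refine Submodule.smul_mem _ _ ?_
  have h := Z.mem (Y.app t.2.1 :: t.2.2)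
  have h2 : d + 1 + wt (Y.app t.2.1 :: t.2.2) = d + e + 1 + wt L := by
    rw [← wt_splits L t ht]
    simp only [wt, List.map_cons, List.sum_cons, Coch.app]
    ring
  rwa [h2] at h

/-- The Schouten-Nijenhuis bracket `[Z, Y] = Z ∘ Y - (-1)^{‖Z‖‖Y‖} Y ∘ Z`. -/
def bracket {d e : ℤ} (Z : Coch D d) (Y : Coch D e) : Coch D (d + e) where
  toFun L := comp Z Y L - (-1 : ℝ) ^ (d * e) • comp Y Z L
  mem L := by
    refine sub_mem (comp_mem Z Y L) (Submodule.smul_mem _ _ ?_)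
    have h := comp_mem Y Z L
    rwa [add_comm e d] at h

variable (D) in
/-- Blended homological vector fields `Q = Q₊ + Q₋` on `E`. -/
structure BlendedQ where
  pos : Coch D 1
  neg : Coch D (-1)
  pos_field : pos.IsMultiVectorField
  neg_field : neg.IsMultiVectorField
  pos_pos : ∀ L, (bracket pos pos).toFun L = 0
  neg_neg : ∀ L, (bracket neg neg).toFun L = 0
  pos_neg : ∀ L, (bracket pos neg).toFun L = 0

/-- `Q(f₁, …, f_l)`. -/
def BlendedQ.eval (Q : BlendedQ D) (L : List D.HFun) : D.FunE := Q.pos.toFun L + Q.neg.toFun L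

/-! ### Submanifolds of coisotropic type, and deformations -/

/-- A function vanishes on the submanifold of `E`, concentrated in degree `k₀`, that has body `T`
and fibres `W x ⊆ A ⊕ B`. -/
def VanishesOn (T : Set D.M) (W : ∀ x : D.M, Submodule ℝ (D.A.V x.proj × D.B.V x.proj))
    (f : D.FunE) : Prop :=
  ∀ x ∈ T, D.pull x.proj ((LinearMap.fst ℝ _ _).comp (W x).subtype)
    ((LinearMap.snd ℝ _ _).comp (W x).subtype) (f x) = 0

/-- The submanifold with body `T` and fibres `W` is of coisotropic type: `Q|_{E_{k₀}}` vanishes on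
its conormal bundle, which is spanned by the differentials of the functions on `E_{k₀}` that vanish
on the submanifold. -/
def IsCoisotropicType (Q : BlendedQ D) (T : Set D.M)
    (W : ∀ x : D.M, Submodule ℝ (D.A.V x.proj × D.B.V x.proj)) : Prop :=
  ∀ L : List D.HFun, (∀ f ∈ L, f.val ∈ D.fromK₀ ∧ VanishesOn T W f.val) →
    VanishesOn T W (Q.eval L)

/-- `A` is of coisotropic type; its body is the zero section of `N`. -/
def IsCoisotropicBase (Q : BlendedQ D) : Prop :=
  IsCoisotropicType Q (Set.range fun s : S => (⟨s, 0⟩ : D.M)) fun _ => Submodule.prod ⊤ ⊥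

/-- The deformations of `A`: pairs `(σ, φ)` such that the graph of `φ`, over the graph of `σ`, is of
coisotropic type. -/
def deformations (Q : BlendedQ D) : Set (Sec D.N × HomSec D.A D.B) :=
  {a | IsCoisotropicType Q (Set.range fun s : S => (⟨s, a.1.toFun s⟩ : D.M))
    fun x => (a.2.toFun x.proj).graph}

/-! ### Analyticity along the fibres of `N` -/

variable (D) in
/-- The functions on `E_{k₀}` that are polynomial along the fibres of `p^! N`. -/
def polyAlong : Subalgebra ℝ D.FunE :=
  Algebra.adjoin ℝ (D.fromA ∪ Set.range (linVal (D := D)))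

/-- On each fibre of `p^! N`, the Maclaurin series of `f` (summed by homogeneous components)
converges to `f`; convergence is that of the coefficients. -/
def IsAnalyticAlong (f : D.FunE) : Prop :=
  ∀ (s : S) (y : D.N.V s) (c : Module.Dual ℝ (D.FibE s)),
    HasSum (fun k : ℕ => ((k.factorial : ℝ)⁻¹) *
      iteratedDeriv k (fun t : ℝ => c (f (⟨s, t • y⟩ : D.M))) 0) (c (f (⟨s, y⟩ : D.M)))

/-- `Q` is analytic along `p^! N`: so is `Q|_{E_{k₀}}(f₁, …, f_l)`, for all polynomial `f_i`. -/
def BlendedQ.IsAnalytic (Q : BlendedQ D) : Prop :=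
  ∀ L : List D.HFun, (∀ f ∈ L, f.val ∈ polyAlong D) →
    IsAnalyticAlong fun x => D.toK₀ x.proj (Q.eval L x)

/-! ### The graded vector space `𝔞`, and the maps `P` and `I` -/

variable (D) in
/-- Families of multi-brackets that take linear coordinates `y`, `η` to functions on `A`. -/
abbrev ACoch : Type (max u v) := List D.Lin → D.FunA

variable (D) in
/-- The component of degree `d` of `𝔞 = Γ(S(A^*) ⊗ S(N[-1] ⊕ B[-1]))[1]`.  A section of
`S(A^*) ⊗ S^l(N[-1] ⊕ B[-1])` is a graded symmetric, `C^∞(S)`-multilinear map from `l` sections of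
`N^* ⊕ B^*` to `C^∞(A)`. -/
def 𝔞 (d : ℤ) : Submodule ℝ (ACoch D) where
  carrier := {α |
    (∀ L, α L ∈ D.smoothA (d + 1 + (L.map fun f => linDeg f - 1).sum)) ∧
    (∀ (L : List D.Lin) (h : S → ℝ) (f g e : DualSec D.N), ContMDiff (𝓡 n) 𝓘(ℝ) ∞ h →
      (∀ s, e.toFun s = h s • f.toFun s + g.toFun s) →
      ∀ s, α (L ++ [.inl e]) s = h s • α (L ++ [.inl f]) s + α (L ++ [.inl g]) s) ∧
    (∀ (L : List D.Lin) (h : S → ℝ) (f g e : DualSec D.B), ContMDiff (𝓡 n) 𝓘(ℝ) ∞ h →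
      (∀ s, e.toFun s = h s • f.toFun s + g.toFun s) →
      ∀ s, α (L ++ [.inr e]) s = h s • α (L ++ [.inr f]) s + α (L ++ [.inr g]) s) ∧
    (∀ (L L' : List D.Lin) (f g : D.Lin), α (L ++ f :: g :: L') =
      (-1 : ℝ) ^ ((linDeg f - 1) * (linDeg g - 1)) • α (L ++ g :: f :: L')) ∧
    ∃ m : ℕ, ∀ L : List D.Lin, m < L.length → α L = 0}
  zero_mem' := ⟨fun _ => zero_mem _, by simp, by simp, by simp, 0, fun _ _ => rfl⟩
  add_mem' := by
    rintro α β ⟨h1, h2, h3, h4, m, h5⟩ ⟨k1, k2, k3, k4, m', k5⟩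
    refine ⟨fun L => add_mem (h1 L) (k1 L), fun L h f g e hh he s => ?_,
      fun L h f g e hh he s => ?_, fun L L' f g => ?_, max m m', fun L hL => ?_⟩
    · simp only [Pi.add_apply, h2 L h f g e hh he s, k2 L h f g e hh he s, smul_add]; abel
    · simp only [Pi.add_apply, h3 L h f g e hh he s, k3 L h f g e hh he s, smul_add]; abel
    · simp only [Pi.add_apply, h4 L L' f g, k4 L L' f g, smul_add]
    · simp [h5 L (by omega), k5 L (by omega)]
  smul_mem' := by
    rintro c α ⟨h1, h2, h3, h4, m, h5⟩
    refine ⟨fun L => Submodule.smul_mem _ c (h1 L), fun L h f g e hh he s => ?_,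
      fun L h f g e hh he s => ?_, fun L L' f g => ?_, m, fun L hL => ?_⟩
    · simp only [Pi.smul_apply, h2 L h f g e hh he s, smul_add, smul_comm c]
    · simp only [Pi.smul_apply, h3 L h f g e hh he s, smul_add, smul_comm c]
    · simp only [Pi.smul_apply, h4 L L' f g, smul_comm c]
    · simp [h5 L hL]

/-- The projection `P`: evaluate on linear coordinates, then restrict to `A`. -/
def P {d : ℤ} (Z : Coch D d) : ACoch D := fun L s =>
  D.pull s LinearMap.id 0 (Z.toFun (L.map linFun) (⟨s, 0⟩ : D.M))

variable (D) in
/-- The multi-vector fields on `E` that are locally sums of `F(x, ξ) ∂_y ∧ ⋯ ∧ ∂_η ∧ ⋯`: they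
annihilate the functions pulled back from `A` and the linear coordinates on the summands `G k`, and
take linear coordinates `y`, `η` to functions pulled back from `A`. -/
def vertical (d : ℤ) : Set (Coch D d) :=
  {Z | Z.IsMultiVectorField ∧
    (∀ (L : List D.HFun) (f : D.HFun), f.val ∈ D.fromA → Z.toFun (L ++ [f]) = 0) ∧
    (∀ (L : List D.HFun) (f : D.HFun) (k) (θ : DualSec (D.G k)),
      (f.val = fun x : D.M => D.genG x.proj k (θ.toFun x.proj)) → Z.toFun (L ++ [f]) = 0) ∧
    ∀ L : List D.Lin, Z.toFun (L.map linFun) ∈ D.fromA}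

/-- The injection `I` of `𝔞` into the multi-vector fields on `E`: the inverse of the restriction of
`P` to its image, the vertical multi-vector fields with coefficients in `C^∞(A)`. -/
def I (d : ℤ) (α : ACoch D) : Coch D d := Function.invFunOn P (vertical D d) α

/-! ### Higher derived brackets and Maurer-Cartan elements -/

/-- `[⋯[[Z, Y₁], Y₂], ⋯, Y_k]`. -/
def iterBracket (Z : Σ d, Coch D d) (Y : List (Σ d, Coch D d)) : Σ d, Coch D d :=
  Y.foldl (fun Z Y => ⟨Z.1 + Y.1, bracket Z.2 Y.2⟩) Z

variable (D) in
/-- Homogeneous elements of `𝔞`. -/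
structure HElt where
  deg : ℤ
  val : ACoch D
  mem : val ∈ 𝔞 D deg

/-- The higher derived brackets `P[⋯[[Z, I a₁], I a₂], ⋯, I a_k]`. -/
def derivedBracket {d : ℤ} (Z : Coch D d) (a : List (HElt D)) : ACoch D :=
  P (iterBracket ⟨d, Z⟩ (a.map fun α => ⟨α.deg, I α.deg α.val⟩)).2

/-- The structure maps `m_k + n_k` of the blended `L_∞`-algebra `𝔞_Q^P`. -/
def structureMap (Q : BlendedQ D) (a : List (HElt D)) : ACoch D :=
  derivedBracket Q.pos a + derivedBracket Q.neg a

variable (D) in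
/-- `𝔞'`: the elements of `𝔞` of multiplicity one. -/
def 𝔞' (d : ℤ) : Submodule ℝ (ACoch D) :=
  𝔞 D d ⊓
    { carrier := {α | ∀ L : List D.Lin, L.length ≠ 1 → α L = 0}
      zero_mem' := fun _ _ => rfl
      add_mem' := fun hα hβ L hL => by simp [hα L hL, hβ L hL]
      smul_mem' := fun c α hα L hL => by simp [hα L hL] }

variable (D) in
/-- The graded subspace of `𝔞` that is `𝔞'` in degree `0`, and `𝔞` in the other degrees. -/
def abar (d : ℤ) : Submodule ℝ (ACoch D) := if d = 0 then 𝔞' D d else 𝔞 D d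

theorem abar_le (d : ℤ) : abar D d ≤ 𝔞 D d := by
  unfold abar
  split_ifs
  · exact inf_le_left
  · exact le_rfl

/-- The Maurer-Cartan elements in `abar`: the elements `v` of degree `0` such that
`∑ (1/k!) (m_k + n_k)(v, …, v)` converges to `0` (coefficient by coefficient, at every point). -/
def maurerCartan (Q : BlendedQ D) : Set (ACoch D) :=
  {v | ∃ hv : v ∈ abar D 0, ∀ (L : List D.Lin) (s : S) (c : Module.Dual ℝ (D.FibA s)),
    HasSum (fun k : ℕ => ((k.factorial : ℝ)⁻¹) *
      c (structureMap Q (List.replicate k ⟨0, v, abar_le 0 hv⟩) L s)) 0}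

/-- `(σ, φ) ∈ Γ(N) ⊕ Γ(A^* ⊗ B)` as an element of `𝔞`: it takes a linear coordinate `y` to the
function `y(σ)` on `S`, and a linear coordinate `η` to the linear function `η ∘ φ` on `A`. -/
def ofSections (a : Sec D.N × HomSec D.A D.B) : ACoch D
  | [.inl f] => fun s => algebraMap ℝ _ (f.toFun s (a.1.toFun s))
  | [.inr f] => fun s => GSym.gen _ (fun _ : Unit => Module.Dual ℝ (D.A.V s)) ()
      ((f.toFun s).comp (a.2.toFun s))
  | _ => 0

end Setup

end GradedQ

end

set_option linter.unusedSectionVars false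

noncomputable section

namespace GradedQ

universe u v w

section

/-! ### Bump functions, local frames and the Hadamard lemma -/

section Bump

variable {X H M : Type*} [NormedAddCommGroup X] [NormedSpace ℝ X] [FiniteDimensional ℝ X]
  [TopologicalSpace H] {I : ModelWithCorners ℝ X H} [TopologicalSpace M] [ChartedSpace H M]
  [T2Space M] [IsManifold I ∞ M]

/-! Write D for the derivation σ ∂_y + φ ∂_η of functions on E, the derivative at t = 0 of
translation along t(σ, φ). The vector field -D is vertical and P sends it to -(σ, φ). Since P is
injective on vertical fields, I(-(σ, φ)) = -D (`I_neg_ofSections`). As -D has degree zero and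
multiplicity one, bracketing a multi-vector field Z with it is the Lie derivative along (σ, φ)
(`bracket_field`): (ℒ Z)(f₁, …, f_l) = D(Z(f₁, …, f_l)) - ∑ Z(f₁, …, D f_i, …, f_l). Hence m_k(v, …,
v) = P(ℒ^k Q) for v = -(σ, φ).

For linear coordinates f_i among the y, η one has D² f_i = 0. Let c(t) be the restriction of Q(f₁ -
t D f₁, …, f_l - t D f_l) to the graph of tφ over tσ. By the product rule, differentiating in t
replaces Q by ℒ Q (`hasWDeriv_pullAt`), so the k-th derivative of c at 0 is the value of m_k(v, …,
v) on the f_i, and the Maurer-Cartan series of v is the Maclaurin series of c at t = 1. It converges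
to c(1) (`IsAnalyticMulti.maclaurin`): the dependence on t through φ and through the arguments is
polynomial, and the dependence through σ is covered by the analyticity of Q.

Now c(1) is the restriction to the graph of Q evaluated on the f_i - D f_i, the linear coordinates
relative to the graph. These determine functions vanishing on the graph to first order, by the
Hadamard lemma, and Q is a multi-derivation; so Q is coisotropic along the graph exactly when all
the c(1) vanish (`IsMultiDer.vanishesOnGraph`). This identifies Maurer-Cartan elements of the form
-(σ, φ) with deformations. That every element of degree zero and multiplicity one has this form is
tensoriality (`exists_ofSections_eq`).

The fibres of the function algebra are given no topology. Derivatives of curves in them are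
therefore tested on all algebraic functionals, and products are differentiated inside finite linear
combinations of fixed vectors with smooth coefficients. -/

variable (I) in
theorem exists_smooth_bump {x : M} {U : Set M} (hU : U ∈ 𝓝 x) :
    ∃ χ : M → ℝ, ContMDiff I 𝓘(ℝ) ∞ χ ∧ χ =ᶠ[𝓝 x] 1 ∧ tsupport χ ⊆ U := by
  obtain ⟨f, -, hf⟩ := (SmoothBumpFunction.nhds_basis_tsupport (I := I) x).mem_iff.1 hU
  exact ⟨f, f.contMDiff, f.eventuallyEq_one, hf⟩

theorem exists_smooth_extension {x : M} {U : Set M} (hU : IsOpen U) (hx : x ∈ U) {g : M → ℝ}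
    (hg : ContMDiffOn I 𝓘(ℝ) ∞ g U) :
    ∃ G : M → ℝ, ContMDiff I 𝓘(ℝ) ∞ G ∧ G =ᶠ[𝓝 x] g := by
  obtain ⟨χ, hχ, h1, hs⟩ := exists_smooth_bump I (hU.mem_nhds hx)
  refine ⟨fun y => χ y * g y, contMDiff_of_tsupport fun y hy => ?_, ?_⟩
  · have hy' : y ∈ U := hs (tsupport_mul_subset_left hy)
    exact (hχ y).mul ((hg y hy').contMDiffAt (hU.mem_nhds hy'))
  · filter_upwards [h1] with y hy
    simp [hy]

end Bump

/-! ### Integrals depending on a parameter, and the Hadamard lemma in coordinates. -/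

section Parametric

open MeasureTheory

/-- The integral is the value at 0 of the convolution of the indicator of (0, 1] with t ↦ χ(t) g(p,
-t). The cut-off χ is 1 on [-1, 1], so it does not change the integral, and it supplies the compact
support required for smooth dependence on p. -/
theorem contDiff_unitInterval_integral {P G : Type*} [NormedAddCommGroup P] [NormedSpace ℝ P]
    [NormedAddCommGroup G] [NormedSpace ℝ G] [CompleteSpace G] {g : P → ℝ → G}
    (hg : ContDiff ℝ ∞ ↿g) : ContDiff ℝ ∞ fun p => ∫ t in (0 : ℝ)..1, g p t := by
  let χ : ContDiffBump (0 : ℝ) := ⟨1, 2, one_pos, one_lt_two⟩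
  let f : ℝ → ℝ := Set.indicator (Set.Ioc 0 1) 1
  let k : P → ℝ → G := fun p t => χ t • g p (-t)
  have hf : LocallyIntegrable f volume :=
    ((integrable_indicator_iff measurableSet_Ioc).2
      (integrableOn_const (by simp) (by simp))).locallyIntegrable
  have h := contDiffOn_convolution_right_with_param_comp (μ := volume) (n := ⊤)
    (ContinuousLinearMap.lsmul ℝ ℝ) (s := Set.univ) (v := fun _ : P => (0 : ℝ))
    (contDiffOn_const) (f := f) (g := k) (k := Metric.closedBall 0 2) isOpen_univ
    (isCompact_closedBall _ _) (by
      intro p x _ hx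
      have : χ x = 0 := by
        apply χ.zero_of_le_dist
        simpa [χ] using (not_le.1 (mt Metric.mem_closedBall.2 hx)).le
      simp [k, this]) hf (by
      apply ContDiff.contDiffOn
      have h2 : ContDiff ℝ ∞ fun q : P × ℝ => χ q.2 • (↿g) (q.1, -q.2) :=
        (χ.contDiff.comp contDiff_snd).smul
          (hg.comp (contDiff_fst.prodMk contDiff_snd.neg))
      exact h2)
  have h' : ContDiff ℝ ∞ _ := contDiffOn_univ.1 h
  convert h' using 2 with p
  rw [intervalIntegral.integral_of_le zero_le_one, convolution,
    ← integral_indicator measurableSet_Ioc]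
  refine integral_congr_ae (Filter.Eventually.of_forall fun t => ?_)
  by_cases ht : t ∈ Set.Ioc (0 : ℝ) 1
  · have : χ (-t) = 1 := by
      apply χ.one_of_mem_closedBall
      simp only [Metric.mem_closedBall, dist_zero_right, norm_neg, Real.norm_eq_abs, χ]
      rw [abs_of_pos ht.1]; exact ht.2
    simp [f, k, ht, this]
  · simp [f, ht]

/-- K is the integral over the segment from w' to w of the partial derivative of k in the direction
F. Both endpoints stay variable, so that w' can later run along a section. -/
theorem exists_contDiff_hadamard {P F : Type*} [NormedAddCommGroup P] [NormedSpace ℝ P]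
    [NormedAddCommGroup F] [NormedSpace ℝ F] {k : P × F → ℝ}
    (hk : ContDiff ℝ ∞ k) : ∃ K : P × F × F → (F →L[ℝ] ℝ), ContDiff ℝ ∞ K ∧
      ∀ p w w', k (p, w) = k (p, w') + K (p, w, w') (w - w') := by
  let q : P × F × F → ℝ → P × F := fun z t => (z.1, z.2.2 + t • (z.2.1 - z.2.2))
  let g : P × F × F → ℝ → (F →L[ℝ] ℝ) := fun z t =>
    (fderiv ℝ k (q z t)).comp (ContinuousLinearMap.inr ℝ P F)
  have hq : ContDiff ℝ ∞ ↿q := by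
    have : ContDiff ℝ ∞ fun z : (P × F × F) × ℝ =>
      ((z.1.1, z.1.2.2 + z.2 • (z.1.2.1 - z.1.2.2)) : P × F) := by fun_prop
    exact this
  have hg : ContDiff ℝ ∞ ↿g := by
    have h1 : ContDiff ℝ ∞ fun z : (P × F × F) × ℝ => fderiv ℝ k ((↿q) z) :=
      (hk.fderiv_right (m := ∞) (by simp)).comp hq
    exact h1.clm_comp contDiff_const
  refine ⟨fun z => ∫ t in (0 : ℝ)..1, g z t, contDiff_unitInterval_integral hg, fun p w w' => ?_⟩
  have hc : Continuous fun t => g (p, w, w') t :=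
    hg.continuous.comp (by fun_prop : Continuous fun t : ℝ => ((p, w, w'), t))
  have hd : ∀ t : ℝ, HasDerivAt (fun t => k (q (p, w, w') t)) (g (p, w, w') t (w - w')) t := by
    intro t
    have h1 : HasDerivAt (fun t => q (p, w, w') t) ((0 : P), w - w') t := by
      have h2 : HasDerivAt (fun t : ℝ => w' + t • (w - w')) (w - w') t := by
        simpa using ((hasDerivAt_id t).smul_const (w - w')).const_add w'
      exact (hasDerivAt_const t p).prodMk h2
    have h3 := (hk.differentiable (by simp) (q (p, w, w') t)).hasFDerivAt.comp_hasDerivAt t h1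
    exact h3
  have h := intervalIntegral.integral_eq_sub_of_hasDerivAt (a := 0) (b := 1) (fun t _ => hd t)
    ((hc.clm_apply continuous_const).intervalIntegrable 0 1)
  rw [ContinuousLinearMap.intervalIntegral_apply (hc.intervalIntegrable 0 1), h]
  simp [q]

end Parametric

variable {n : ℕ} {S : Type u} [TopologicalSpace S] [ChartedSpace (EuclideanSpace ℝ (Fin n)) S]

/-! ### Fibre coordinates on the total space of a vector bundle. -/

namespace VB

instance (E : VB.{u, v} n S) [T2Space S] : T2Space E.Tot := by
  refine ⟨fun x y hxy => ?_⟩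
  by_cases h : x.proj = y.proj
  · let e := trivializationAt E.F E.V x.proj
    have hx : x ∈ e.source := FiberBundle.mem_trivializationAt_proj_source
    have hy : y ∈ e.source := by
      rw [e.mem_source, ← h]; exact FiberBundle.mem_baseSet_trivializationAt' _
    obtain ⟨U, V, hU, hV, hxU, hyV, hUV⟩ := t2_separation
      (fun h' => hxy (e.toOpenPartialHomeomorph.injOn hx hy h') : e x ≠ e y)
    exact ⟨e.source ∩ e ⁻¹' U, e.source ∩ e ⁻¹' V,
      e.toOpenPartialHomeomorph.isOpen_inter_preimage hU,
      e.toOpenPartialHomeomorph.isOpen_inter_preimage hV, ⟨hx, hxU⟩, ⟨hy, hyV⟩,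
      (hUV.preimage e).mono Set.inter_subset_right Set.inter_subset_right⟩
  · exact separated_by_continuous (FiberBundle.continuous_proj E.F E.V) h


variable (E : VB.{u, v} n S)

/-- The preferred trivialization around `s₀`. -/
abbrev triv (s₀ : S) : Trivialization E.F (TotalSpace.proj : E.Tot → S) :=
  trivializationAt E.F E.V s₀

theorem mem_triv (s₀ : S) : s₀ ∈ (E.triv s₀).baseSet := FiberBundle.mem_baseSet_trivializationAt' _

theorem triv_mem_nhds (s₀ : S) : (E.triv s₀).baseSet ∈ 𝓝 s₀ :=
  (E.triv s₀).open_baseSet.mem_nhds (E.mem_triv s₀)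

/-- The linear coordinate on the fibres over the domain of the trivialization around `s₀`. -/
def fib (s₀ s : S) : E.V s →ₗ[ℝ] E.F := (E.triv s₀).linearMapAt ℝ s

theorem fib_apply {s₀ s : S} (hs : s ∈ (E.triv s₀).baseSet) (y : E.V s) :
    E.fib s₀ s y = (E.triv s₀ ⟨s, y⟩).2 := by
  rw [fib, (E.triv s₀).coe_linearMapAt_of_mem hs]

/-- The linear coordinates as an isomorphism. -/
def fibEquiv {s₀ s : S} (hs : s ∈ (E.triv s₀).baseSet) : E.V s ≃ₗ[ℝ] E.F :=
  (E.triv s₀).linearEquivAt ℝ s hs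

theorem fibEquiv_apply {s₀ s : S} (hs : s ∈ (E.triv s₀).baseSet) (y : E.V s) :
    E.fibEquiv hs y = E.fib s₀ s y := by
  rw [E.fib_apply hs]; rfl

instance finiteDimensional_fiber (s : S) : FiniteDimensional ℝ (E.V s) :=
  (E.fibEquiv (E.mem_triv s)).symm.finiteDimensional

theorem contMDiffOn_fib [IsManifold (𝓡 n) ∞ S] (s₀ : S) :
    ContMDiffOn ((𝓡 n).prod 𝓘(ℝ, E.F)) 𝓘(ℝ, E.F) ∞ (fun x : E.Tot => E.fib s₀ x.proj x.2)
      (E.triv s₀).source := by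
  have h := contMDiff_snd.comp_contMDiffOn ((E.triv s₀).contMDiffOn (IB := 𝓡 n) (n := ∞))
  refine h.congr fun x hx => ?_
  rw [E.fib_apply ((E.triv s₀).mem_source.1 hx)]
  rfl

theorem source_mem_nhds {s₀ : S} {x : E.Tot} (hx : x.proj ∈ (E.triv s₀).baseSet) :
    (E.triv s₀).source ∈ 𝓝 x :=
  (E.triv s₀).open_source.mem_nhds ((E.triv s₀).mem_source.2 hx)

theorem contMDiff_totProj :
    ContMDiff ((𝓡 n).prod 𝓘(ℝ, E.F)) (𝓡 n) ∞ (fun x : E.Tot => x.proj) :=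
  contMDiff_proj E.V

theorem continuous_totProj : Continuous (fun x : E.Tot => x.proj) :=
  FiberBundle.continuous_proj E.F E.V

end VB

/-! ### Smooth functions on total spaces, linear coordinates and sections. -/

section Sections

variable {E : VB.{u, v} n S}

instance : Add (DualSec E) := ⟨fun f g => ⟨fun s => f.toFun s + g.toFun s, f.smooth.add g.smooth⟩⟩

/-- The product of a smooth function and a fibrewise linear function. -/
def DualSec.mulFun (h : S → ℝ) (hh : ContMDiff (𝓡 n) 𝓘(ℝ) ∞ h) (f : DualSec E) : DualSec E :=
  ⟨fun s => h s • f.toFun s, (hh.comp E.contMDiff_totProj).mul f.smooth⟩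

instance : Zero (DualSec E) := ⟨⟨fun _ => 0, contMDiff_const⟩⟩

variable [T2Space S] [IsManifold (𝓡 n) ∞ S]

/-- A linear coordinate of a trivialization extends to a global fibrewise linear function, after
shrinking the domain. -/
theorem exists_dualSec_eq (s₀ : S) (l : Module.Dual ℝ E.F) :
    ∃ f : DualSec E, ∀ᶠ s in 𝓝 s₀, f.toFun s = l.comp (E.fib s₀ s) := by
  obtain ⟨χ, hχ, h1, hs⟩ := exists_smooth_bump (𝓡 n) (E.triv_mem_nhds s₀)
  refine ⟨⟨fun s => χ s • l.comp (E.fib s₀ s), ?_⟩, ?_⟩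
  · refine contMDiff_of_tsupport fun x hx => ?_
    have hx' : x.proj ∈ tsupport χ := by
      have h2 : tsupport (fun x : E.Tot => χ x.proj * l (E.fib s₀ x.proj x.2)) ⊆
          (fun x : E.Tot => x.proj) ⁻¹' tsupport χ :=
        (tsupport_mul_subset_left (f := fun x : E.Tot => χ x.proj)).trans
          (tsupport_comp_subset_preimage χ E.continuous_totProj)
      exact h2 hx
    have h3 := ((E.contMDiffOn_fib s₀) x ((E.triv s₀).mem_source.2 (hs hx'))).contMDiffAt
      (E.source_mem_nhds (hs hx'))
    have h4 : ContMDiffAt ((𝓡 n).prod 𝓘(ℝ, E.F)) 𝓘(ℝ) ∞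
        (fun x : E.Tot => (LinearMap.toContinuousLinearMap l) (E.fib s₀ x.proj x.2)) x :=
      (LinearMap.toContinuousLinearMap l).contMDiff.contMDiffAt.comp x h3
    exact ((hχ.comp E.contMDiff_totProj) x).mul h4
  · filter_upwards [h1] with s hs
    simp [hs]

theorem exists_dualSec_through (s₀ : S) (l : Module.Dual ℝ (E.V s₀)) :
    ∃ f : DualSec E, f.toFun s₀ = l := by
  obtain ⟨f, hf⟩ := exists_dualSec_eq (E := E) s₀
    (l.comp (E.fibEquiv (E.mem_triv s₀)).symm.toLinearMap)
  refine ⟨f, ?_⟩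
  rw [hf.self_of_nhds]
  ext y
  simp [← E.fibEquiv_apply (E.mem_triv s₀)]

/-- A map into the total space of a vector bundle is smooth if its composites with the projection
and with all fibrewise linear functions are smooth. -/
theorem contMDiff_of_dualSec {X H M : Type*} [NormedAddCommGroup X] [NormedSpace ℝ X]
    [TopologicalSpace H] {I : ModelWithCorners ℝ X H} [TopologicalSpace M] [ChartedSpace H M]
    {g : M → E.Tot} (hp : ContMDiff I (𝓡 n) ∞ fun x => (g x).proj)
    (hf : ∀ f : DualSec E, ContMDiff I 𝓘(ℝ) ∞ fun x => f.toFun (g x).proj (g x).2) :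
    ContMDiff I ((𝓡 n).prod 𝓘(ℝ, E.F)) ∞ g := by
  intro x
  rw [contMDiffAt_totalSpace]
  refine ⟨hp x, ?_⟩
  let s₀ := (g x).proj
  let b := Module.finBasis ℝ E.F
  have key : ∀ l : Module.Dual ℝ E.F,
      ContMDiffAt I 𝓘(ℝ) ∞ (fun z => l (E.triv s₀ (g z)).2) x := by
    intro l
    obtain ⟨f, h⟩ := exists_dualSec_eq (E := E) s₀ l
    refine (hf f x).congr_of_eventuallyEq ?_
    filter_upwards [hp.continuous.continuousAt.eventually h,
      hp.continuous.continuousAt.eventually (E.triv_mem_nhds s₀)] with z hz hz'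
    rw [hz, LinearMap.comp_apply, E.fib_apply hz']
  have h2 : ContMDiffAt I 𝓘(ℝ, E.F) ∞
      (fun z => ∑ i, b.coord i (E.triv s₀ (g z)).2 • b i) x :=
    contMDiffAt_finsetSum fun i _ => (key (b.coord i)).smul contMDiffAt_const
  refine h2.congr_of_eventuallyEq (Filter.Eventually.of_forall fun z => ?_)
  exact (b.sum_repr _).symm

/-- Near a fibre, a smooth function on the total space is a smooth function of the coordinates. -/
theorem exists_local_model {h : E.Tot → ℝ} (hh : ContMDiff ((𝓡 n).prod 𝓘(ℝ, E.F)) 𝓘(ℝ) ∞ h)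
    (s₀ : S) : ∃ k : EuclideanSpace ℝ (Fin n) × E.F → ℝ, ContDiff ℝ ∞ k ∧
      ∀ᶠ s in 𝓝 s₀, ∀ y : E.V s, h ⟨s, y⟩ = k (extChartAt (𝓡 n) s₀ s, E.fib s₀ s y) := by
  let e := E.triv s₀
  let c := extChartAt (𝓡 n) s₀
  let U : Set (EuclideanSpace ℝ (Fin n)) := c.target ∩ c.symm ⁻¹' e.baseSet
  have hU : IsOpen U := (continuousOn_extChartAt_symm s₀).isOpen_inter_preimage
    (isOpen_extChartAt_target s₀) e.open_baseSet
  have hmem : c s₀ ∈ U := ⟨mem_extChartAt_target s₀, by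
    simpa [c, extChartAt_to_inv] using E.mem_triv s₀⟩
  -- The cut-off acts on the base only: over `U` the fibre coordinate already ranges over all of
  -- `E.F`, so the model is valid on whole fibres.
  obtain ⟨χ, hχ, h1, hs⟩ := exists_smooth_bump 𝓘(ℝ, EuclideanSpace ℝ (Fin n)) (hU.mem_nhds hmem)
  have hk : ContMDiffOn (𝓘(ℝ, EuclideanSpace ℝ (Fin n)).prod 𝓘(ℝ, E.F)) 𝓘(ℝ) ∞
      (fun z : EuclideanSpace ℝ (Fin n) × E.F =>
        h (e.toOpenPartialHomeomorph.symm (c.symm z.1, z.2))) (U ×ˢ Set.univ) := by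
    refine hh.comp_contMDiffOn ?_
    refine (e.contMDiffOn_symm (IB := 𝓡 n) (n := ∞)).comp (t := e.target) ?_ ?_
    · refine ContMDiffOn.prodMk ?_ contMDiffOn_snd
      exact ((contMDiffOn_extChartAt_symm (I := 𝓡 n) (n := ∞) s₀).mono
        Set.inter_subset_left).comp contMDiffOn_fst fun z hz => hz.1
    · intro z hz
      exact e.mem_target.2 hz.1.2
  refine ⟨fun z => χ z.1 * h (e.toOpenPartialHomeomorph.symm (c.symm z.1, z.2)), ?_, ?_⟩
  · rw [contDiff_iff_contDiffAt]
    intro z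
    by_cases hz : z.1 ∈ tsupport χ
    · have hz' : (U ×ˢ (Set.univ : Set E.F)) ∈ 𝓝 z :=
        (hU.prod isOpen_univ).mem_nhds ⟨hs hz, trivial⟩
      have h3 := (hk z ⟨hs hz, trivial⟩).contMDiffAt hz'
      rw [← modelWithCornersSelf_prod, chartedSpaceSelf_prod, contMDiffAt_iff_contDiffAt] at h3
      exact (hχ.contDiff.contDiffAt.comp z contDiffAt_fst).mul h3
    · have : (fun z : EuclideanSpace ℝ (Fin n) × E.F =>
          χ z.1 * h (e.toOpenPartialHomeomorph.symm (c.symm z.1, z.2))) =ᶠ[𝓝 z] fun _ => 0 := by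
        have h4 : ∀ᶠ w in 𝓝 z.1, χ w = 0 := notMem_tsupport_iff_eventuallyEq.1 hz
        filter_upwards [continuousAt_fst.eventually h4] with w hw
        simp [hw]
      exact contDiffAt_const.congr_of_eventuallyEq this
  · have h5 : ∀ᶠ s in 𝓝 s₀, χ (c s) = 1 :=
      (continuousAt_extChartAt s₀).eventually h1
    filter_upwards [h5, E.triv_mem_nhds s₀, extChartAt_source_mem_nhds (I := 𝓡 n) s₀]
      with s h6 h7 h8 y
    simp only [c] at h6 ⊢
    rw [h6, one_mul, (extChartAt (𝓡 n) s₀).left_inv h8, E.fib_apply h7]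
    congr 1
    have h9 : (⟨s, y⟩ : E.Tot) ∈ e.source := e.mem_source.2 h7
    have h10 : (s, (e ⟨s, y⟩).2) = e ⟨s, y⟩ := by
      exact Prod.ext (e.coe_fst h9).symm rfl
    rw [h10]
    exact (e.toOpenPartialHomeomorph.left_inv h9).symm

theorem Sec.contMDiffOn_fib (τ : Sec E) (s₀ : S) :
    ContMDiffOn (𝓡 n) 𝓘(ℝ, E.F) ∞ (fun s => E.fib s₀ s (τ.toFun s)) (E.triv s₀).baseSet :=
  (E.contMDiffOn_fib s₀).comp τ.smooth.contMDiffOn fun _ hs => (E.triv s₀).mem_source.2 hs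

/-- The coordinate neighbourhood of the fibre over `s₀`. -/
def coordNhd (E : VB.{u, v} n S) (s₀ : S) : Set E.Tot :=
  (fun x : E.Tot => x.proj) ⁻¹' ((E.triv s₀).baseSet ∩ (extChartAt (𝓡 n) s₀).source)

theorem isOpen_coordNhd (s₀ : S) : IsOpen (coordNhd E s₀) :=
  ((E.triv s₀).open_baseSet.inter (isOpen_extChartAt_source s₀)).preimage E.continuous_totProj

theorem mem_coordNhd (s₀ : S) (y : E.V s₀) : (⟨s₀, y⟩ : E.Tot) ∈ coordNhd E s₀ :=
  ⟨E.mem_triv s₀, mem_extChartAt_source s₀⟩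

theorem contMDiffOn_coord (τ : Sec E) (s₀ : S) :
    ContMDiffOn ((𝓡 n).prod 𝓘(ℝ, E.F)) 𝓘(ℝ, EuclideanSpace ℝ (Fin n) × E.F × E.F) ∞
      (fun x : E.Tot => (extChartAt (𝓡 n) s₀ x.proj, E.fib s₀ x.proj x.2,
        E.fib s₀ x.proj (τ.toFun x.proj))) (coordNhd E s₀) := by
  have hb : Set.MapsTo (fun x : E.Tot => x.proj) (coordNhd E s₀) (E.triv s₀).baseSet :=
    fun x hx => hx.1
  have hc : Set.MapsTo (fun x : E.Tot => x.proj) (coordNhd E s₀)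
      (chartAt (EuclideanSpace ℝ (Fin n)) s₀).source :=
    fun x hx => by simpa using hx.2
  exact ((contMDiffOn_extChartAt (I := 𝓡 n) (n := ∞) (x := s₀)).comp
    E.contMDiff_totProj.contMDiffOn hc).prodMk_space
    (((E.contMDiffOn_fib s₀).mono fun x hx => (E.triv s₀).mem_source.2 hx.1).prodMk_space
    ((τ.contMDiffOn_fib s₀).comp E.contMDiff_totProj.contMDiffOn hb))

/-- The Hadamard lemma along a section of a vector bundle. -/
theorem exists_hadamard {h : E.Tot → ℝ} (hh : ContMDiff ((𝓡 n).prod 𝓘(ℝ, E.F)) 𝓘(ℝ) ∞ h)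
    (τ : Sec E) (s₀ : S) : ∃ (m : ℕ) (e : Fin m → DualSec E) (k : Fin m → E.Tot → ℝ),
      (∀ i, ContMDiff ((𝓡 n).prod 𝓘(ℝ, E.F)) 𝓘(ℝ) ∞ (k i)) ∧
      ∀ᶠ x in 𝓝 (⟨s₀, τ.toFun s₀⟩ : E.Tot), h x = h ⟨x.proj, τ.toFun x.proj⟩ +
        ∑ i, ((e i).toFun x.proj x.2 - (e i).toFun x.proj (τ.toFun x.proj)) * k i x := by
  obtain ⟨k, hk, hk'⟩ := exists_local_model hh s₀
  obtain ⟨K, hK, hK'⟩ := exists_contDiff_hadamard hk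
  let b := Module.finBasis ℝ E.F
  choose e he using fun i => exists_dualSec_eq (E := E) s₀ (b.coord i)
  -- The components of K are defined only over the coordinate neighbourhood; they are extended to
  -- global functions, without change near the given point.
  have h1 : ∀ i, ∃ G : E.Tot → ℝ, ContMDiff ((𝓡 n).prod 𝓘(ℝ, E.F)) 𝓘(ℝ) ∞ G ∧
      G =ᶠ[𝓝 (⟨s₀, τ.toFun s₀⟩ : E.Tot)] fun x => K (extChartAt (𝓡 n) s₀ x.proj,
        E.fib s₀ x.proj x.2, E.fib s₀ x.proj (τ.toFun x.proj)) (b i) := fun i =>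
    exists_smooth_extension (isOpen_coordNhd s₀) (mem_coordNhd s₀ _)
      ((hK.clm_apply contDiff_const).contMDiff.comp_contMDiffOn (contMDiffOn_coord τ s₀))
  choose G hG hG' using h1
  refine ⟨_, e, G, hG, ?_⟩
  have hproj := (E.continuous_totProj.tendsto (⟨s₀, τ.toFun s₀⟩ : E.Tot))
  filter_upwards [Filter.eventually_all.2 hG', hproj.eventually hk',
    hproj.eventually (Filter.eventually_all.2 he)] with x h2 h3 h4
  rw [h3 (τ.toFun x.proj), show h x = h ⟨x.proj, x.2⟩ from rfl, h3 x.2, hK' _ _ (E.fib s₀ x.proj (τ.toFun x.proj))]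
  congr 1
  conv_lhs => rw [← b.sum_repr (E.fib s₀ x.proj x.2 - E.fib s₀ x.proj (τ.toFun x.proj))]
  rw [map_sum]
  refine Finset.sum_congr rfl fun i _ => ?_
  rw [h2, h4 i]
  simp

/-- The derivative of a smooth function on the total space of a vector bundle in the direction of
a section. -/
theorem exists_vertical_deriv {h : E.Tot → ℝ}
    (hh : ContMDiff ((𝓡 n).prod 𝓘(ℝ, E.F)) 𝓘(ℝ) ∞ h) (τ : Sec E) :
    ∃ h' : E.Tot → ℝ, ContMDiff ((𝓡 n).prod 𝓘(ℝ, E.F)) 𝓘(ℝ) ∞ h' ∧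
      ∀ s (y : E.V s), HasDerivAt (fun t : ℝ => h ⟨s, y + t • τ.toFun s⟩) (h' ⟨s, y⟩) 0 := by
  have key : ∀ s₀, ∃ g : E.Tot → ℝ, ContMDiffOn ((𝓡 n).prod 𝓘(ℝ, E.F)) 𝓘(ℝ) ∞ g
      (coordNhd E s₀) ∧ ∀ᶠ s in 𝓝 s₀, ∀ y : E.V s,
        HasDerivAt (fun t : ℝ => h ⟨s, y + t • τ.toFun s⟩) (g ⟨s, y⟩) 0 := by
    intro s₀
    obtain ⟨k, hk, hk'⟩ := exists_local_model hh s₀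
    have h1 : ContDiff ℝ ∞ fun z : EuclideanSpace ℝ (Fin n) × E.F × E.F =>
        fderiv ℝ k (z.1, z.2.1) (0, z.2.2) :=
      ((hk.fderiv_right (m := ∞) (by simp)).comp
        (contDiff_fst.prodMk (contDiff_fst.comp contDiff_snd))).clm_apply
        (contDiff_const.prodMk (contDiff_snd.comp contDiff_snd))
    refine ⟨_, h1.contMDiff.comp_contMDiffOn (contMDiffOn_coord τ s₀), ?_⟩
    filter_upwards [hk'] with s hs y
    simp only [hs, map_add, map_smul]
    have h2 : HasDerivAt (fun t : ℝ => (extChartAt (𝓡 n) s₀ s,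
        E.fib s₀ s y + t • E.fib s₀ s (τ.toFun s))) (0, E.fib s₀ s (τ.toFun s)) 0 := by
      refine (hasDerivAt_const _ _).prodMk ?_
      simpa using ((hasDerivAt_id (0 : ℝ)).smul_const (E.fib s₀ s (τ.toFun s))).const_add (E.fib s₀ s y)
    have h3 : HasFDerivAt k (fderiv ℝ k (extChartAt (𝓡 n) s₀ s, E.fib s₀ s y))
        (extChartAt (𝓡 n) s₀ s, E.fib s₀ s y + (0 : ℝ) • E.fib s₀ s (τ.toFun s)) := by
      simpa using (hk.differentiable (by simp) (extChartAt (𝓡 n) s₀ s, E.fib s₀ s y)).hasFDerivAt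
    exact h3.comp_hasDerivAt 0 h2
  -- The derivative is defined fibrewise and globally, so nothing has to be glued; the local models
  -- only show that it exists and is smooth.
  refine ⟨fun x => deriv (fun t : ℝ => h ⟨x.proj, x.2 + t • τ.toFun x.proj⟩) 0, ?_, ?_⟩
  · intro x
    obtain ⟨g, hg, hg'⟩ := key x.proj
    refine (((hg x (mem_coordNhd _ _))).contMDiffAt ((isOpen_coordNhd _).mem_nhds
      (mem_coordNhd _ _))).congr_of_eventuallyEq ?_
    filter_upwards [(E.continuous_totProj.tendsto x).eventually hg'] with z hz
    exact (hz z.2).deriv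
  · intro s y
    obtain ⟨g, -, hg'⟩ := key s
    exact (hg'.self_of_nhds y).differentiableAt.hasDerivAt

/-- A smooth function on the total space is smooth along the lines in the fibres. -/
theorem contDiff_along_line {h : E.Tot → ℝ}
    (hh : ContMDiff ((𝓡 n).prod 𝓘(ℝ, E.F)) 𝓘(ℝ) ∞ h) {s : S} (y z : E.V s) :
    ContDiff ℝ ∞ fun t : ℝ => h ⟨s, y + t • z⟩ := by
  obtain ⟨k, hk, hk'⟩ := exists_local_model hh s
  simp only [hk'.self_of_nhds, map_add, map_smul]
  fun_prop

/-- The topology of a single fibre is not assumed compatible with its vector space structure, so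
continuity is obtained through a trivialization. -/
theorem continuous_line {s : S} (y z : E.V s) :
    Continuous fun t : ℝ => (⟨s, y + t • z⟩ : E.Tot) := by
  let e := E.triv s
  have h : Continuous fun t : ℝ => e.toOpenPartialHomeomorph.symm
      (s, E.fib s s y + t • E.fib s s z) := by
    refine continuous_iff_continuousAt.2 fun t => ContinuousAt.comp (g := e.toOpenPartialHomeomorph.symm)
      (f := fun t : ℝ => (s, E.fib s s y + t • E.fib s s z)) ?_ (by fun_prop)
    exact e.toOpenPartialHomeomorph.continuousAt_symm (e.mem_target.2 (E.mem_triv s))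
  refine h.congr fun t => ?_
  rw [← map_smul, ← map_add, E.fib_apply (E.mem_triv s)]
  have h9 : (⟨s, y + t • z⟩ : E.Tot) ∈ e.source := e.mem_source.2 (E.mem_triv s)
  have h10 : (s, (e ⟨s, y + t • z⟩).2) = e ⟨s, y + t • z⟩ := Prod.ext (e.coe_fst h9).symm rfl
  rw [h10]
  exact e.toOpenPartialHomeomorph.left_inv h9

theorem exists_sec_eq (s₀ : S) (w : E.F) :
    ∃ τ : Sec E, ∀ᶠ s in 𝓝 s₀, E.fib s₀ s (τ.toFun s) = w := by
  classical
  obtain ⟨χ, hχ, h1, hs⟩ := exists_smooth_bump (𝓡 n) (E.triv_mem_nhds s₀)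
  let e := E.triv s₀
  refine ⟨⟨fun s => χ s • e.symm s w, contMDiff_of_dualSec contMDiff_id fun f => ?_⟩, ?_⟩
  · have h2 : ∀ s, f.toFun s (χ s • e.symm s w) = χ s * f.toFun s (e.symm s w) := by simp
    simp only [h2]
    refine contMDiff_of_tsupport fun s hs' => ?_
    have hs1 : s ∈ e.baseSet := hs (tsupport_mul_subset_left hs')
    refine (hχ s).mul ?_
    have h3 : ContMDiffOn (𝓡 n) ((𝓡 n).prod 𝓘(ℝ, E.F)) ∞
        (fun s => (⟨s, e.symm s w⟩ : E.Tot)) e.baseSet := by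
      rw [e.contMDiffOn_iff (fun s hs => e.mem_source.2 hs)]
      refine ⟨contMDiffOn_id, (contMDiffOn_const (c := w)).congr fun s hs => ?_⟩
      exact congrArg Prod.snd (e.apply_mk_symm hs w)
    exact (f.smooth.comp_contMDiffOn h3 s hs1).contMDiffAt (e.open_baseSet.mem_nhds hs1)
  · filter_upwards [h1, E.triv_mem_nhds s₀] with s h4 h5
    simp only [h4, Pi.one_apply, one_smul]
    rw [E.fib_apply h5]
    exact congrArg Prod.snd (e.apply_mk_symm h5 w)

theorem exists_sec_through (s₀ : S) (y : E.V s₀) : ∃ τ : Sec E, τ.toFun s₀ = y := by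
  obtain ⟨τ, hτ⟩ := exists_sec_eq (E := E) s₀ (E.fib s₀ s₀ y)
  refine ⟨τ, (E.fibEquiv (E.mem_triv s₀)).injective ?_⟩
  rw [E.fibEquiv_apply, E.fibEquiv_apply, hτ.self_of_nhds]

end Sections

end

section

/-! ### More on graded symmetric algebras -/

section GSymMore

variable {κ : Type w} {deg : κ → ℕ} {W : κ → Type v}
  [∀ i, AddCommGroup (W i)] [∀ i, Module ℝ (W i)]

theorem GSym.algHom_ext {R : Type*} [Ring R] [Algebra ℝ R] {f g : GSym deg W →ₐ[ℝ] R}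
    (h : ∀ i x, f (GSym.gen deg W i x) = g (GSym.gen deg W i x)) : f = g := by
  classical
  refine RingQuot.ringQuot_ext' (S := ℝ) (s := GSymRel deg W) f g ?_
  refine TensorAlgebra.hom_ext ?_
  refine DirectSum.linearMap_ext ℝ fun i => ?_
  ext x
  exact h i x

theorem GSym.homog_mul_mem {m m' : ℤ} {x y : GSym deg W} (hx : x ∈ GSym.homog deg W m)
    (hy : y ∈ GSym.homog deg W m') : x * y ∈ GSym.homog deg W (m + m') := by
  refine Submodule.span_induction₂ (p := fun x y _ _ => x * y ∈ GSym.homog deg W (m + m'))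
    ?_ (by simp) (by simp) ?_ ?_ ?_ ?_ hx hy
  · rintro _ _ ⟨L, rfl, rfl⟩ ⟨L', rfl, rfl⟩
    exact Submodule.subset_span ⟨L ++ L', by simp, by simp⟩
  · intro x y z _ _ _ h1 h2
    rw [add_mul]; exact add_mem h1 h2
  · intro x y z _ _ _ h1 h2
    rw [mul_add]; exact add_mem h1 h2
  · intro r x y _ _ h
    rw [smul_mul_assoc]; exact Submodule.smul_mem _ _ h
  · intro r x y _ _ h
    rw [mul_smul_comm]; exact Submodule.smul_mem _ _ h

theorem GSym.one_mem_homog : (1 : GSym deg W) ∈ GSym.homog deg W 0 := by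
  simpa using GSym.algebraMap_mem_homog (deg := deg) (W := W) 1

/-- A linear map on the span of monomials. -/
theorem GSym.map_mem_of_monomial {R : Type*} [AddCommGroup R] [Module ℝ R] (U : Submodule ℝ R)
    (θ : GSym deg W →ₗ[ℝ] R) {m : ℤ} (h : ∀ L : List (Σ i, W i),
      ((L.map fun a => deg a.1).sum : ℤ) = m →
        θ (L.map fun a => GSym.gen deg W a.1 a.2).prod ∈ U)
    {x : GSym deg W} (hx : x ∈ GSym.homog deg W m) : θ x ∈ U := by
  refine (Submodule.span_le (p := U.comap θ)).2 ?_ hx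
  rintro _ ⟨L, hL, rfl⟩
  exact h L hL

theorem GSym.map_homog {κ' : Type*} {deg' : κ' → ℕ} {W' : κ' → Type*}
    [∀ i, AddCommGroup (W' i)] [∀ i, Module ℝ (W' i)] (θ : GSym deg W →ₐ[ℝ] GSym deg' W')
    (h : ∀ i x, θ (GSym.gen deg W i x) ∈ GSym.homog deg' W' (deg i)) {m : ℤ} {x : GSym deg W}
    (hx : x ∈ GSym.homog deg W m) : θ x ∈ GSym.homog deg' W' m := by
  refine GSym.map_mem_of_monomial _ θ.toLinearMap (fun L hL => ?_) hx
  subst hL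
  clear hx
  induction L with
  | nil => simpa using GSym.one_mem_homog
  | cons a L ih =>
    simp only [List.map_cons, List.prod_cons, AlgHom.toLinearMap_apply, map_mul, List.sum_cons,
      Nat.cast_add] at ih ⊢
    exact GSym.homog_mul_mem (h _ _) ih

theorem GSym.homog_neg {m : ℤ} (hm : m < 0) {x : GSym deg W} (hx : x ∈ GSym.homog deg W m) :
    x = 0 := by
  refine (Submodule.mem_bot ℝ).1 (GSym.map_mem_of_monomial ⊥ LinearMap.id (fun L hL => ?_) hx)
  omega

open Polynomial in
-- Degrees add up along monomials. This bounds the power of t that appears on restriction to the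
-- graph of tφ.
theorem GSym.natDegree_le {R : Type*} [Ring R] [Algebra ℝ R] (θ : GSym deg W →ₐ[ℝ] R[X])
    (h : ∀ i x, (θ (GSym.gen deg W i x)).natDegree ≤ deg i) {m : ℤ} {x : GSym deg W}
    (hx : x ∈ GSym.homog deg W m) : (θ x).natDegree ≤ m.toNat := by
  have : θ x ∈ Polynomial.degreeLE R m.toNat := by
    refine GSym.map_mem_of_monomial ((Polynomial.degreeLE R m.toNat).restrictScalars ℝ)
      θ.toLinearMap (fun L hL => ?_) hx
    subst hL
    rw [Submodule.restrictScalars_mem, Polynomial.mem_degreeLE, ← Polynomial.natDegree_le_iff_degree_le]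
    rw [Int.toNat_natCast]
    clear hx
    induction L with
    | nil => simp
    | cons a L ih =>
      simp only [List.map_cons, List.prod_cons, AlgHom.toLinearMap_apply, map_mul,
        List.sum_cons] at ih ⊢
      exact Polynomial.natDegree_mul_le.trans (add_le_add (h _ _) ih)
  rwa [Polynomial.mem_degreeLE, ← Polynomial.natDegree_le_iff_degree_le] at this

/-- Multiplication of the elements of degree `m` by `X ^ m`. -/
def GSym.gradeHom : GSym deg W →ₐ[ℝ] Polynomial (GSym deg W) :=
  GSym.lift deg W
    (fun i => ((Polynomial.monomial (deg i)).restrictScalars ℝ).comp (GSym.gen deg W i)) (by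
    intro i j x y
    simp only [LinearMap.comp_apply, LinearMap.restrictScalars_apply,
      Polynomial.monomial_mul_monomial, Polynomial.smul_monomial, add_comm (deg j)]
    rw [GSym.gen_mul_gen])

/-- The projection onto the part of degree `m`. -/
def GSym.gradeProj (m : ℕ) : GSym deg W →ₗ[ℝ] GSym deg W :=
  ((Polynomial.lcoeff (GSym deg W) m).restrictScalars ℝ).comp GSym.gradeHom.toLinearMap

theorem GSym.gradeHom_of_mem {m : ℕ} {x : GSym deg W} (hx : x ∈ GSym.homog deg W m) :
    GSym.gradeHom x = Polynomial.monomial m x := by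
  have : (GSym.gradeHom.toLinearMap - (Polynomial.monomial m).restrictScalars ℝ :
      GSym deg W →ₗ[ℝ] _) x ∈ (⊥ : Submodule ℝ (Polynomial (GSym deg W))) := by
    refine GSym.map_mem_of_monomial ⊥ _ (fun L hL => ?_) hx
    norm_cast at hL
    subst hL
    rw [Submodule.mem_bot, LinearMap.sub_apply, sub_eq_zero]
    clear hx
    induction L with
    | nil => simp
    | cons a L ih =>
      simp only [List.map_cons, List.prod_cons, AlgHom.toLinearMap_apply, map_mul, List.sum_cons,
        LinearMap.restrictScalars_apply] at ih ⊢
      rw [ih, GSym.gradeHom, GSym.lift_gen]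
      simp [Polynomial.monomial_mul_monomial]
  simpa [sub_eq_zero] using this

/-- Used to cut an inhomogeneous polynomial representative of a homogeneous function down to the
relevant degree. -/
theorem GSym.gradeProj_of_mem {m k : ℕ} {x : GSym deg W} (hx : x ∈ GSym.homog deg W m) :
    GSym.gradeProj k x = if m = k then x else 0 := by
  simp [GSym.gradeProj, GSym.gradeHom_of_mem hx, Polynomial.coeff_monomial]

/-- The restriction to first order jets at the origin, in the direction `ℓ`. -/
def GSym.jet (ℓ : ∀ i, W i →ₗ[ℝ] ℝ) : GSym deg W →ₐ[ℝ] DualNumber ℝ :=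
  -- Products of two infinitesimals vanish, so graded commutativity holds in the dual numbers for
  -- even and odd generators alike.
  GSym.lift deg W (fun i => (TrivSqZeroExt.inrHom ℝ ℝ).comp (ℓ i)) (by
    intro i j x y
    simp)

theorem GSym.jet_gen (ℓ : ∀ i, W i →ₗ[ℝ] ℝ) (i : κ) (x : W i) :
    GSym.jet ℓ (GSym.gen deg W i x) = TrivSqZeroExt.inr (ℓ i x) := by
  simp [GSym.jet, GSym.lift_gen]

theorem GSym.algebraMap_injective : Function.Injective (algebraMap ℝ (GSym deg W)) := by
  intro a b h
  have := congrArg (GSym.jet (deg := deg) (W := W) fun _ => 0) h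
  rw [AlgHom.commutes, AlgHom.commutes] at this
  exact congrArg TrivSqZeroExt.fst this

/-- First order jets see a generator also when it is odd: the jet in the direction of a functional c
on the i-th summand sends the generator of x to c(x), and such c separate points. -/
theorem GSym.gen_injective (i : κ) : Function.Injective (GSym.gen deg W i) := by
  classical
  rw [← LinearMap.ker_eq_bot, Submodule.eq_bot_iff]
  intro x hx
  rw [LinearMap.mem_ker] at hx
  refine (Module.forall_dual_apply_eq_zero_iff ℝ x).1 fun c => ?_
  have := congrArg (GSym.jet (deg := deg) (W := W)
    fun j => if h : j = i then h ▸ c else 0) hx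
  rw [GSym.jet_gen] at this
  simpa using congrArg TrivSqZeroExt.snd this

/-- All generators have positive degree, so the empty monomial is the only one of degree zero. -/
theorem GSym.exists_of_mem_homog_zero (hdeg : ∀ i, 1 ≤ deg i) {x : GSym deg W}
    (hx : x ∈ GSym.homog deg W 0) : ∃ c : ℝ, x = algebraMap ℝ _ c := by
  have : x ∈ LinearMap.range (Algebra.linearMap ℝ (GSym deg W)) := by
    refine GSym.map_mem_of_monomial _ LinearMap.id (fun L hL => ?_) hx
    cases L with
    | nil => exact ⟨1, by simp⟩
    | cons a L =>
      exfalso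
      norm_cast at hL
      simp only [List.map_cons, List.sum_cons] at hL
      have := hdeg a.1
      omega
  obtain ⟨c, hc⟩ := this
  exact ⟨c, hc.symm⟩

/-- With all generators in degree j ≥ 1, a monomial of degree j has exactly one factor. -/
theorem GSym.exists_of_mem_homog_deg {j : ℕ} (hj : 1 ≤ j) {V : Type v} [AddCommGroup V]
    [Module ℝ V] {x : GSym (fun _ : Unit => j) fun _ : Unit => V}
    (hx : x ∈ GSym.homog (fun _ : Unit => j) (fun _ : Unit => V) j) :
    ∃ y : V, x = GSym.gen (fun _ : Unit => j) (fun _ : Unit => V) () y := by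
  have : x ∈ LinearMap.range (GSym.gen (fun _ : Unit => j) (fun _ : Unit => V) ()) := by
    refine GSym.map_mem_of_monomial _ LinearMap.id (fun L hL => ?_) hx
    match L with
    | [] => simp at hL; omega
    | [a] => exact ⟨a.2, by simp⟩
    | a :: b :: L =>
      exfalso
      norm_cast at hL
      simp only [List.map_cons, List.sum_cons] at hL
      omega
  obtain ⟨c, hc⟩ := this
  exact ⟨c, hc.symm⟩

end GSymMore

open Polynomial in
/-- Evaluation of a polynomial at a scalar. -/
def evalScalar (R : Type*) [Ring R] [Algebra ℝ R] (t : ℝ) : R[X] →ₐ[ℝ] R where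
  toRingHom := Polynomial.eval₂RingHom' (RingHom.id R) (algebraMap ℝ R t)
    fun a => (Algebra.commutes t a).symm
  commutes' r := by
    change (C (algebraMap ℝ R r)).eval₂ (RingHom.id R) (algebraMap ℝ R t) = _
    simp

open Polynomial in
theorem evalScalar_apply {R : Type*} [Ring R] [Algebra ℝ R] (t : ℝ) (p : R[X]) :
    evalScalar R t p = p.sum fun j a => t ^ j • a := by
  change p.eval₂ (RingHom.id R) (algebraMap ℝ R t) = _
  rw [eval₂_eq_sum]
  refine Finset.sum_congr rfl fun j _ => ?_
  beta_reduce
  rw [Algebra.smul_def, map_pow, ← map_pow, Algebra.commutes]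
  rfl

variable {n : ℕ} {S : Type u} [TopologicalSpace S] [ChartedSpace (EuclideanSpace ℝ (Fin n)) S]

/-! ### Restriction and pull-back homomorphisms between the fibre algebras. -/

namespace Setup

variable (D : Setup.{u, v} n S)

theorem one_le_deg (i : Idx D.r D.j₀) : 1 ≤ D.deg i := by
  rcases i with _ | _ | k
  · exact D.one_le_j₀
  · exact D.one_le_j₀
  · exact k.2.1

variable {D}

theorem fibE_ext {R : Type*} [Ring R] [Algebra ℝ R] {s : S} {f g : D.FibE s →ₐ[ℝ] R}
    (ha : ∀ x, f (D.genA s x) = g (D.genA s x)) (hb : ∀ x, f (D.genB s x) = g (D.genB s x))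
    (hg : ∀ k x, f (D.genG s k x) = g (D.genG s k x)) : f = g := by
  refine GSym.algHom_ext ?_
  rintro (_ | _ | k) x
  · exact ha x
  · exact hb x
  · exact hg k x

section Pull

variable {s : S} {V : Type v} [AddCommGroup V] [Module ℝ V]

variable (D) in
/-- The linear coordinates on a vector space in degree `k₀`. -/
abbrev genV (V : Type v) [AddCommGroup V] [Module ℝ V] : Module.Dual ℝ V →ₗ[ℝ] D.FibV V :=
  GSym.gen (fun _ : Unit => D.j₀) (fun _ : Unit => Module.Dual ℝ V) ()

@[simp] theorem pull_genA (a : V →ₗ[ℝ] D.A.V s) (b : V →ₗ[ℝ] D.B.V s) (x) :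
    D.pull s a b (D.genA s x) = D.genV V (x.comp a) := GSym.lift_gen _ _ _ _

@[simp] theorem pull_genB (a : V →ₗ[ℝ] D.A.V s) (b : V →ₗ[ℝ] D.B.V s) (x) :
    D.pull s a b (D.genB s x) = D.genV V (x.comp b) := GSym.lift_gen _ _ _ _

@[simp] theorem pull_genG (a : V →ₗ[ℝ] D.A.V s) (b : V →ₗ[ℝ] D.B.V s) (k x) :
    D.pull s a b (D.genG s k x) = 0 := GSym.lift_gen _ _ _ _

@[simp] theorem toK₀_genA (x) : D.toK₀ s (D.genA s x) = D.genA s x := GSym.lift_gen _ _ _ _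

@[simp] theorem toK₀_genB (x) : D.toK₀ s (D.genB s x) = D.genB s x := GSym.lift_gen _ _ _ _

@[simp] theorem toK₀_genG (k x) : D.toK₀ s (D.genG s k x) = 0 := GSym.lift_gen _ _ _ _

@[simp] theorem inclA_gen (x : Module.Dual ℝ (D.A.V s)) :
    D.inclA s (D.genV (D.A.V s) x) = D.genA s x := GSym.lift_gen _ _ _ _

theorem pull_comp_toK₀ (a : V →ₗ[ℝ] D.A.V s) (b : V →ₗ[ℝ] D.B.V s) :
    (D.pull s a b).comp (D.toK₀ s) = D.pull s a b :=
  fibE_ext (by simp) (by simp) (by simp)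

theorem pull_toK₀ (a : V →ₗ[ℝ] D.A.V s) (b : V →ₗ[ℝ] D.B.V s) (x : D.FibE s) :
    D.pull s a b (D.toK₀ s x) = D.pull s a b x :=
  DFunLike.congr_fun (pull_comp_toK₀ a b) x

theorem fibV_ext {R : Type*} [Ring R] [Algebra ℝ R] {f g : D.FibV V →ₐ[ℝ] R}
    (h : ∀ x, f (D.genV V x) = g (D.genV V x)) : f = g :=
  GSym.algHom_ext fun _ x => h x

theorem pull_inclA (φ : D.A.V s →ₗ[ℝ] D.B.V s) (x : D.FibA s) :
    D.pull s LinearMap.id φ (D.inclA s x) = x :=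
  DFunLike.congr_fun (fibV_ext (fun x => by simp) :
    (D.pull s LinearMap.id φ).comp (D.inclA s) = AlgHom.id ℝ _) x

variable (D) in
/-- Pull-back of functions along a linear map of vector spaces in degree `k₀`. -/
def mapV {V' : Type v} [AddCommGroup V'] [Module ℝ V'] (e : V' →ₗ[ℝ] V) :
    D.FibV V →ₐ[ℝ] D.FibV V' :=
  GSym.lift _ _ (fun _ => (D.genV V').comp e.dualMap) fun _ _ _ _ => gen_mul_gen' _ _

@[simp] theorem mapV_gen {V' : Type v} [AddCommGroup V'] [Module ℝ V'] (e : V' →ₗ[ℝ] V) (x) :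
    D.mapV e (D.genV V x) = D.genV V' (x.comp e) := GSym.lift_gen _ _ _ _

theorem mapV_pull {V' : Type v} [AddCommGroup V'] [Module ℝ V'] (e : V' →ₗ[ℝ] V)
    (a : V →ₗ[ℝ] D.A.V s) (b : V →ₗ[ℝ] D.B.V s) (x : D.FibE s) :
    D.mapV e (D.pull s a b x) = D.pull s (a.comp e) (b.comp e) x :=
  DFunLike.congr_fun (fibE_ext (by simp [LinearMap.comp_assoc]) (by simp [LinearMap.comp_assoc])
    (by simp) : (D.mapV e).comp (D.pull s a b) = D.pull s (a.comp e) (b.comp e)) x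

/-- Vanishing on a graph, in terms of its parametrization. -/
theorem pull_graph_eq_zero_iff (φ : D.A.V s →ₗ[ℝ] D.B.V s) (x : D.FibE s) :
    D.pull s ((LinearMap.fst ℝ _ _).comp φ.graph.subtype)
      ((LinearMap.snd ℝ _ _).comp φ.graph.subtype) x = 0 ↔
    D.pull s LinearMap.id φ x = 0 := by
  constructor
  · intro h
    let e : D.A.V s →ₗ[ℝ] φ.graph := (LinearMap.id.prod φ).codRestrict _ (by simp)
    have := congrArg (D.mapV e) h
    rw [mapV_pull, map_zero] at this
    exact this
  · intro h
    let e : φ.graph →ₗ[ℝ] D.A.V s := (LinearMap.fst ℝ _ _).comp φ.graph.subtype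
    have := congrArg (D.mapV e) h
    rw [mapV_pull, map_zero] at this
    have he : (LinearMap.snd ℝ _ _).comp φ.graph.subtype = φ.comp e := by
      ext ⟨z, hz⟩
      simpa [e] using hz
    rw [he]
    exact this

end Pull

/-! ### Shears -/

section Shear

/-- A and B sit in the same degree j₀, so η + φ^*ξ is homogeneous and obeys the same sign rule as η.
With `gcomm_genG` this makes `shear` well defined. -/
theorem gcomm_genA_genB {s : S} (x y : Module.Dual ℝ (D.A.V s)) (z w : Module.Dual ℝ (D.B.V s)) :
    (D.genB s z + D.genA s x) * (D.genB s w + D.genA s y) = (-1 : ℝ) ^ (D.j₀ * D.j₀) •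
      ((D.genB s w + D.genA s y) * (D.genB s z + D.genA s x)) := by
  have h1 : ∀ i j (x) (y), GSym.gen D.deg (fun i => Module.Dual ℝ ((D.E i).V s)) i x *
      GSym.gen D.deg _ j y = _ := GSym.gen_mul_gen
  have haa := h1 .a .a x y
  have hab := h1 .a .b x w
  have hba := h1 .b .a z y
  have hbb := h1 .b .b z w
  change D.genA s x * D.genA s y = (-1 : ℝ) ^ (D.j₀ * D.j₀) • (D.genA s y * D.genA s x) at haa
  change D.genA s x * D.genB s w = (-1 : ℝ) ^ (D.j₀ * D.j₀) • (D.genB s w * D.genA s x) at hab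
  change D.genB s z * D.genA s y = (-1 : ℝ) ^ (D.j₀ * D.j₀) • (D.genA s y * D.genB s z) at hba
  change D.genB s z * D.genB s w = (-1 : ℝ) ^ (D.j₀ * D.j₀) • (D.genB s w * D.genB s z) at hbb
  simp only [add_mul, mul_add, smul_add]
  rw [haa, hab, hba, hbb]
  abel

theorem gcomm_genG {s : S} (k) (g : Module.Dual ℝ ((D.G k).V s)) (x : Module.Dual ℝ (D.A.V s))
    (z : Module.Dual ℝ (D.B.V s)) :
    (D.genB s z + D.genA s x) * D.genG s k g = (-1 : ℝ) ^ (D.j₀ * k.1) •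
      (D.genG s k g * (D.genB s z + D.genA s x)) := by
  have h1 : ∀ i j (x) (y), GSym.gen D.deg (fun i => Module.Dual ℝ ((D.E i).V s)) i x *
      GSym.gen D.deg _ j y = _ := GSym.gen_mul_gen
  have ha := h1 .a (.g k) x g
  have hb := h1 .b (.g k) z g
  change D.genA s x * D.genG s k g = (-1 : ℝ) ^ (D.j₀ * k.1) • (D.genG s k g * D.genA s x) at ha
  change D.genB s z * D.genG s k g = (-1 : ℝ) ^ (D.j₀ * k.1) • (D.genG s k g * D.genB s z) at hb
  simp only [add_mul, mul_add, smul_add]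
  rw [ha, hb]

variable (D) in
/-- The pull-back along the automorphism `(a, b, g) ↦ (a, b + φ a, g)` of the fibre of `E`. -/
def shear (s : S) (φ : D.A.V s →ₗ[ℝ] D.B.V s) : D.FibE s →ₐ[ℝ] D.FibE s :=
  GSym.lift _ _
    (fun i => match i with
      | .a => D.genA s
      | .b => D.genB s + (D.genA s).comp φ.dualMap
      | .g k => D.genG s k) (by
    rintro (_ | _ | i) (_ | _ | j) x y
    · exact GSym.gen_mul_gen (deg := D.deg) (W := fun i => Module.Dual ℝ ((D.E i).V s)) _ _ x y
    · have h := gcomm_genA_genB x (φ.dualMap y) 0 y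
      rw [map_zero, zero_add] at h
      exact h
    · exact GSym.gen_mul_gen (deg := D.deg) (W := fun i => Module.Dual ℝ ((D.E i).V s)) _ _ x y
    · have h := gcomm_genA_genB (φ.dualMap x) y x 0
      rw [map_zero, zero_add] at h
      exact h
    · exact gcomm_genA_genB (φ.dualMap x) (φ.dualMap y) x y
    · exact gcomm_genG j y (φ.dualMap x) x
    · exact GSym.gen_mul_gen (deg := D.deg) (W := fun i => Module.Dual ℝ ((D.E i).V s)) _ _ x y
    · have h := gcomm_genG i x (φ.dualMap y) y
      change D.genG s i x * (D.genB s y + D.genA s (φ.dualMap y)) =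
        (-1 : ℝ) ^ (i.1 * D.j₀) • ((D.genB s y + D.genA s (φ.dualMap y)) * D.genG s i x)
      rw [h, smul_smul, mul_comm i.1, ← mul_pow]
      simp
    · exact GSym.gen_mul_gen (deg := D.deg) (W := fun i => Module.Dual ℝ ((D.E i).V s)) _ _ x y)

variable {s : S}

@[simp] theorem shear_genA (φ : D.A.V s →ₗ[ℝ] D.B.V s) (x) :
    D.shear s φ (D.genA s x) = D.genA s x := GSym.lift_gen _ _ _ _

@[simp] theorem shear_genB (φ : D.A.V s →ₗ[ℝ] D.B.V s) (x) :
    D.shear s φ (D.genB s x) = D.genB s x + D.genA s (x.comp φ) := GSym.lift_gen _ _ _ _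

@[simp] theorem shear_genG (φ : D.A.V s →ₗ[ℝ] D.B.V s) (k x) :
    D.shear s φ (D.genG s k x) = D.genG s k x := GSym.lift_gen _ _ _ _

/-- The shears by tφ form a one-parameter group; this reduces derivatives at any time t to
derivatives at time 0. -/
theorem shear_shear (φ ψ : D.A.V s →ₗ[ℝ] D.B.V s) (x : D.FibE s) :
    D.shear s φ (D.shear s ψ x) = D.shear s (φ + ψ) x :=
  DFunLike.congr_fun (fibE_ext (by simp)
    (fun x => by simp [LinearMap.comp_add, map_add, add_assoc]) (by simp) :
    (D.shear s φ).comp (D.shear s ψ) = D.shear s (φ + ψ)) x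

theorem pull_shear (φ : D.A.V s →ₗ[ℝ] D.B.V s) (x : D.FibE s) :
    D.pull s LinearMap.id 0 (D.shear s φ x) = D.pull s LinearMap.id φ x :=
  DFunLike.congr_fun (fibE_ext (by simp) (by simp) (by simp) :
    (D.pull s LinearMap.id 0).comp (D.shear s φ) = D.pull s LinearMap.id φ) x

theorem shear_zero (x : D.FibE s) : D.shear s 0 x = x :=
  DFunLike.congr_fun (fibE_ext (by simp) (by simp) (by simp) :
    D.shear s 0 = AlgHom.id ℝ _) x

theorem shear_inclA (φ : D.A.V s →ₗ[ℝ] D.B.V s) (x : D.FibA s) :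
    D.shear s φ (D.inclA s x) = D.inclA s x :=
  DFunLike.congr_fun (fibV_ext (fun x => by simp) :
    (D.shear s φ).comp (D.inclA s) = D.inclA s) x

theorem genA_mem_homog (x : Module.Dual ℝ (D.A.V s)) :
    D.genA s x ∈ GSym.homog D.deg (fun i => Module.Dual ℝ ((D.E i).V s)) D.j₀ :=
  GSym.gen_mem_homog (deg := D.deg) (W := fun i => Module.Dual ℝ ((D.E i).V s)) .a x

theorem genB_mem_homog (x : Module.Dual ℝ (D.B.V s)) :
    D.genB s x ∈ GSym.homog D.deg (fun i => Module.Dual ℝ ((D.E i).V s)) D.j₀ :=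
  GSym.gen_mem_homog (deg := D.deg) (W := fun i => Module.Dual ℝ ((D.E i).V s)) .b x

theorem genG_mem_homog (k) (x : Module.Dual ℝ ((D.G k).V s)) :
    D.genG s k x ∈ GSym.homog D.deg (fun i => Module.Dual ℝ ((D.E i).V s)) (k.1 : ℕ) :=
  GSym.gen_mem_homog (deg := D.deg) (W := fun i => Module.Dual ℝ ((D.E i).V s)) (.g k) x

theorem shear_homog (φ : D.A.V s →ₗ[ℝ] D.B.V s) {m : ℤ} {x : D.FibE s}
    (hx : x ∈ GSym.homog D.deg _ m) : D.shear s φ x ∈ GSym.homog D.deg _ m := by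
  refine GSym.map_homog _ ?_ hx
  rintro (_ | _ | k) x
  · exact (shear_genA φ x).symm ▸ genA_mem_homog x
  · exact (shear_genB φ x).symm ▸ add_mem (genB_mem_homog x) (genA_mem_homog _)
  · exact (shear_genG φ k x).symm ▸ genG_mem_homog k x

theorem toK₀_homog {m : ℤ} {x : D.FibE s}
    (hx : x ∈ GSym.homog D.deg _ m) : D.toK₀ s x ∈ GSym.homog D.deg _ m := by
  refine GSym.map_homog _ ?_ hx
  rintro (_ | _ | k) x
  · exact (toK₀_genA x).symm ▸ genA_mem_homog x
  · exact (toK₀_genB x).symm ▸ genB_mem_homog x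
  · exact (toK₀_genG k x).symm ▸ zero_mem _

theorem inclA_homog {m : ℤ} {x : D.FibA s}
    (hx : x ∈ GSym.homog (fun _ : Unit => D.j₀) _ m) : D.inclA s x ∈ GSym.homog D.deg _ m :=
  GSym.map_homog _ (fun _ x => (inclA_gen x).symm ▸ genA_mem_homog x) hx

theorem pull_homog {V : Type v} [AddCommGroup V] [Module ℝ V] (a : V →ₗ[ℝ] D.A.V s)
    (b : V →ₗ[ℝ] D.B.V s) {m : ℤ} {x : D.FibE s} (hx : x ∈ GSym.homog D.deg _ m) :
    D.pull s a b x ∈ GSym.homog (fun _ : Unit => D.j₀) _ m := by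
  refine GSym.map_homog _ ?_ hx
  rintro (_ | _ | k) x
  · exact (pull_genA a b x).symm ▸ GSym.gen_mem_homog (deg := fun _ : Unit => D.j₀) () _
  · exact (pull_genB a b x).symm ▸ GSym.gen_mem_homog (deg := fun _ : Unit => D.j₀) () _
  · exact (pull_genG a b k x).symm ▸ zero_mem _

open Polynomial in
theorem gcomm_monomial (p q : ℕ) (x y : Module.Dual ℝ (D.A.V s)) :
    monomial p (D.genV (D.A.V s) x) * monomial q (D.genV (D.A.V s) y) =
      (-1 : ℝ) ^ (D.j₀ * D.j₀) •
        (monomial q (D.genV (D.A.V s) y) * monomial p (D.genV (D.A.V s) x)) := by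
  rw [monomial_mul_monomial, monomial_mul_monomial, smul_monomial, add_comm q, gen_mul_gen']

open Polynomial in
variable (D) in
/-- The pull-back along the graph of `t φ`, as a polynomial in `t`. -/
def pullPoly (s : S) (φ : D.A.V s →ₗ[ℝ] D.B.V s) : D.FibE s →ₐ[ℝ] (D.FibA s)[X] :=
  GSym.lift _ _
    (fun i => match i with
      | .a => ((monomial 0).restrictScalars ℝ).comp (D.genV (D.A.V s))
      | .b => ((monomial 1).restrictScalars ℝ).comp ((D.genV (D.A.V s)).comp φ.dualMap)
      | .g _ => 0) (by
    rintro (_ | _ | i) (_ | _ | j) x y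
    · exact gcomm_monomial 0 0 x y
    · exact gcomm_monomial 0 1 x (φ.dualMap y)
    · simp
    · exact gcomm_monomial 1 0 (φ.dualMap x) y
    · exact gcomm_monomial 1 1 (φ.dualMap x) (φ.dualMap y)
    all_goals simp)

open Polynomial in
-- The power of t counts the factors from B, and every coordinate has degree at least one. The bound
-- depends on the degree only, hence is uniform over the points of the body.
theorem pullPoly_natDegree (φ : D.A.V s →ₗ[ℝ] D.B.V s) {m : ℤ} {x : D.FibE s}
    (hx : x ∈ GSym.homog D.deg _ m) : (D.pullPoly s φ x).natDegree ≤ m.toNat := by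
  refine GSym.natDegree_le _ ?_ hx
  rintro (_ | _ | k) x
  · rw [pullPoly, GSym.lift_gen]
    exact (natDegree_monomial_le _).trans (Nat.zero_le _)
  · rw [pullPoly, GSym.lift_gen]
    exact (natDegree_monomial_le _).trans (D.one_le_deg _)
  · rw [pullPoly, GSym.lift_gen]
    simp

open Polynomial in
theorem pull_eq_sum (φ : D.A.V s →ₗ[ℝ] D.B.V s) (t : ℝ) (x : D.FibE s) :
    D.pull s LinearMap.id (t • φ) x = (D.pullPoly s φ x).sum fun j a => t ^ j • a := by
  have h : D.pull s LinearMap.id (t • φ) = (evalScalar (D.FibA s) t).comp (D.pullPoly s φ) := by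
    refine fibE_ext (fun x => ?_) (fun x => ?_) (fun k x => ?_)
    · rw [pull_genA, AlgHom.comp_apply, show D.pullPoly s φ (D.genA s x) = monomial 0 _ from
        GSym.lift_gen _ _ _ _]
      simp [evalScalar_apply]
      rfl
    · rw [pull_genB, AlgHom.comp_apply, show D.pullPoly s φ (D.genB s x) = monomial 1 _ from
        GSym.lift_gen _ _ _ _]
      simp [evalScalar_apply, LinearMap.comp_smul, LinearMap.dualMap_def]
      rfl
    · rw [pull_genG, AlgHom.comp_apply, show D.pullPoly s φ (D.genG s k x) = 0 from
        GSym.lift_gen _ _ _ _]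
      simp
  rw [h, AlgHom.comp_apply, evalScalar_apply]

end Shear

end Setup

end

section

variable {n : ℕ} {S : Type u} [TopologicalSpace S] [ChartedSpace (EuclideanSpace ℝ (Fin n)) S]

/-! ### The algebra of smooth families -/

section Families

variable {κ : Type w} (deg : κ → ℕ) (E : κ → VB.{u, v} n S)
  {H X M : Type*} [NormedAddCommGroup X] [NormedSpace ℝ X] [TopologicalSpace H]
  (I : ModelWithCorners ℝ X H) [TopologicalSpace M] [ChartedSpace H M] (p : M → S)

/-- The smooth families form an algebra. -/
def smoothAlg : Subalgebra ℝ (∀ x, Fib deg E (p x)) where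
  carrier := {f | IsSmoothFam deg E I p f}
  add_mem' := by
    rintro f g hf hg x
    obtain ⟨a, ha, ha'⟩ := hf x
    obtain ⟨b, hb, hb'⟩ := hg x
    refine ⟨a + b, add_mem ha hb, ?_⟩
    filter_upwards [ha', hb'] with y h1 h2
    simp [h1, h2]
  mul_mem' := by
    rintro f g hf hg x
    obtain ⟨a, ha, ha'⟩ := hf x
    obtain ⟨b, hb, hb'⟩ := hg x
    refine ⟨a * b, mul_mem ha hb, ?_⟩
    filter_upwards [ha', hb'] with y h1 h2
    simp [h1, h2]
  algebraMap_mem' r := fun _ => ⟨_, Subalgebra.algebraMap_mem _ r, Filter.Eventually.of_forall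
    fun _ => rfl⟩

variable {deg E I p}

theorem mem_smoothAlg {f : ∀ x, Fib deg E (p x)} :
    f ∈ smoothAlg deg E I p ↔ IsSmoothFam deg E I p f := Iff.rfl

theorem homFun_mul {m m' : ℤ} {f g : ∀ x, Fib deg E (p x)} (hf : f ∈ homFun deg E I p m)
    (hg : g ∈ homFun deg E I p m') : f * g ∈ homFun deg E I p (m + m') :=
  ⟨(smoothAlg deg E I p).mul_mem hf.1 hg.1, fun x => GSym.homog_mul_mem (hf.2 x) (hg.2 x)⟩

theorem IsSmoothFam.algebraMap {h : M → ℝ} (hh : ContMDiff I 𝓘(ℝ) ∞ h) :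
    IsSmoothFam deg E I p fun x => algebraMap ℝ _ (h x) :=
  IsSmoothFam.of_basic _ _ _ _ (Or.inl ⟨h, hh, rfl⟩)

theorem IsSmoothFam.gen (i : κ) (a : DualSec (E i)) :
    IsSmoothFam deg E I p fun x => GSym.gen deg _ i (a.toFun (p x)) :=
  IsSmoothFam.of_basic _ _ _ _ (Or.inr ⟨i, a, rfl⟩)

/-- Smooth families are locally polynomials in the basic functions, and fibrewise algebra
homomorphisms preserve polynomials; so only basic functions need to be checked. -/
theorem IsSmoothFam.map {κ' : Type*} {deg' : κ' → ℕ} {E' : κ' → VB.{u, v} n S}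
    {H' X' M' : Type*} [NormedAddCommGroup X'] [NormedSpace ℝ X'] [TopologicalSpace H']
    {I' : ModelWithCorners ℝ X' H'} [TopologicalSpace M'] [ChartedSpace H' M'] {p' : M' → S}
    {q : M' → M} (hq : Continuous q) (θ : ∀ x, Fib deg E (p (q x)) →ₐ[ℝ] Fib deg' E' (p' x))
    (h : ∀ b ∈ basicFun deg E I p, IsSmoothFam deg' E' I' p' fun x => θ x (b (q x)))
    {f : ∀ x, Fib deg E (p x)} (hf : IsSmoothFam deg E I p f) :
    IsSmoothFam deg' E' I' p' fun x => θ x (f (q x)) := by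
  let Θ : (∀ x, Fib deg E (p x)) →ₐ[ℝ] (∀ x, Fib deg' E' (p' x)) :=
    AlgHom.pi fun x => (θ x).comp (Pi.evalAlgHom ℝ (fun x => Fib deg E (p x)) (q x))
  have hΘ : Algebra.adjoin ℝ (basicFun deg E I p) ≤ (smoothAlg deg' E' I' p').comap Θ :=
    Algebra.adjoin_le fun b hb => h b hb
  intro x
  obtain ⟨g, hg, hg'⟩ := hf (q x)
  obtain ⟨g', hg1, hg2⟩ := hΘ hg x
  refine ⟨g', hg1, ?_⟩
  filter_upwards [hq.continuousAt.eventually hg', hg2] with y h1 h2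
  rw [h1]
  exact h2

end Families

/-- Composition of a fibrewise linear function with a bundle map. -/
def DualSec.comp {A B : VB.{u, v} n S} (f : DualSec B) (φ : HomSec A B) : DualSec A :=
  ⟨fun s => (f.toFun s).comp (φ.toFun s), f.smooth.comp φ.smooth⟩

/-- Evaluation of a fibrewise linear function on a section. -/
theorem DualSec.contMDiff_apply {E : VB.{u, v} n S} (f : DualSec E) (σ : Sec E) :
    ContMDiff (𝓡 n) 𝓘(ℝ) ∞ fun s => f.toFun s (σ.toFun s) := f.smooth.comp σ.smooth

/-! ### Homogeneous functions on E. -/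

namespace Setup

variable {D : Setup.{u, v} n S}

variable (D) in
/-- Smooth functions on the body of `E`. -/
abbrev CM : Type (max u v) := ContMDiffMap ((𝓡 n).prod 𝓘(ℝ, D.N.F)) 𝓘(ℝ) D.M ℝ ∞

variable (D) in
/-- Smooth families of elements of the fibres of the algebra bundle of `E`. -/
abbrev smE : Subalgebra ℝ D.FunE :=
  smoothAlg D.deg D.E ((𝓡 n).prod 𝓘(ℝ, D.N.F)) (fun x : D.M => x.proj)

theorem smoothE_mul {m m' : ℤ} {f g : D.FunE} (hf : f ∈ D.smoothE m) (hg : g ∈ D.smoothE m') :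
    f * g ∈ D.smoothE (m + m') := homFun_mul hf hg

theorem smoothE_neg_deg {m : ℤ} (hm : m < 0) {f : D.FunE} (hf : f ∈ D.smoothE m) : f = 0 :=
  funext fun x => GSym.homog_neg hm (hf.2 x)

namespace HFun

theorem ext' {f g : D.HFun} (hdeg : f.deg = g.deg) (hval : f.val = g.val) : f = g := by
  cases f; cases g; cases hdeg; cases hval; rfl

/-- A smooth function on the body, as a function on `E`. -/
def ofSmooth (h : D.CM) : D.HFun :=
  ⟨0, fun x => algebraMap ℝ _ (h x), IsSmoothFam.algebraMap h.contMDiff,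
    fun _ => GSym.algebraMap_mem_homog _⟩

/-- A linear coordinate on a summand of `E`, as a function on `E`. -/
def ofGen (i : Idx D.r D.j₀) (a : DualSec (D.E i)) : D.HFun :=
  ⟨D.deg i, fun x => GSym.gen D.deg _ i (a.toFun x.proj), IsSmoothFam.gen i a,
    fun _ => GSym.gen_mem_homog _ _⟩

/-- The product of homogeneous functions. -/
def mul (f g : D.HFun) : D.HFun := ⟨f.deg + g.deg, f.val * g.val, smoothE_mul f.mem g.mem⟩

/-- A linear combination of a homogeneous function and one of the same degree. -/
def lin (c : ℝ) (f g : D.HFun) (h : g.deg = f.deg) : D.HFun :=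
  ⟨f.deg, c • f.val + g.val, add_mem (Submodule.smul_mem _ _ f.mem) (h ▸ g.mem)⟩

end HFun

/-! ### Twisted derivations at a point -/

section Twisted

variable {x : D.M} {R : Type*} [Ring R] [Algebra ℝ R]

/-- Derivations of the algebra of functions on `E` along the evaluation at `x` followed by `ρ`. -/
structure IsTwistedDer (ρ : D.FibE x.proj →ₐ[ℝ] R) (e : ℤ) (μ : D.HFun → R) : Prop where
  lin : ∀ (c : ℝ) (f g h : D.HFun), f.deg = h.deg → g.deg = h.deg →
    h.val = c • f.val + g.val → μ h = c • μ f + μ g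
  leibniz : ∀ f g h : D.HFun, h.deg = f.deg + g.deg → h.val = f.val * g.val →
    μ h = μ f * ρ (g.val x) + (-1 : ℝ) ^ (e * f.deg) • (ρ (f.val x) * μ g)

variable {ρ : D.FibE x.proj →ₐ[ℝ] R} {e : ℤ} {μ : D.HFun → R}

namespace IsTwistedDer

theorem map_zero (hμ : IsTwistedDer ρ e μ) {f : D.HFun} (hf : f.val = 0) : μ f = 0 := by
  have := hμ.lin 1 f f f rfl rfl (by simp [hf])
  simpa using this

variable [T2Space S] [IsManifold (𝓡 n) ∞ S]

/-- For a bump function χ at x supported in the zero set of f, the product χ f is zero, while the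
Leibniz rule with χ(x) = 1 and f(x) = 0 returns μ f. -/
theorem map_zero_of_eventually (hμ : IsTwistedDer ρ e μ) {f : D.HFun}
    (hf : ∀ᶠ y in 𝓝 x, f.val y = 0) : μ f = 0 := by
  obtain ⟨χ, hχ, h1, hs⟩ := exists_smooth_bump ((𝓡 n).prod 𝓘(ℝ, D.N.F)) hf
  have h0 : ((HFun.ofSmooth ⟨χ, hχ⟩).mul f).val = 0 := by
    funext y
    by_cases hy : y ∈ tsupport χ
    · have : f.val y = 0 := hs hy
      simp [HFun.mul, this]
    · have : χ y = 0 := image_eq_zero_of_notMem_tsupport hy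
      simp [HFun.mul, HFun.ofSmooth, this]
  have h2 := hμ.leibniz (HFun.ofSmooth ⟨χ, hχ⟩) f _ rfl (rfl : ((HFun.ofSmooth ⟨χ, hχ⟩).mul f).val = _)
  have h3 : χ x = 1 := h1.self_of_nhds
  rw [hμ.map_zero h0, hf.self_of_nhds] at h2
  simpa [HFun.ofSmooth, h3] using h2.symm

theorem congr_of_eventually (hμ : IsTwistedDer ρ e μ) {f g : D.HFun} (hd : f.deg = g.deg)
    (h : ∀ᶠ y in 𝓝 x, f.val y = g.val y) : μ f = μ g := by
  have h1 : μ (HFun.lin (-1) g f hd) = 0 := hμ.map_zero_of_eventually (by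
    filter_upwards [h] with y hy
    simp [HFun.lin, hy])
  have h2 := hμ.lin (-1) g f (HFun.lin (-1) g f hd) rfl hd rfl
  rw [h1] at h2
  rw [neg_one_smul, neg_add_eq_sub, eq_comm, sub_eq_zero] at h2
  exact h2

/-- By the Leibniz rule a product of killed functions is killed. The degree is returned as well,
since μ is defined on homogeneous functions only. -/
theorem exists_list (hμ : IsTwistedDer ρ e μ) (h0 : ∀ h, μ (HFun.ofSmooth h) = 0)
    (h1 : ∀ i a, μ (HFun.ofGen i a) = 0) (L : List D.FunE)
    (hL : ∀ f ∈ L, f ∈ basicFun D.deg D.E ((𝓡 n).prod 𝓘(ℝ, D.N.F)) (fun x : D.M => x.proj)) :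
    ∃ (d : ℕ) (G : D.HFun), G.deg = d ∧ G.val = L.prod ∧ μ G = 0 := by
  induction L with
  | nil => exact ⟨0, HFun.ofSmooth 1, rfl, funext fun y => by simp [HFun.ofSmooth], h0 _⟩
  | cons b L ih =>
    obtain ⟨d, G, hd, hG, hG0⟩ := ih fun f hf => hL f (List.mem_cons_of_mem _ hf)
    have hb : ∃ (d : ℕ) (F : D.HFun), F.deg = d ∧ F.val = b ∧ μ F = 0 := by
      rcases hL b List.mem_cons_self with ⟨h, hh, rfl⟩ | ⟨i, a, rfl⟩
      · exact ⟨0, HFun.ofSmooth ⟨h, hh⟩, rfl, rfl, h0 _⟩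
      · exact ⟨D.deg i, HFun.ofGen i a, rfl, rfl, h1 _ _⟩
    obtain ⟨d', F, hd', hF, hF0⟩ := hb
    refine ⟨d' + d, F.mul G, by simp [HFun.mul, hd, hd'], by simp [HFun.mul, hF, hG], ?_⟩
    rw [hμ.leibniz F G _ rfl rfl, hF0, hG0]
    simp

/-- A twisted derivation that kills the smooth functions on the body and the linear coordinates
vanishes. -/
theorem eq_zero (hμ : IsTwistedDer ρ e μ) (h0 : ∀ h, μ (HFun.ofSmooth h) = 0)
    (h1 : ∀ i a, μ (HFun.ofGen i a) = 0) (f : D.HFun) : μ f = 0 := by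
  rcases lt_or_ge f.deg 0 with hneg | hpos
  · exact hμ.map_zero (smoothE_neg_deg hneg f.mem)
  obtain ⟨m, hm⟩ := Int.eq_ofNat_of_zero_le hpos
  obtain ⟨g, hg, hg'⟩ := f.mem.1 x
  -- The local representative `g` need not be homogeneous. Its part of degree m is realized by a
  -- global homogeneous function killed by μ, and agrees with f near x.
  have key : ∃ F : D.HFun, F.deg = m ∧ (∀ y, F.val y = GSym.gradeProj m (g y)) ∧ μ F = 0 := by
    clear hg'
    have hzero : ∃ F : D.HFun, F.deg = m ∧ F.val = 0 ∧ μ F = 0 :=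
      ⟨⟨m, 0, zero_mem _⟩, rfl, rfl, hμ.map_zero rfl⟩
    rw [← Subalgebra.mem_toSubmodule, Algebra.adjoin_eq_span] at hg
    induction hg using Submodule.span_induction with
    | mem g hg =>
      obtain ⟨L, hL, rfl⟩ := Submonoid.exists_list_of_mem_closure hg
      obtain ⟨d, G, hd, hG, hG0⟩ := hμ.exists_list h0 h1 L hL
      by_cases hdm : d = m
      · refine ⟨G, by rw [hd, hdm], fun y => ?_, hG0⟩
        have hy : G.val y ∈ GSym.homog D.deg _ (d : ℤ) := hd ▸ G.mem.2 y
        rw [← hG, GSym.gradeProj_of_mem hy, if_pos hdm]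
      · obtain ⟨F, hF, hF', hF0⟩ := hzero
        refine ⟨F, hF, fun y => ?_, hF0⟩
        have hy : G.val y ∈ GSym.homog D.deg _ (d : ℤ) := hd ▸ G.mem.2 y
        rw [← hG, GSym.gradeProj_of_mem hy, if_neg hdm, hF']
        rfl
    | zero =>
      obtain ⟨F, hF, hF', hF0⟩ := hzero
      exact ⟨F, hF, fun y => by simp [hF'], hF0⟩
    | add g g' _ _ ih ih' =>
      obtain ⟨F, hF, hF', hF0⟩ := ih
      obtain ⟨G, hG, hG', hG0⟩ := ih'
      refine ⟨HFun.lin 1 F G (hG.trans hF.symm), hF, fun y => by simp [HFun.lin, hF', hG'], ?_⟩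
      rw [hμ.lin 1 F G (HFun.lin 1 F G (hG.trans hF.symm)) rfl (hG.trans hF.symm) rfl, hF0, hG0]
      simp
    | smul c g _ ih =>
      obtain ⟨F, hF, hF', hF0⟩ := ih
      obtain ⟨G, hG, hG', hG0⟩ := hzero
      refine ⟨HFun.lin c F G (hG.trans hF.symm), hF, fun y => by simp [HFun.lin, hF', hG'], ?_⟩
      rw [hμ.lin c F G (HFun.lin c F G (hG.trans hF.symm)) rfl (hG.trans hF.symm) rfl, hF0, hG0]
      simp
  obtain ⟨F, hF, hF', hF0⟩ := key
  rw [← hF0]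
  refine hμ.congr_of_eventually (hm.trans hF.symm) ?_
  filter_upwards [hg'] with y hy
  have hy' : f.val y ∈ GSym.homog D.deg _ (m : ℤ) := hm ▸ f.mem.2 y
  rw [hF', ← hy, GSym.gradeProj_of_mem hy', if_pos rfl]

/-- A twisted derivation restricted to the smooth functions on the body. -/
def onSmooth (hμ : IsTwistedDer ρ e μ) : D.CM →ₗ[ℝ] R where
  toFun h := μ (HFun.ofSmooth h)
  map_add' h h' := by
    have := hμ.lin 1 (HFun.ofSmooth h) (HFun.ofSmooth h') (HFun.ofSmooth (h + h')) rfl rfl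
      (funext fun y => by simp [HFun.ofSmooth])
    simpa using this
  map_smul' c h := by
    have := hμ.lin c (HFun.ofSmooth h) (HFun.ofSmooth 0) (HFun.ofSmooth (c • h)) rfl rfl
      (funext fun y => by
        change algebraMap ℝ (D.FibE y.proj) (c * h y) =
          c • algebraMap ℝ (D.FibE y.proj) (h y) + algebraMap ℝ (D.FibE y.proj) 0
        rw [_root_.map_mul, _root_.map_zero, add_zero, Algebra.smul_def])
    rw [hμ.map_zero (f := HFun.ofSmooth 0) (funext fun y => by simp [HFun.ofSmooth])] at this
    simpa using this

variable (D) in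
/-- The restriction of a function on the body to a section, pulled back to the body. -/
def alongSec (τ : Sec D.N) (h : D.CM) : D.CM :=
  ⟨fun x => h ⟨x.proj, τ.toFun x.proj⟩,
    h.contMDiff.comp (τ.smooth.comp D.N.contMDiff_totProj)⟩

variable (D) in
/-- A linear coordinate on `N` as a smooth function on the body. -/
def linCM (f : DualSec D.N) : D.CM := ⟨_, f.smooth⟩

/-- By the Hadamard lemma, a twisted derivation at a point of a section that does not distinguish
the linear coordinates from their restrictions to the section does not distinguish any function
on the body from its restriction. -/
theorem smooth_eq (hμ : IsTwistedDer ρ e μ) (τ : Sec D.N) (hτ : τ.toFun x.proj = x.2)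
    (hlin : ∀ f : DualSec D.N, μ (HFun.ofSmooth (linCM D f)) =
      μ (HFun.ofSmooth (alongSec D τ (linCM D f)))) (h : D.CM) :
    μ (HFun.ofSmooth h) = μ (HFun.ofSmooth (alongSec D τ h)) := by
  have hx : (⟨x.proj, τ.toFun x.proj⟩ : D.M) = x := by rw [hτ]
  obtain ⟨m, ℓ, k, hk, hev⟩ := exists_hadamard h.contMDiff τ x.proj
  rw [hx] at hev
  let K : Fin m → D.CM := fun i => ⟨k i, hk i⟩
  -- The right-hand side of the Hadamard expansion, as a global function that agrees with h only
  -- near x; locality of μ makes this enough.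
  let H : D.CM := alongSec D τ h + ∑ i, (linCM D (ℓ i) - alongSec D τ (linCM D (ℓ i))) * K i
  have h1 : μ (HFun.ofSmooth h) = μ (HFun.ofSmooth H) := by
    refine hμ.congr_of_eventually rfl ?_
    filter_upwards [hev] with y hy
    simp only [HFun.ofSmooth]
    congr 1
    rw [hy]
    have : ∀ (ι : Finset (Fin m)) (g : Fin m → D.CM), (∑ i ∈ ι, g i) y = ∑ i ∈ ι, g i y := by
      intro ι g
      induction ι using Finset.cons_induction with
      | empty => simp
      | cons a t ha ih =>
        rw [Finset.sum_cons, Finset.sum_cons, ContMDiffMap.coe_add, Pi.add_apply, ih]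
    simp only [H, ContMDiffMap.coe_add, Pi.add_apply, this]
    rfl
  -- In each product the first factor vanishes at x, as τ passes through x, and is killed by μ by
  -- hypothesis; so both Leibniz terms vanish.
  have h2 : ∀ i, hμ.onSmooth ((linCM D (ℓ i) - alongSec D τ (linCM D (ℓ i))) * K i) = 0 := by
    intro i
    have h3 := hμ.leibniz (HFun.ofSmooth (linCM D (ℓ i) - alongSec D τ (linCM D (ℓ i))))
      (HFun.ofSmooth (K i))
      (HFun.ofSmooth ((linCM D (ℓ i) - alongSec D τ (linCM D (ℓ i))) * K i)) rfl
      (funext fun y => by simp [HFun.ofSmooth])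
    have h4 : μ (HFun.ofSmooth (linCM D (ℓ i) - alongSec D τ (linCM D (ℓ i)))) = 0 := by
      have := map_sub hμ.onSmooth (linCM D (ℓ i)) (alongSec D τ (linCM D (ℓ i)))
      simp only [onSmooth, LinearMap.coe_mk, AddHom.coe_mk] at this
      rw [this, hlin, sub_self]
    have h5 : (linCM D (ℓ i) - alongSec D τ (linCM D (ℓ i))) x = 0 := by
      change (ℓ i).toFun x.proj x.2 - (ℓ i).toFun x.proj (τ.toFun x.proj) = 0
      rw [hτ, sub_self]
    change μ _ = 0
    rw [h3, h4]
    simp only [HFun.ofSmooth, h5]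
    simp
  rw [h1]
  change hμ.onSmooth H = hμ.onSmooth _
  rw [map_add, map_sum, Finset.sum_eq_zero fun i _ => h2 i, add_zero]

end IsTwistedDer

end Twisted

end Setup

end

section

variable {n : ℕ} {S : Type u} [TopologicalSpace S] [ChartedSpace (EuclideanSpace ℝ (Fin n)) S]

namespace Setup

variable {D : Setup.{u, v} n S}

/-! ### Multi-derivations -/

/-- Graded symmetry of multi-brackets. -/
def IsGSymm (Ψ : List D.HFun → D.FunE) : Prop :=
  ∀ (L R : List D.HFun) (f g : D.HFun), Ψ (L ++ f :: g :: R) =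
    (-1 : ℝ) ^ ((f.deg - 1) * (g.deg - 1)) • Ψ (L ++ g :: f :: R)

/-- Graded symmetric multi-derivations. -/
structure IsMultiDer (e : ℤ) (Ψ : List D.HFun → D.FunE) : Prop where
  linear : ∀ (L : List D.HFun) (c : ℝ) (f g h : D.HFun), f.deg = h.deg → g.deg = h.deg →
    h.val = c • f.val + g.val → Ψ (L ++ [h]) = c • Ψ (L ++ [f]) + Ψ (L ++ [g])
  symm : IsGSymm Ψ
  leibniz : ∀ (L : List D.HFun) (f g h : D.HFun), h.deg = f.deg + g.deg → h.val = f.val * g.val →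
    Ψ (L ++ [h]) = Ψ (L ++ [f]) * g.val +
      (-1 : ℝ) ^ ((e + wt L) * f.deg) • (f.val * Ψ (L ++ [g]))

theorem neg_one_zpow_mul_self (k : ℤ) : (-1 : ℝ) ^ k * (-1 : ℝ) ^ k = 1 := by
  rw [← mul_zpow]; simp

theorem wt_cons (f : D.HFun) (L : List D.HFun) : wt (f :: L) = (f.deg - 1) + wt L := by
  simp [wt]

/-- Linearity and the Leibniz rule are imposed in the last slot only; this brings any argument
there. -/
theorem IsGSymm.move {Ψ : List D.HFun → D.FunE} (hΨ : IsGSymm Ψ) (L L' : List D.HFun)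
    (f : D.HFun) : Ψ (L ++ f :: L') = (-1 : ℝ) ^ ((f.deg - 1) * wt L') • Ψ (L ++ L' ++ [f]) := by
  induction L' generalizing L with
  | nil => simp [wt]
  | cons g L' ih =>
    have h := ih (L ++ [g])
    rw [hΨ, wt_cons, mul_add, zpow_add₀ (by norm_num), mul_smul]
    rw [List.append_assoc] at h
    rw [show L ++ g :: f :: L' = L ++ ([g] ++ f :: L') from rfl, h]
    simp

theorem Coch.IsMultiVectorField.isMultiDer {d : ℤ} {Z : Coch D d} (hZ : Z.IsMultiVectorField) :
    IsMultiDer d Z.toFun := ⟨hZ.linear, hZ.symm, hZ.leibniz⟩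

theorem IsMultiDer.smul_add {e : ℤ} {Ψ Ψ' : List D.HFun → D.FunE} (h : IsMultiDer e Ψ)
    (h' : IsMultiDer e Ψ') (a : ℝ) : IsMultiDer e (fun L => Ψ L + a • Ψ' L) where
  linear L c f g k h1 h2 h3 := by
    rw [h.linear L c f g k h1 h2 h3, h'.linear L c f g k h1 h2 h3]
    module
  symm L L' f g := by
    beta_reduce
    rw [h.symm L L' f g, h'.symm L L' f g]
    module
  leibniz L f g k h1 h2 := by
    rw [h.leibniz L f g k h1 h2, h'.leibniz L f g k h1 h2, add_mul (Ψ _), mul_add f.val,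
      smul_mul_assoc, mul_smul_comm]
    module

/-- The degree enters only through signs. Hence Q₊ and Q₋, of degrees 1 and -1, add up to a single
multi-derivation of odd degree. -/
theorem IsMultiDer.congr_parity {e e' : ℤ} {Ψ : List D.HFun → D.FunE} (h : IsMultiDer e Ψ)
    (he : e' = e + 2) : IsMultiDer e' Ψ where
  linear := h.linear
  symm := h.symm
  leibniz L f g k h1 h2 := by
    rw [h.leibniz L f g k h1 h2, he, show (e + 2 + wt L) * f.deg =
      (e + wt L) * f.deg + (f.deg + f.deg) by ring, zpow_add₀ (by norm_num : (-1 : ℝ) ≠ 0),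
      zpow_add₀ (by norm_num : (-1 : ℝ) ≠ 0) f.deg, neg_one_zpow_mul_self, mul_one]

theorem BlendedQ.isMultiDer (Q : BlendedQ D) : IsMultiDer 1 Q.eval := by
  have := Q.pos_field.isMultiDer.smul_add (Q.neg_field.isMultiDer.congr_parity (by norm_num)) 1
  simp only [one_smul] at this
  exact this

theorem IsMultiDer.twisted {e : ℤ} {Ψ : List D.HFun → D.FunE} (h : IsMultiDer e Ψ)
    (L : List D.HFun) {x : D.M} {R : Type*} [Ring R] [Algebra ℝ R] (ρ : D.FibE x.proj →ₐ[ℝ] R) :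
    IsTwistedDer ρ (e + wt L) fun f => ρ (Ψ (L ++ [f]) x) where
  lin c f g k h1 h2 h3 := by simp [h.linear L c f g k h1 h2 h3]
  leibniz f g k h1 h2 := by simp [h.leibniz L f g k h1 h2]

theorem fromA_ofSmooth (h : S → ℝ) (hh : ContMDiff (𝓡 n) 𝓘(ℝ) ∞ h) :
    (fun x : D.M => algebraMap ℝ (D.FibE x.proj) (h x.proj)) ∈ D.fromA :=
  ⟨fun s => algebraMap ℝ _ (h s), IsSmoothFam.algebraMap hh, fun x => by simp⟩

theorem fromA_genA (α : DualSec D.A) :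
    (fun x : D.M => D.genA x.proj (α.toFun x.proj)) ∈ D.fromA :=
  ⟨fun s => D.genV (D.A.V s) (α.toFun s), IsSmoothFam.gen (E := fun _ : Unit => D.A) () α,
    fun _ => (inclA_gen _).symm⟩

theorem zero_mem_fromA : (0 : D.FunE) ∈ D.fromA :=
  ⟨0, (smoothAlg (fun _ : Unit => D.j₀) (fun _ : Unit => D.A) (𝓡 n) (fun s : S => s)).zero_mem,
    fun x => by simp⟩

/-! ### Vertical fields are determined by their values on linear coordinates. -/

section Manifold

variable [T2Space S] [IsManifold (𝓡 n) ∞ S]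

/-- A multi-derivation that kills the functions on `A` and the linear coordinates vanishes. -/
theorem IsMultiDer.eq_zero {e : ℤ} {Ψ : List D.HFun → D.FunE} (hΨ : IsMultiDer e Ψ)
    (hA : ∀ (L : List D.HFun) (f : D.HFun), f.val ∈ D.fromA → Ψ (L ++ [f]) = 0)
    (hG : ∀ (L : List D.HFun) (f : D.HFun) (k) (θ : DualSec (D.G k)),
      (f.val = fun x : D.M => D.genG x.proj k (θ.toFun x.proj)) → Ψ (L ++ [f]) = 0)
    (hlin : ∀ L : List D.Lin, Ψ (L.map linFun) = 0) (L : List D.HFun) : Ψ L = 0 := by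
  -- Arbitrary arguments are traded for linear coordinates one at a time: once the last entry of
  -- `L₁` is moved to the end, Ψ is a derivation in it, and the induction hypothesis covers the case
  -- where it is a linear coordinate.
  suffices h : ∀ (L₁ : List D.HFun) (L₂ : List D.Lin), Ψ (L₁ ++ L₂.map linFun) = 0 by
    simpa using h L []
  intro L₁
  induction L₁ using List.reverseRecOn with
  | nil => simpa using hlin
  | append_singleton L₁ f ih =>
    intro L₂
    rw [List.append_assoc, List.singleton_append, hΨ.symm.move]
    refine smul_eq_zero_of_right _ ?_
    funext x
    have hμ := hΨ.twisted (L₁ ++ L₂.map linFun) (x := x) (AlgHom.id ℝ _)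
    have hl : ∀ l : D.Lin, Ψ (L₁ ++ L₂.map linFun ++ [linFun l]) = 0 := fun l => by
      have := ih (L₂ ++ [l])
      simpa using this
    refine hμ.eq_zero (fun h => ?_) ?_ f
    · obtain ⟨τ, hτ⟩ := exists_sec_through (E := D.N) x.proj x.2
      have hs : ∀ h : D.CM, Ψ (L₁ ++ L₂.map linFun ++
          [HFun.ofSmooth (IsTwistedDer.alongSec D τ h)]) = 0 := fun h =>
        hA _ _ (fromA_ofSmooth (fun s => h ⟨s, τ.toFun s⟩) (h.contMDiff.comp τ.smooth))
      have h1 := hμ.smooth_eq τ hτ (fun f => by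
        rw [hs]
        have : HFun.ofSmooth (IsTwistedDer.linCM D f) = linFun (.inl f) := HFun.ext' rfl rfl
        rw [this, hl]) h
      rw [h1, hs]
      simp
    · rintro (_ | _ | k) a
      · rw [hA _ _ (fromA_genA a)]
        simp
      · have : HFun.ofGen (D := D) .b a = linFun (.inr a) := HFun.ext' rfl rfl
        rw [this, hl]
        simp
      · rw [hG _ _ k a rfl]
        simp

theorem Coch.ext' {d : ℤ} {Z Z' : Coch D d} (h : ∀ L, Z.toFun L = Z'.toFun L) : Z = Z' := by
  cases Z; cases Z'; congr; exact funext h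

theorem eq_of_fromA {f g : D.FunE} (hf : f ∈ D.fromA) (hg : g ∈ D.fromA)
    (h : ∀ s, D.pull s LinearMap.id 0 (f (⟨s, 0⟩ : D.M)) =
      D.pull s LinearMap.id 0 (g (⟨s, 0⟩ : D.M))) : f = g := by
  obtain ⟨f', -, hf⟩ := hf
  obtain ⟨g', -, hg⟩ := hg
  funext x
  have := h x.proj
  rw [hf, hg, pull_inclA, pull_inclA] at this
  rw [hf, hg, this]

/-- The projection `P` is injective on the vertical multi-vector fields. -/
theorem P_injOn (d : ℤ) : Set.InjOn (P (D := D)) (vertical D d) := by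
  intro Z hZ Z' hZ' h
  have h0 := (hZ.1.isMultiDer.smul_add hZ'.1.isMultiDer (-1)).eq_zero
    (fun L f hf => by rw [hZ.2.1 L f hf, hZ'.2.1 L f hf]; simp)
    (fun L f k θ hf => by rw [hZ.2.2.1 L f k θ hf, hZ'.2.2.1 L f k θ hf]; simp)
    (fun L => by
      rw [eq_of_fromA (hZ.2.2.2 L) (hZ'.2.2.2 L) fun s => congrFun (congrFun h L) s]
      simp)
  refine Coch.ext' fun L => ?_
  have := h0 L
  rw [neg_one_smul, ← sub_eq_add_neg, sub_eq_zero] at this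
  exact this

/-- `I` is an inverse by choice; injectivity of `P` forces its value as soon as one vertical field
with the right projection is known. -/
theorem I_eq {d : ℤ} {Z : Coch D d} (hZ : Z ∈ vertical D d) {α : ACoch D} (h : P Z = α) :
    I d α = Z := by
  subst h
  exact (P_injOn d).leftInvOn_invFunOn hZ

end Manifold

/-! ### Functions vanishing on the graph of a deformation -/

section Graph

variable (a : Sec D.N × HomSec D.A D.B)

/-- Minus the value of the derivation along `(σ, φ)` on a linear coordinate. -/
def graphVal : D.Lin → D.FunE
  | .inl f => fun x => algebraMap ℝ _ (f.toFun x.proj (a.1.toFun x.proj))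
  | .inr f => fun x => D.genA x.proj ((f.toFun x.proj).comp (a.2.toFun x.proj))

theorem graphVal_mem_fromA (l : D.Lin) : graphVal a l ∈ D.fromA := by
  cases l with
  | inl f => exact fromA_ofSmooth _ (f.contMDiff_apply a.1)
  | inr f => exact fromA_genA (f.comp a.2)

theorem graphVal_mem (l : D.Lin) : graphVal a l ∈ D.smoothE (linDeg l) := by
  cases l with
  | inl f =>
    exact ⟨IsSmoothFam.algebraMap ((f.contMDiff_apply a.1).comp D.N.contMDiff_totProj),
      fun _ => GSym.algebraMap_mem_homog _⟩
  | inr f => exact ⟨IsSmoothFam.gen (E := D.E) .a (f.comp a.2), fun x => genA_mem_homog _⟩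

/-- The restriction of a linear coordinate to the graph, as a function on `E`. -/
def graphFun (l : D.Lin) : D.HFun := ⟨linDeg l, graphVal a l, graphVal_mem a l⟩

/-- The linear coordinates relative to the graph. -/
def shiftFun (l : D.Lin) : D.HFun :=
  ⟨linDeg l, linVal l - graphVal a l, sub_mem (linFun l).mem (graphVal_mem a l)⟩

/-- The restriction of a function to the graph, pulled back along `E → A`. -/
def retract (f : D.HFun) : D.HFun :=
  ⟨f.deg, fun x => D.inclA x.proj (D.pull x.proj LinearMap.id (a.2.toFun x.proj)
      (f.val ⟨x.proj, a.1.toFun x.proj⟩)), by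
    refine ⟨?_, fun x => inclA_homog (pull_homog _ _ (f.mem.2 ⟨x.proj, a.1.toFun x.proj⟩))⟩
    refine IsSmoothFam.map (E := D.E) (p := fun x : D.M => x.proj)
      (q := fun x : D.M => (⟨x.proj, a.1.toFun x.proj⟩ : D.M))
      (a.1.smooth.continuous.comp D.N.continuous_totProj)
      (fun x => (D.inclA x.proj).comp (D.pull x.proj LinearMap.id (a.2.toFun x.proj)))
      ?_ f.mem.1
    rintro _ (⟨h, hh, rfl⟩ | ⟨i, b, rfl⟩)
    · simp only [AlgHom.commutes]
      exact IsSmoothFam.algebraMap (hh.comp (a.1.smooth.comp D.N.contMDiff_totProj))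
    · rcases i with _ | _ | k
      · refine (mem_smoothAlg).1 ?_
        convert mem_smoothAlg.2 (IsSmoothFam.gen (E := D.E) (deg := D.deg)
          (I := (𝓡 n).prod 𝓘(ℝ, D.N.F)) (p := fun x : D.M => x.proj) .a b) using 2 with x
        exact (congrArg (D.inclA x.proj) (pull_genA _ _ _)).trans (inclA_gen _)
      · refine (mem_smoothAlg).1 ?_
        convert mem_smoothAlg.2 (IsSmoothFam.gen (E := D.E) (deg := D.deg)
          (I := (𝓡 n).prod 𝓘(ℝ, D.N.F)) (p := fun x : D.M => x.proj) .a
            (DualSec.comp b a.2)) using 2 with x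
        exact (congrArg (D.inclA x.proj) (pull_genB _ _ _)).trans (inclA_gen _)
      · refine (mem_smoothAlg).1 ?_
        convert zero_mem (smoothAlg D.deg D.E ((𝓡 n).prod 𝓘(ℝ, D.N.F))
          (fun x : D.M => x.proj)) using 2 with x
        exact (congrArg (D.inclA x.proj) (pull_genG _ _ _ _)).trans (map_zero _)⟩

theorem toK₀_mem_smE {f : D.FunE} (hf : f ∈ D.smE) :
    (fun x : D.M => D.toK₀ x.proj (f x)) ∈ D.smE := by
  refine IsSmoothFam.map (E := D.E) (p := fun x : D.M => x.proj) (q := id) continuous_id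
    (fun x => D.toK₀ x.proj) ?_ hf
  rintro _ (⟨h, hh, rfl⟩ | ⟨i, b, rfl⟩)
  · simp only [AlgHom.commutes]
    exact IsSmoothFam.algebraMap hh
  · rcases i with _ | _ | k
    · refine (mem_smoothAlg).1 ?_
      convert mem_smoothAlg.2 (IsSmoothFam.gen (E := D.E) (deg := D.deg)
        (I := (𝓡 n).prod 𝓘(ℝ, D.N.F)) (p := fun x : D.M => x.proj) .a b) using 2 with x
      exact toK₀_genA _
    · refine (mem_smoothAlg).1 ?_
      convert mem_smoothAlg.2 (IsSmoothFam.gen (E := D.E) (deg := D.deg)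
        (I := (𝓡 n).prod 𝓘(ℝ, D.N.F)) (p := fun x : D.M => x.proj) .b b) using 2 with x
      exact toK₀_genB _
    · refine (mem_smoothAlg).1 ?_
      convert zero_mem (smoothAlg D.deg D.E ((𝓡 n).prod 𝓘(ℝ, D.N.F))
        (fun x : D.M => x.proj)) using 2 with x
      exact toK₀_genG _ _

/-- The restriction to `E_{k₀}` of a homogeneous function. -/
def restrictK₀ (f : D.HFun) : D.HFun :=
  ⟨f.deg, fun x => D.toK₀ x.proj (f.val x), toK₀_mem_smE f.mem.1,
    fun x => toK₀_homog (f.mem.2 x)⟩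

/-- The restriction of a function to the graph vanishes. -/
def VanishesOnGraph (f : D.FunE) : Prop :=
  ∀ s : S, D.pull s LinearMap.id (a.2.toFun s) (f (⟨s, a.1.toFun s⟩ : D.M)) = 0

theorem vanishesOn_graph_iff (f : D.FunE) :
    VanishesOn (Set.range fun s : S => (⟨s, a.1.toFun s⟩ : D.M))
      (fun x => (a.2.toFun x.proj).graph) f ↔ VanishesOnGraph a f := by
  simp only [VanishesOn, VanishesOnGraph, Set.forall_mem_range]
  exact forall_congr' fun s => pull_graph_eq_zero_iff _ _

theorem vanishesOnGraph_shiftFun (l : D.Lin) : VanishesOnGraph a (shiftFun a l).val := by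
  intro s
  cases l with
  | inl f => simp [shiftFun, linVal, graphVal]
  | inr f => simp [shiftFun, linVal, graphVal]

theorem shiftFun_mem_fromK₀ (l : D.Lin) : (shiftFun a l).val ∈ D.fromK₀ := by
  intro x
  cases l with
  | inl f => simp [shiftFun, linVal, graphVal]
  | inr f => simp [shiftFun, linVal, graphVal]

variable [T2Space S] [IsManifold (𝓡 n) ∞ S]

variable {a} in
/-- It suffices to test the vanishing of a multi-derivation on the conormal bundle of the graph on
the linear coordinates relative to the graph. -/
theorem IsMultiDer.vanishesOnGraph {e : ℤ} {Ψ : List D.HFun → D.FunE} (hΨ : IsMultiDer e Ψ)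
    (h : ∀ L : List D.Lin, VanishesOnGraph a (Ψ (L.map (shiftFun a)))) (L : List D.HFun)
    (hL : ∀ f ∈ L, f.val ∈ D.fromK₀ ∧ VanishesOnGraph a f.val) : VanishesOnGraph a (Ψ L) := by
  -- As for `IsMultiDer.eq_zero`, arbitrary functions in the ideal of the graph are exchanged one by
  -- one for relative linear coordinates.
  suffices h : ∀ (L₁ : List D.HFun), (∀ f ∈ L₁, f.val ∈ D.fromK₀ ∧ VanishesOnGraph a f.val) →
      ∀ (L₂ : List D.Lin), VanishesOnGraph a (Ψ (L₁ ++ L₂.map (shiftFun a))) by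
    simpa using h L hL []
  intro L₁
  induction L₁ using List.reverseRecOn with
  | nil => simpa using h
  | append_singleton L₁ f ih =>
    intro hL₁ L₂ s
    rw [List.append_assoc, List.singleton_append, hΨ.symm.move]
    rw [Pi.smul_apply, map_smul]
    refine smul_eq_zero_of_right _ ?_
    obtain ⟨hf, hf'⟩ := hL₁ f (by simp)
    let ρ := D.pull s LinearMap.id (a.2.toFun s)
    have hlam := hΨ.twisted (L₁ ++ L₂.map (shiftFun a)) (x := (⟨s, a.1.toFun s⟩ : D.M)) ρ
    set lam : D.HFun → D.FibA s := fun f =>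
      ρ (Ψ (L₁ ++ L₂.map (shiftFun a) ++ [f]) ⟨s, a.1.toFun s⟩) with hlamdef
    have hl : ∀ l : D.Lin, lam (linFun l) = lam (graphFun a l) := fun l => by
      have h1 := ih (fun f hf => hL₁ f (by simp [hf])) (L₂ ++ [l]) s
      have h2 := hlam.lin (-1) (graphFun a l) (linFun l) (shiftFun a l) rfl rfl
        (by simp [graphFun, linFun, shiftFun, sub_eq_neg_add])
      have h3 : lam (shiftFun a l) = 0 := by simpa [hlamdef] using h1
      rw [h3, neg_one_smul, neg_add_eq_sub, eq_comm, sub_eq_zero] at h2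
      exact h2
    have hres : ∀ f : D.HFun, ρ ((restrictK₀ f).val ⟨s, a.1.toFun s⟩) =
        ρ (f.val ⟨s, a.1.toFun s⟩) := fun f => pull_toK₀ _ _ _
    have hret : ∀ f : D.HFun, ρ ((retract a f).val ⟨s, a.1.toFun s⟩) =
        ρ (f.val ⟨s, a.1.toFun s⟩) := fun f => pull_inclA _ _
    -- Restriction to E_{k₀} and retraction onto the graph are multiplicative and have the same
    -- value under ρ, so the difference of the two compositions with `lam` is again a twisted
    -- derivation. On f in the ideal it equals `lam f`, because the retraction of f is zero; it
    -- remains to check generators.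
    have hμ : IsTwistedDer (x := (⟨s, a.1.toFun s⟩ : D.M)) ρ (e + wt (L₁ ++ L₂.map (shiftFun a)))
        fun f => lam (restrictK₀ f) - lam (retract a f) := by
      constructor
      · intro c f g k h1 h2 h3
        rw [hlam.lin c (restrictK₀ f) (restrictK₀ g) (restrictK₀ k) h1 h2
            (funext fun x => by simp [restrictK₀, h3]),
          hlam.lin c (retract a f) (retract a g) (retract a k) h1 h2
            (funext fun x => by simp [retract, h3])]
        module
      · intro f g k h1 h2
        rw [hlam.leibniz (restrictK₀ f) (restrictK₀ g) (restrictK₀ k) h1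
            (funext fun x => by simp [restrictK₀, h2]),
          hlam.leibniz (retract a f) (retract a g) (retract a k) h1
            (funext fun x => by simp [retract, h2])]
        rw [hres, hret, hres, hret, sub_mul, mul_sub]
        simp only [restrictK₀, retract]
        module
    have h0 := hμ.eq_zero (fun h => ?_) ?_ f
    · have h1 : restrictK₀ f = f := HFun.ext' rfl (funext fun x => hf x)
      have h2 : lam (retract a f) = 0 := hlam.map_zero (funext fun x => by
        simp [retract, hf' x.proj])
      rw [h1, h2, sub_zero] at h0
      exact h0
    · have h1 : restrictK₀ (HFun.ofSmooth h) = HFun.ofSmooth h :=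
        HFun.ext' rfl (funext fun x => by simp [restrictK₀, HFun.ofSmooth])
      have h2 : retract a (HFun.ofSmooth h) =
          HFun.ofSmooth (IsTwistedDer.alongSec D a.1 h) :=
        HFun.ext' rfl (funext fun x => by
          simp [retract, HFun.ofSmooth, IsTwistedDer.alongSec])
      rw [h1, h2, sub_eq_zero]
      exact hlam.smooth_eq a.1 rfl (fun f => hl (.inl f)) h
    · rintro (_ | _ | k) b
      · have h1 : restrictK₀ (HFun.ofGen (D := D) .a b) = HFun.ofGen .a b :=
          HFun.ext' rfl (funext fun x => toK₀_genA _)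
        have h2 : retract a (HFun.ofGen (D := D) .a b) = HFun.ofGen .a b :=
          HFun.ext' rfl (funext fun x =>
            (congrArg (D.inclA x.proj) (pull_genA _ _ _)).trans (inclA_gen _))
        rw [h1, h2, sub_self]
      · have h1 : restrictK₀ (HFun.ofGen (D := D) .b b) = linFun (.inr b) :=
          HFun.ext' rfl (funext fun x => toK₀_genB _)
        have h2 : retract a (HFun.ofGen (D := D) .b b) = graphFun a (.inr b) :=
          HFun.ext' rfl (funext fun x =>
            (congrArg (D.inclA x.proj) (pull_genB _ _ _)).trans (inclA_gen _))
        rw [h1, h2, hl, sub_self]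
      · have h1 : (restrictK₀ (HFun.ofGen (D := D) (.g k) b)).val = 0 :=
          funext fun x => toK₀_genG _ _
        have h2 : (retract a (HFun.ofGen (D := D) (.g k) b)).val = 0 :=
          funext fun x =>
            (congrArg (D.inclA x.proj) (pull_genG _ _ _ _)).trans (map_zero _)
        rw [hlam.map_zero h1, hlam.map_zero h2, sub_self]

/-- Deformations are characterized by the linear coordinates relative to the graph. -/
theorem mem_deformations_iff (Q : BlendedQ D) : a ∈ deformations Q ↔
    ∀ L : List D.Lin, VanishesOnGraph a (Q.eval (L.map (shiftFun a))) := by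
  simp only [deformations, Set.mem_ofPred_eq, IsCoisotropicType, vanishesOn_graph_iff]
  refine ⟨fun h L => h _ fun f hf => ?_, fun h => Q.isMultiDer.vanishesOnGraph h⟩
  obtain ⟨l, -, rfl⟩ := List.mem_map.1 hf
  exact ⟨shiftFun_mem_fromK₀ a l, vanishesOnGraph_shiftFun a l⟩

end Graph

end Setup

end

section

/-! ### Curves in a vector space without topology -/

section Curves

variable {R : Type*} [AddCommGroup R] [Module ℝ R]

/-- The coefficients of the curve `γ` have the coefficients of `w` as derivatives at `t`. -/
def HasWDeriv (γ : ℝ → R) (w : R) (t : ℝ) : Prop :=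
  ∀ c : Module.Dual ℝ R, HasDerivAt (fun t => c (γ t)) (c w) t

namespace HasWDeriv

variable {γ γ' : ℝ → R} {w w' : R} {t : ℝ}

theorem unique (h : HasWDeriv γ w t) (h' : HasWDeriv γ w' t) : w = w' := by
  rw [← sub_eq_zero, ← Module.forall_dual_apply_eq_zero_iff ℝ]
  intro c
  rw [map_sub, (h c).unique (h' c), sub_self]

theorem add (h : HasWDeriv γ w t) (h' : HasWDeriv γ' w' t) :
    HasWDeriv (fun t => γ t + γ' t) (w + w') t := fun c => by
  simpa using HasDerivAt.fun_add (h c) (h' c)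

theorem smul (a : ℝ) (h : HasWDeriv γ w t) : HasWDeriv (fun t => a • γ t) (a • w) t := fun c => by
  simpa using (h c).const_mul a

theorem congr (h : HasWDeriv γ w t) (h' : ∀ᶠ r in 𝓝 t, γ' r = γ r) : HasWDeriv γ' w t :=
  fun c => (h c).congr_of_eventuallyEq (by
    filter_upwards [h'] with r hr
    rw [hr])

theorem const (w : R) (t : ℝ) : HasWDeriv (fun _ => w) 0 t := fun c => by
  simpa using hasDerivAt_const t (c w)

theorem map {R' : Type*} [AddCommGroup R'] [Module ℝ R'] (h : HasWDeriv γ w t)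
    (T : R →ₗ[ℝ] R') : HasWDeriv (fun t => T (γ t)) (T w) t := fun c => h (c.comp T)

/-- In the quotient by U the curve is constantly zero. No closedness of U is needed, since algebraic
functionals separate the points of every quotient. -/
theorem mem (h : HasWDeriv γ w t) {U : Submodule ℝ R} (hU : ∀ t, γ t ∈ U) : w ∈ U := by
  rw [← Submodule.Quotient.mk_eq_zero]
  have h1 := h.map U.mkQ
  have h2 : (fun t => U.mkQ (γ t)) = fun _ => 0 :=
    funext fun t => (Submodule.Quotient.mk_eq_zero U).2 (hU t)
  rw [h2] at h1
  exact h1.unique (const 0 t)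

theorem smul_const {h : ℝ → ℝ} {h' : ℝ} (hh : HasDerivAt h h' t) (w : R) :
    HasWDeriv (fun t => h t • w) (h' • w) t := fun c => by
  simpa using hh.mul_const (c w)

theorem comp_sub (h : HasWDeriv γ w 0) (t : ℝ) : HasWDeriv (fun r => γ (r - t)) w t := fun c => by
  have h1 : HasDerivAt (fun r => c (γ r)) (c w) (t - t) := by simpa using h c
  exact h1.comp_sub_const t t

end HasWDeriv

variable (R) in
/-- The curves that are finite linear combinations of vectors with smooth coefficients. -/
def smoothCurves : Submodule ℝ (ℝ → R) :=
  Submodule.span ℝ {γ | ∃ (h : ℝ → ℝ) (u : R), ContDiff ℝ ∞ h ∧ γ = fun t => h t • u}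

theorem smul_mem_smoothCurves {h : ℝ → ℝ} (hh : ContDiff ℝ ∞ h) (u : R) :
    (fun t => h t • u) ∈ smoothCurves R := Submodule.subset_span ⟨h, u, hh, rfl⟩

theorem const_mem_smoothCurves (u : R) : (fun _ => u) ∈ smoothCurves R := by
  simpa using smul_mem_smoothCurves (contDiff_const (c := (1 : ℝ))) u

theorem contDiff_of_mem_smoothCurves {γ : ℝ → R} (hγ : γ ∈ smoothCurves R)
    (c : Module.Dual ℝ R) : ContDiff ℝ ∞ fun t => c (γ t) := by
  induction hγ using Submodule.span_induction with
  | mem γ h =>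
    obtain ⟨h, u, hh, rfl⟩ := h
    simpa using hh.mul contDiff_const
  | zero => simpa using contDiff_const
  | add γ δ _ _ h h' => simpa using h.add h'
  | smul a γ _ h => simpa using contDiff_const.mul h

theorem exists_hasWDeriv {γ : ℝ → R} (hγ : γ ∈ smoothCurves R) (t : ℝ) :
    ∃ w, HasWDeriv γ w t := by
  induction hγ using Submodule.span_induction with
  | mem γ h =>
    obtain ⟨h, u, hh, rfl⟩ := h
    exact ⟨_, .smul_const (hh.differentiable (by simp) t).hasDerivAt u⟩
  | zero => exact ⟨0, .const 0 t⟩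
  | add γ δ _ _ h h' =>
    obtain ⟨w, hw⟩ := h
    obtain ⟨w', hw'⟩ := h'
    exact ⟨_, hw.add hw'⟩
  | smul a γ _ h =>
    obtain ⟨w, hw⟩ := h
    exact ⟨_, hw.smul a⟩

variable {R : Type*} [Ring R] [Algebra ℝ R]

theorem mul_mem_smoothCurves {γ δ : ℝ → R} (hγ : γ ∈ smoothCurves R) (hδ : δ ∈ smoothCurves R) :
    γ * δ ∈ smoothCurves R := by
  refine Submodule.span_induction₂ (p := fun γ δ _ _ => γ * δ ∈ smoothCurves R)
    ?_ (by simp) (by simp) ?_ ?_ ?_ ?_ hγ hδ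
  · rintro _ _ ⟨h, u, hh, rfl⟩ ⟨h', u', hh', rfl⟩
    convert smul_mem_smoothCurves (hh.mul hh') (u * u') using 1
    funext t
    simp [smul_smul, mul_comm]
  · intro x y z _ _ _ h1 h2
    rw [add_mul]; exact add_mem h1 h2
  · intro x y z _ _ _ h1 h2
    rw [mul_add]; exact add_mem h1 h2
  · intro r x y _ _ h
    rw [smul_mul_assoc]; exact Submodule.smul_mem _ _ h
  · intro r x y _ _ h
    rw [mul_smul_comm]; exact Submodule.smul_mem _ _ h

/-- A functional of a product is not determined by functionals of the factors. For finite sums of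
curves h(t) u the rule reduces to the product rule for the scalar coefficients. -/
theorem HasWDeriv.mul {γ δ : ℝ → R} (hγ : γ ∈ smoothCurves R) (hδ : δ ∈ smoothCurves R) {t : ℝ}
    {w w' : R} (h : HasWDeriv γ w t) (h' : HasWDeriv δ w' t) :
    HasWDeriv (fun t => γ t * δ t) (w * δ t + γ t * w') t := by
  -- Existential derivatives keep the span induction free of the given w and w'; uniqueness
  -- identifies them at the end.
  have key : ∃ w w', HasWDeriv γ w t ∧ HasWDeriv δ w' t ∧
      HasWDeriv (fun t => γ t * δ t) (w * δ t + γ t * w') t := by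
    refine Submodule.span_induction₂ (p := fun γ δ _ _ => ∃ w w', HasWDeriv γ w t ∧
      HasWDeriv δ w' t ∧ HasWDeriv (fun t => γ t * δ t) (w * δ t + γ t * w') t)
      ?_ ?_ ?_ ?_ ?_ ?_ ?_ hγ hδ
    · rintro _ _ ⟨h, u, hh, rfl⟩ ⟨h', u', hh', rfl⟩
      have h1 := (hh.differentiable (by simp) t).hasDerivAt
      have h2 := (hh'.differentiable (by simp) t).hasDerivAt
      refine ⟨_, _, .smul_const h1 u, .smul_const h2 u', ?_⟩
      have h3 := HasWDeriv.smul_const (h1.mul h2) (u * u')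
      convert h3 using 1
      · funext t
        simp [smul_smul, mul_comm]
      · simp only [smul_mul_assoc, mul_smul_comm, add_smul, smul_smul]
        rw [mul_comm (h t), mul_comm (h' t)]
    · intro δ hδ
      obtain ⟨w, hw⟩ := exists_hasWDeriv hδ t
      exact ⟨0, w, .const 0 t, hw, by simpa using HasWDeriv.const (0 : R) t⟩
    · intro γ hγ
      obtain ⟨w, hw⟩ := exists_hasWDeriv hγ t
      exact ⟨w, 0, hw, .const 0 t, by simpa using HasWDeriv.const (0 : R) t⟩
    · rintro γ₁ γ₂ δ _ _ _ ⟨w₁, w₁', h1, h2, h3⟩ ⟨w₂, w₂', k1, k2, k3⟩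
      obtain rfl := h2.unique k2
      refine ⟨w₁ + w₂, w₁', h1.add k1, h2, ?_⟩
      convert h3.add k3 using 1
      · funext t; simp [add_mul]
      · simp only [Pi.add_apply, add_mul]; abel
    · rintro γ δ₁ δ₂ _ _ _ ⟨w₁, w₁', h1, h2, h3⟩ ⟨w₂, w₂', k1, k2, k3⟩
      obtain rfl := h1.unique k1
      refine ⟨w₁, w₁' + w₂', h1, h2.add k2, ?_⟩
      convert h3.add k3 using 1
      · funext t; simp [mul_add]
      · simp only [Pi.add_apply, mul_add]; abel
    · rintro a γ δ _ _ ⟨w, w', h1, h2, h3⟩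
      refine ⟨a • w, w', h1.smul a, h2, ?_⟩
      convert h3.smul a using 1
      · funext t; simp
      · simp [smul_add]
    · rintro a γ δ _ _ ⟨w, w', h1, h2, h3⟩
      refine ⟨w, a • w', h1, h2.smul a, ?_⟩
      convert h3.smul a using 1
      · funext t; simp
      · simp [smul_add]
  obtain ⟨w₁, w₁', h1, h2, h3⟩ := key
  rwa [h.unique h1, h'.unique h2]

end Curves

variable {n : ℕ} {S : Type u} [TopologicalSpace S] [ChartedSpace (EuclideanSpace ℝ (Fin n)) S]

/-! ### Translation along t(σ, φ) and the derivation σ ∂_y + φ ∂_η. -/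

namespace Setup

variable {D : Setup.{u, v} n S} [T2Space S] [IsManifold (𝓡 n) ∞ S]

/-- Polynomials in smooth functions on the body and linear coordinates. -/
abbrev polyE (D : Setup.{u, v} n S) : Subalgebra ℝ D.FunE :=
  Algebra.adjoin ℝ (basicFun D.deg D.E ((𝓡 n).prod 𝓘(ℝ, D.N.F)) (fun x : D.M => x.proj))

/-- The family θ is left free so that the identity and the shears by tφ are treated together. -/
theorem polyE_curve {g : D.FunE} (hg : g ∈ polyE D) {s : S} (y z : D.N.V s)
    (θ : ℝ → D.FibE s →ₐ[ℝ] D.FibE s)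
    (hθ : ∀ i x, (fun t => θ t (GSym.gen D.deg _ i x)) ∈ smoothCurves (D.FibE s)) :
    (fun t : ℝ => θ t (g (⟨s, y + t • z⟩ : D.M))) ∈ smoothCurves (D.FibE s) := by
  induction hg using Algebra.adjoin_induction with
  | mem b hb =>
    rcases hb with ⟨h, hh, rfl⟩ | ⟨i, α, rfl⟩
    · have h1 := smul_mem_smoothCurves (contDiff_along_line hh y z) (1 : D.FibE s)
      simp only [← Algebra.algebraMap_eq_smul_one] at h1
      simpa only [AlgHom.commutes] using h1
    · exact hθ i (α.toFun s)
  | algebraMap r =>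
    have h1 := const_mem_smoothCurves (algebraMap ℝ (D.FibE s) r)
    simpa only [Pi.algebraMap_apply, AlgHom.commutes] using h1
  | add g g' _ _ h h' =>
    simp only [Pi.add_apply, map_add]
    exact add_mem h h'
  | mul g g' _ _ h h' =>
    simp only [Pi.mul_apply, map_mul]
    exact mul_mem_smoothCurves h h'

theorem contDiff_smooth_line {f : D.FunE} (hf : f ∈ D.smE) {s : S} (y z : D.N.V s)
    (c : Module.Dual ℝ (D.FibE s)) :
    ContDiff ℝ ∞ fun t : ℝ => c (f (⟨s, y + t • z⟩ : D.M)) := by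
  rw [contDiff_iff_contDiffAt]
  intro t
  obtain ⟨g, hg, hg'⟩ := hf (⟨s, y + t • z⟩ : D.M)
  have h1 := contDiff_of_mem_smoothCurves (polyE_curve hg y z (fun _ => AlgHom.id ℝ _)
    fun i x => const_mem_smoothCurves _) c
  refine h1.contDiffAt.congr_of_eventuallyEq ?_
  filter_upwards [(continuous_line y z).continuousAt.eventually hg'] with r hr
  simp [hr]

section Flow

variable (a : Sec D.N × HomSec D.A D.B)

/-- The curve of values at `x` of the translates of a function along `t (σ, φ)`. -/
def flowCurve (f : D.FunE) (x : D.M) (t : ℝ) : D.FibE x.proj :=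
  D.shear x.proj (t • a.2.toFun x.proj) (f ⟨x.proj, x.2 + t • a.1.toFun x.proj⟩)

theorem shear_smul_genB {s : S} (φ : D.A.V s →ₗ[ℝ] D.B.V s) (t : ℝ)
    (x : Module.Dual ℝ (D.B.V s)) :
    D.shear s (t • φ) (D.genB s x) = D.genB s x + t • D.genA s (x.comp φ) := by
  rw [shear_genB, LinearMap.comp_smul, map_smul]

theorem flowCurve_zero (f : D.FunE) (x : D.M) : flowCurve a f x 0 = f x := by
  have h : ∀ y : D.N.V x.proj, y = x.2 → f ⟨x.proj, y⟩ = f x := by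
    rintro _ rfl
    rfl
  rw [flowCurve, zero_smul, shear_zero]
  exact h _ (by simp)

theorem shear_gen_smoothCurves (s : S) (φ : D.A.V s →ₗ[ℝ] D.B.V s) (i) (x) :
    (fun t : ℝ => D.shear s (t • φ) (GSym.gen D.deg (fun i => Module.Dual ℝ ((D.E i).V s)) i x)) ∈
      smoothCurves (D.FibE s) := by
  rcases i with _ | _ | k
  · exact (funext fun t : ℝ => shear_genA (t • φ) x :
      (fun t : ℝ => D.shear s (t • φ) (D.genA s x)) = _) ▸ const_mem_smoothCurves _
  · have h : (fun t : ℝ => D.shear s (t • φ) (D.genB s x)) =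
        (fun _ : ℝ => D.genB s x) + fun t : ℝ => t • D.genA s (x.comp φ) :=
      funext fun t => shear_smul_genB φ t x
    exact h ▸ add_mem (const_mem_smoothCurves _) (smul_mem_smoothCurves contDiff_id _)
  · exact (funext fun t : ℝ => shear_genG (t • φ) k x :
      (fun t : ℝ => D.shear s (t • φ) (D.genG s k x)) = _) ▸ const_mem_smoothCurves _

theorem flowCurve_mem {g : D.FunE} (hg : g ∈ polyE D) (x : D.M) :
    flowCurve a g x ∈ smoothCurves (D.FibE x.proj) :=
  polyE_curve hg _ _ _ (shear_gen_smoothCurves _ _)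

theorem flowCurve_eventuallyEq {f g : D.FunE} {x : D.M} (h : ∀ᶠ y in 𝓝 x, f y = g y) :
    ∀ᶠ t in 𝓝 (0 : ℝ), flowCurve a f x t = flowCurve a g x t := by
  have hc : Filter.Tendsto (fun t : ℝ => (⟨x.proj, x.2 + t • a.1.toFun x.proj⟩ : D.M)) (𝓝 0)
      (𝓝 x) := by
    have := (continuous_line (E := D.N) x.2 (a.1.toFun x.proj)).tendsto 0
    simpa using this
  filter_upwards [hc.eventually h] with t ht
  rw [flowCurve, flowCurve, ht]

/-- On generators the derivative is explicit: a vertical derivative on functions of the body, zero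
on the coordinates of A and of the G_k, and η ↦ η ∘ φ. The product rule extends it to polynomials,
so the derivation preserves smoothness. -/
theorem exists_polyE_deriv {g : D.FunE} (hg : g ∈ polyE D) :
    ∃ g' ∈ polyE D, ∀ x, HasWDeriv (flowCurve a g x) (g' x) 0 := by
  induction hg using Algebra.adjoin_induction with
  | mem b hb =>
    rcases hb with ⟨h, hh, rfl⟩ | ⟨i, α, rfl⟩
    · obtain ⟨h', hh', hd⟩ := exists_vertical_deriv hh a.1
      refine ⟨_, Algebra.subset_adjoin (Or.inl ⟨h', hh', rfl⟩), fun x => ?_⟩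
      have := HasWDeriv.smul_const (hd x.proj x.2) (1 : D.FibE x.proj)
      simp only [← Algebra.algebraMap_eq_smul_one] at this
      exact this.congr (.of_forall fun t => AlgHom.commutes _ _)
    · rcases i with _ | _ | k
      · refine ⟨0, zero_mem _, fun x => ?_⟩
        exact (HasWDeriv.const (D.genA x.proj (α.toFun x.proj)) 0).congr
          (.of_forall fun t => shear_genA _ _)
      · refine ⟨_, Algebra.subset_adjoin (Or.inr ⟨.a, DualSec.comp α a.2, rfl⟩), fun x => ?_⟩
        have := (HasWDeriv.const (D.genB x.proj (α.toFun x.proj)) 0).add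
          (HasWDeriv.smul_const (hasDerivAt_id (0 : ℝ))
            (D.genA x.proj ((α.toFun x.proj).comp (a.2.toFun x.proj))))
        rw [zero_add, one_smul] at this
        exact this.congr (.of_forall fun t => shear_smul_genB _ _ _)
      · refine ⟨0, zero_mem _, fun x => ?_⟩
        exact (HasWDeriv.const (D.genG x.proj k (α.toFun x.proj)) 0).congr
          (.of_forall fun t => shear_genG _ _ _)
  | algebraMap r =>
    refine ⟨0, zero_mem _, fun x => ?_⟩
    exact (HasWDeriv.const (algebraMap ℝ (D.FibE x.proj) r) 0).congr
      (.of_forall fun t => AlgHom.commutes _ _)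
  | add g g' _ _ h h' =>
    obtain ⟨k, hk, hk'⟩ := h
    obtain ⟨l, hl, hl'⟩ := h'
    exact ⟨k + l, add_mem hk hl, fun x => ((hk' x).add (hl' x)).congr
      (.of_forall fun t => map_add _ _ _)⟩
  | mul g g' hg hg' h h' =>
    obtain ⟨k, hk, hk'⟩ := h
    obtain ⟨l, hl, hl'⟩ := h'
    refine ⟨k * g' + g * l, add_mem (mul_mem hk hg') (mul_mem hg hl), fun x => ?_⟩
    have := ((hk' x).mul (flowCurve_mem a hg x) (flowCurve_mem a hg' x) (hl' x)).congr
      (γ' := flowCurve a (g * g') x) (.of_forall fun t => map_mul _ _ _)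
    rwa [flowCurve_zero, flowCurve_zero] at this

open Classical in
/-- The derivative of functions along `(σ, φ)`, i.e. `σ ∂_y + φ ∂_η`. -/
def derivAlong (f : D.FunE) : D.FunE := fun x =>
  if h : ∃ w, HasWDeriv (flowCurve a f x) w 0 then h.choose else 0

theorem derivAlong_eq {f : D.FunE} {x : D.M} {w : D.FibE x.proj}
    (h : HasWDeriv (flowCurve a f x) w 0) : derivAlong a f x = w := by
  have h' : ∃ w, HasWDeriv (flowCurve a f x) w 0 := ⟨w, h⟩
  rw [derivAlong, dif_pos h']
  exact h'.choose_spec.unique h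

theorem hasWDeriv_derivAlong {f : D.FunE} (hf : f ∈ D.smE) (x : D.M) :
    HasWDeriv (flowCurve a f x) (derivAlong a f x) 0 := by
  obtain ⟨g, hg, hg'⟩ := hf x
  obtain ⟨g₁, -, h⟩ := exists_polyE_deriv a hg
  have h2 := (h x).congr (flowCurve_eventuallyEq a hg')
  rwa [derivAlong_eq a h2]

theorem derivAlong_mem_smE {f : D.FunE} (hf : f ∈ D.smE) : derivAlong a f ∈ D.smE := by
  intro x
  obtain ⟨g, hg, hg'⟩ := hf x
  obtain ⟨g₁, hg₁, h⟩ := exists_polyE_deriv a hg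
  refine ⟨g₁, hg₁, ?_⟩
  -- The derivative at y sees a neighbourhood of y, so `f` and `g` must agree near each y close to
  -- x, not only at y.
  filter_upwards [eventually_eventually_nhds.2 hg'] with y hy
  exact derivAlong_eq a ((h y).congr (flowCurve_eventuallyEq a hy))

/-- Translates of a function of degree m stay in degree m, and derivatives of curves in a subspace
remain in it. -/
theorem derivAlong_mem {f : D.FunE} {m : ℤ} (hf : f ∈ D.smoothE m) :
    derivAlong a f ∈ D.smoothE m :=
  ⟨derivAlong_mem_smE a hf.1, fun x => (hasWDeriv_derivAlong a hf.1 x).mem fun t =>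
    shear_homog _ (hf.2 ⟨x.proj, x.2 + t • a.1.toFun x.proj⟩)⟩

theorem derivAlong_lin {f g : D.FunE} (hf : f ∈ D.smE) (hg : g ∈ D.smE) (c : ℝ) :
    derivAlong a (c • f + g) = c • derivAlong a f + derivAlong a g := by
  funext x
  exact derivAlong_eq a ((((hasWDeriv_derivAlong a hf x).smul c).add
    (hasWDeriv_derivAlong a hg x)).congr (.of_forall fun t => by
      simp [flowCurve]))

theorem derivAlong_mul {f g : D.FunE} (hf : f ∈ D.smE) (hg : g ∈ D.smE) :
    derivAlong a (f * g) = derivAlong a f * g + f * derivAlong a g := by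
  funext x
  obtain ⟨f₁, hf₁, hf'⟩ := hf x
  obtain ⟨g₁, hg₁, hg'⟩ := hg x
  have hF := (hasWDeriv_derivAlong a hf x).congr (γ' := flowCurve a f₁ x)
    ((flowCurve_eventuallyEq a hf').mono fun _ h => h.symm)
  have hG := (hasWDeriv_derivAlong a hg x).congr (γ' := flowCurve a g₁ x)
    ((flowCurve_eventuallyEq a hg').mono fun _ h => h.symm)
  have h := hF.mul (flowCurve_mem a hf₁ x) (flowCurve_mem a hg₁ x) hG
  have h' := h.congr (γ' := flowCurve a (f * g) x) (by
    filter_upwards [flowCurve_eventuallyEq a hf', flowCurve_eventuallyEq a hg'] with t h1 h2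
    rw [← h1, ← h2]
    exact map_mul _ _ _)
  rw [derivAlong_eq a h']
  simp [flowCurve_zero, hf'.self_of_nhds, hg'.self_of_nhds]

theorem derivAlong_eq_zero {f : D.FunE} (h : ∀ x t, flowCurve a f x t = f x) :
    derivAlong a f = 0 := by
  funext x
  exact derivAlong_eq a ((HasWDeriv.const (f x) 0).congr (.of_forall (h x)))

theorem derivAlong_fromA {f : D.FunE} (hf : f ∈ D.fromA) : derivAlong a f = 0 := by
  obtain ⟨g, -, hg⟩ := hf
  refine derivAlong_eq_zero a fun x t => ?_
  rw [flowCurve, hg, hg, shear_inclA]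

theorem derivAlong_linVal (l : D.Lin) : derivAlong a (linVal l) = graphVal a l := by
  funext x
  refine derivAlong_eq a ?_
  cases l with
  | inl f =>
    have h := HasWDeriv.smul_const (((hasDerivAt_id (0 : ℝ)).mul_const
      (f.toFun x.proj (a.1.toFun x.proj))).const_add (f.toFun x.proj x.2)) (1 : D.FibE x.proj)
    rw [one_mul] at h
    simp only [← Algebra.algebraMap_eq_smul_one] at h
    refine h.congr (.of_forall fun t => ?_)
    simp [flowCurve, linVal]
  | inr f =>
    have := (HasWDeriv.const (D.genB x.proj (f.toFun x.proj)) 0).add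
      (HasWDeriv.smul_const (hasDerivAt_id (0 : ℝ))
        (D.genA x.proj ((f.toFun x.proj).comp (a.2.toFun x.proj))))
    rw [zero_add, one_smul] at this
    refine this.congr (.of_forall fun t => ?_)
    simp [flowCurve, linVal, LinearMap.comp_smul]

/-- The pull-back to the graph of `t φ` over `t σ` is differentiable in `t`. -/
theorem hasWDeriv_pull {f : D.FunE} (hf : f ∈ D.smE) (s : S) (t : ℝ) :
    HasWDeriv (fun t : ℝ => D.pull s LinearMap.id (t • a.2.toFun s)
        (f (⟨s, t • a.1.toFun s⟩ : D.M)))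
      (D.pull s LinearMap.id (t • a.2.toFun s)
        (derivAlong a f (⟨s, t • a.1.toFun s⟩ : D.M))) t := by
  -- The derivative at time t is the one at time 0 based at the point tσ: pulling back along tφ
  -- after shearing by (r - t)φ is pulling back along rφ.
  have h := (hasWDeriv_derivAlong a hf (⟨s, t • a.1.toFun s⟩ : D.M)).map
    (D.pull s LinearMap.id (t • a.2.toFun s)).toLinearMap
  refine (h.comp_sub t).congr (.of_forall fun r => ?_)
  simp only [flowCurve, AlgHom.toLinearMap_apply]
  rw [← pull_shear (t • a.2.toFun s), shear_shear, pull_shear, ← add_smul, ← add_smul,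
    add_sub_cancel]

end Flow

end Setup

end

section

variable {n : ℕ} {S : Type u} [TopologicalSpace S] [ChartedSpace (EuclideanSpace ℝ (Fin n)) S]

namespace Setup

variable {D : Setup.{u, v} n S} [T2Space S] [IsManifold (𝓡 n) ∞ S]

section Field

variable (a : Sec D.N × HomSec D.A D.B)

/-! ### The vertical vector field of a pair of sections -/

/-- The values of the vector field `-(σ ∂_y + φ ∂_η)` as a multi-bracket. -/
def fieldFun : List D.HFun → D.FunE
  | [f] => - derivAlong a f.val
  | _ => 0

theorem fieldFun_eq_zero {L : List D.HFun} (hL : L.length ≠ 1) : fieldFun a L = 0 := by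
  match L with
  | [] => rfl
  | [_] => simp at hL
  | _ :: _ :: _ => rfl

/-- The vector field `-(σ ∂_y + φ ∂_η)`. -/
def field : Coch D 0 where
  toFun := fieldFun a
  mem L := by
    match L with
    | [] => exact zero_mem _
    | [f] =>
      have h : (0 : ℤ) + 1 + wt [f] = f.deg := by simp [wt]
      rw [h]
      exact neg_mem (derivAlong_mem a f.mem)
    | _ :: _ :: _ => exact zero_mem _

theorem field_isMultiVectorField : (field a).IsMultiVectorField where
  linear L c f g h h1 h2 h3 := by
    change fieldFun a _ = c • fieldFun a _ + fieldFun a _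
    match L with
    | [] =>
      simp only [List.nil_append, fieldFun, h3]
      rw [derivAlong_lin a f.mem.1 g.mem.1]
      module
    | k :: L =>
      rw [fieldFun_eq_zero, fieldFun_eq_zero, fieldFun_eq_zero] <;> simp
  symm L L' f g := by
    change fieldFun a _ = _ • fieldFun a _
    rw [fieldFun_eq_zero, fieldFun_eq_zero]
    · simp
    · simp only [List.length_append, List.length_cons]; omega
    · simp only [List.length_append, List.length_cons]; omega
  leibniz L f g h h1 h2 := by
    change fieldFun a _ = fieldFun a _ * _ + _ • (_ * fieldFun a _)
    match L with
    | [] =>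
      simp only [List.nil_append, fieldFun, h2, wt, List.map_nil, List.sum_nil, add_zero, zero_mul,
        zpow_zero, one_smul]
      rw [derivAlong_mul a f.mem.1 g.mem.1, neg_add, neg_mul, mul_neg]
    | k :: L =>
      rw [fieldFun_eq_zero, fieldFun_eq_zero, fieldFun_eq_zero] <;> simp
  finite := ⟨1, fun L hL => fieldFun_eq_zero a (by omega)⟩

theorem fieldFun_linFun (L : List D.Lin) : fieldFun a (L.map linFun) ∈ D.fromA := by
  match L with
  | [] => exact zero_mem_fromA
  | [l] =>
    obtain ⟨g, hg, hg'⟩ := graphVal_mem_fromA a l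
    refine ⟨-g, (smoothAlg (fun _ : Unit => D.j₀) (fun _ : Unit => D.A) (𝓡 n)
      (fun s : S => s)).neg_mem hg, fun x => ?_⟩
    change -(derivAlong a (linVal l) x) = _
    rw [derivAlong_linVal, hg']
    simp
  | _ :: _ :: _ => exact zero_mem_fromA

theorem field_mem_vertical : field a ∈ vertical D 0 := by
  refine ⟨field_isMultiVectorField a, fun L f hf => ?_, fun L f k θ hf => ?_,
    fieldFun_linFun a⟩
  · change fieldFun a _ = 0
    match L with
    | [] => simp [fieldFun, derivAlong_fromA a hf]
    | k :: L => exact fieldFun_eq_zero a (by simp)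
  · change fieldFun a _ = 0
    match L with
    | [] =>
      have : derivAlong a f.val = 0 := by
        refine derivAlong_eq_zero a fun x t => ?_
        rw [hf]
        exact shear_genG _ _ _
      simp [fieldFun, this]
    | k :: L => exact fieldFun_eq_zero a (by simp)

theorem P_field : P (field a) = -ofSections a := by
  funext L s
  change D.pull s LinearMap.id 0 (fieldFun a (L.map linFun) (⟨s, 0⟩ : D.M)) = -(ofSections a L s)
  match L with
  | [] => simp [fieldFun, ofSections]
  | [.inl f] =>
    change D.pull s LinearMap.id 0 (-(derivAlong a (linVal (.inl f)) ⟨s, 0⟩)) = _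
    rw [derivAlong_linVal]
    simp [graphVal, ofSections]
  | [.inr f] =>
    change D.pull s LinearMap.id 0 (-(derivAlong a (linVal (.inr f)) ⟨s, 0⟩)) = _
    rw [derivAlong_linVal]
    simp [graphVal, ofSections, LinearMap.comp_id]
  | _ :: _ :: _ => simp [fieldFun, ofSections]

/-- This makes the abstract injection explicit, and so turns the higher derived brackets of -(σ, φ)
into iterated brackets with a concrete vector field. -/
theorem I_neg_ofSections : I 0 (-ofSections a) = field a :=
  I_eq (field_mem_vertical a) (P_field a)

/-! ### The adjoint action of the vector field -/

/-- The derivative along `(σ, φ)` of a homogeneous function. -/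
def derivH (f : D.HFun) : D.HFun := ⟨f.deg, derivAlong a f.val, derivAlong_mem a f.mem⟩

/-- Graded symmetric multilinear multi-brackets with smooth values. -/
structure IsMultiLin (Ψ : List D.HFun → D.FunE) : Prop where
  linear : ∀ (L L' : List D.HFun) (c : ℝ) (f g h : D.HFun), f.deg = h.deg → g.deg = h.deg →
    h.val = c • f.val + g.val → Ψ (L ++ h :: L') = c • Ψ (L ++ f :: L') + Ψ (L ++ g :: L')
  symm : IsGSymm Ψ
  smooth : ∀ L, Ψ L ∈ D.smE

theorem Coch.smooth {d : ℤ} (Z : Coch D d) (L : List D.HFun) : Z.toFun L ∈ D.smE := (Z.mem L).1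

theorem IsMultiDer.isMultiLin {e : ℤ} {Ψ : List D.HFun → D.FunE} (h : IsMultiDer e Ψ)
    (hs : ∀ L, Ψ L ∈ D.smE) : IsMultiLin Ψ where
  linear L L' c f g k h1 h2 h3 := by
    rw [h.symm.move, h.symm.move L L' f, h.symm.move L L' g, h.linear _ c f g k h1 h2 h3, h1, h2]
    module
  symm := h.symm
  smooth := hs

theorem IsMultiLin.cons {Ψ : List D.HFun → D.FunE} (h : IsMultiLin Ψ) (f : D.HFun) :
    IsMultiLin fun L => Ψ (f :: L) where
  linear L := h.linear (f :: L)
  symm L := h.symm (f :: L)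
  smooth _ := h.smooth _

theorem IsMultiLin.head {Ψ : List D.HFun → D.FunE} (h : IsMultiLin Ψ) (L : List D.HFun) (c : ℝ)
    (f g k : D.HFun) (h1 : f.deg = k.deg) (h2 : g.deg = k.deg)
    (h3 : k.val = c • f.val + g.val) : Ψ (k :: L) = c • Ψ (f :: L) + Ψ (g :: L) :=
  h.linear [] L c f g k h1 h2 h3

/-- The sum over all the slots of the multi-bracket with the derivative inserted in that slot. -/
def insertDeriv (Ψ : List D.HFun → D.FunE) : List D.HFun → D.FunE
  | [] => 0
  | f :: L => Ψ (derivH a f :: L) + insertDeriv (fun L => Ψ (f :: L)) L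

theorem insertDeriv_lin (Ψ Ψ₁ Ψ₂ : List D.HFun → D.FunE) (c : ℝ)
    (h : ∀ L, Ψ L = c • Ψ₁ L + Ψ₂ L) (L : List D.HFun) :
    insertDeriv a Ψ L = c • insertDeriv a Ψ₁ L + insertDeriv a Ψ₂ L := by
  induction L generalizing Ψ Ψ₁ Ψ₂ with
  | nil => simp [insertDeriv]
  | cons f L ih =>
    simp only [insertDeriv]
    rw [h, ih (fun L => Ψ (f :: L)) (fun L => Ψ₁ (f :: L)) (fun L => Ψ₂ (f :: L)) fun L => h _]
    module

theorem insertDeriv_smul (Ψ Ψ₁ : List D.HFun → D.FunE) (c : ℝ)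
    (h : ∀ L, Ψ L = c • Ψ₁ L) (L : List D.HFun) :
    insertDeriv a Ψ L = c • insertDeriv a Ψ₁ L := by
  induction L generalizing Ψ Ψ₁ with
  | nil => simp [insertDeriv]
  | cons f L ih =>
    simp only [insertDeriv]
    rw [h, ih (fun L => Ψ (f :: L)) (fun L => Ψ₁ (f :: L)) fun L => h _, smul_add]

theorem IsMultiLin.insertDeriv {Ψ : List D.HFun → D.FunE} (h : IsMultiLin Ψ) :
    IsMultiLin (insertDeriv a Ψ) where
  linear L L' c f g k h1 h2 h3 := by
    induction L generalizing Ψ with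
    | nil =>
      simp only [List.nil_append, Setup.insertDeriv]
      rw [h.head L' c (derivH a f) (derivH a g) (derivH a k) h1 h2 (by
          simp only [derivH, h3]
          exact derivAlong_lin a f.mem.1 g.mem.1 c),
        insertDeriv_lin a (fun L => Ψ (k :: L)) (fun L => Ψ (f :: L)) (fun L => Ψ (g :: L)) c
          fun L => h.head L c f g k h1 h2 h3]
      module
    | cons l L ih =>
      simp only [List.cons_append, Setup.insertDeriv]
      rw [ih (h.cons l), ← List.cons_append, ← List.cons_append, ← List.cons_append,
        h.linear (derivH a l :: L) L' c f g k h1 h2 h3]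
      module
  symm L L' f g := by
    induction L generalizing Ψ with
    | nil =>
      simp only [List.nil_append, Setup.insertDeriv]
      have hs := fun (f g : D.HFun) (L : List D.HFun) => h.symm [] L f g
      simp only [List.nil_append] at hs
      rw [hs (derivH a f), hs f (derivH a g),
        insertDeriv_smul a (fun L => Ψ (f :: g :: L)) (fun L => Ψ (g :: f :: L)) _
          fun L => hs f g L]
      simp only [derivH]
      module
    | cons l L ih =>
      simp only [List.cons_append, Setup.insertDeriv]
      rw [ih (h.cons l), ← List.cons_append, ← List.cons_append, h.symm (derivH a l :: L) L' f g]
      module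
  smooth L := by
    induction L generalizing Ψ with
    | nil => exact zero_mem _
    | cons f L ih => exact add_mem (h.smooth _) (ih (h.cons f))

/-- The Lie derivative along `(σ, φ)` of multi-brackets. -/
def lieDeriv (Ψ : List D.HFun → D.FunE) (L : List D.HFun) : D.FunE :=
  derivAlong a (Ψ L) - insertDeriv a Ψ L

theorem derivAlong_smul {f : D.FunE} (hf : f ∈ D.smE) (c : ℝ) :
    derivAlong a (c • f) = c • derivAlong a f := by
  have h0 : derivAlong a (0 : D.FunE) = 0 := derivAlong_fromA a zero_mem_fromA
  have := derivAlong_lin a hf (zero_mem _) c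
  rwa [add_zero, h0, add_zero] at this

theorem IsMultiLin.lieDeriv {Ψ : List D.HFun → D.FunE} (h : IsMultiLin Ψ) :
    IsMultiLin (lieDeriv a Ψ) where
  linear L L' c f g k h1 h2 h3 := by
    simp only [Setup.lieDeriv]
    rw [(h.insertDeriv a).linear L L' c f g k h1 h2 h3, h.linear L L' c f g k h1 h2 h3,
      derivAlong_lin a (h.smooth _) (h.smooth _)]
    module
  symm L L' f g := by
    simp only [Setup.lieDeriv]
    rw [(h.insertDeriv a).symm L L' f g, h.symm L L' f g, derivAlong_smul a (h.smooth _)]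
    module
  smooth L := sub_mem (derivAlong_mem_smE a (h.smooth L)) ((h.insertDeriv a).smooth L)

/-! ### The bracket with the vector field -/

/-- Only the unshuffle with empty first part survives, and its Koszul sign is 1 because the empty
list has weight 0. -/
theorem sum_splits_nil_left (F : List D.HFun → List D.HFun → D.FunE)
    (hF : ∀ T R, T ≠ [] → F T R = 0) (L : List D.HFun) :
    ((splits L).map fun t => t.1 • F t.2.1 t.2.2).sum = F [] L := by
  induction L generalizing F with
  | nil => simp [splits]
  | cons f L ih =>
    simp only [splits, List.map_append, List.map_map, List.sum_append, Function.comp_def]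
    have h1 : ((splits L).map fun t => t.1 • F (f :: t.2.1) t.2.2) =
        (splits L).map fun _ => (0 : D.FunE) :=
      List.map_congr_left fun t _ => by rw [hF _ _ (by simp), smul_zero]
    rw [h1, List.map_const', List.sum_replicate, smul_zero, zero_add]
    have h2 := ih (fun T R => (-1 : ℝ) ^ ((f.deg - 1) * wt T) • F T (f :: R))
      fun T R hT => by rw [hF _ _ hT, smul_zero]
    simp only [smul_smul] at h2
    simp only [mul_comm _ (Prod.fst _)]
    rw [h2]
    simp [wt]

theorem sum_splits_nil_right (F : List D.HFun → List D.HFun → D.FunE)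
    (hF : ∀ T R, R ≠ [] → F T R = 0) (L : List D.HFun) :
    ((splits L).map fun t => t.1 • F t.2.1 t.2.2).sum = F L [] := by
  induction L generalizing F with
  | nil => simp [splits]
  | cons f L ih =>
    simp only [splits, List.map_append, List.map_map, List.sum_append, Function.comp_def]
    have h1 : ((splits L).map fun t => ((-1 : ℝ) ^ ((f.deg - 1) * wt t.2.1) * t.1) •
        F t.2.1 (f :: t.2.2)) = (splits L).map fun _ => (0 : D.FunE) :=
      List.map_congr_left fun t _ => by rw [hF _ _ (by simp), smul_zero]
    rw [h1, List.map_const', List.sum_replicate, smul_zero, add_zero]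
    exact ih (fun T R => F (f :: T) R) fun T R hR => hF _ _ hR

/-- A vector field is nonzero only on one-element lists, so the unshuffles that contribute are those
selecting one entry: this is the sum over all slots. -/
theorem sum_splits_field {Ψ : List D.HFun → D.FunE} (h : IsMultiLin Ψ) (L : List D.HFun) :
    ((splits L).map fun t => t.1 • Ψ ((field a).app t.2.1 :: t.2.2)).sum =
      -insertDeriv a Ψ L := by
  have hzero : ∀ (Ψ : List D.HFun → D.FunE), IsMultiLin Ψ → ∀ (f : D.HFun) (L : List D.HFun),
      f.val = 0 → Ψ (f :: L) = 0 := by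
    intro Ψ h f L hf
    have := h.head L 1 f f f rfl rfl (by simp [hf])
    simpa using this
  induction L generalizing Ψ with
  | nil =>
    simp only [splits, List.map_cons, List.map_nil, List.sum_cons, List.sum_nil, add_zero,
      insertDeriv, one_smul, neg_zero]
    exact hzero Ψ h _ _ rfl
  | cons f L ih =>
    simp only [splits, List.map_append, List.map_map, List.sum_append, Function.comp_def,
      insertDeriv]
    have h1 := sum_splits_nil_left (fun T R => Ψ ((field a).app (f :: T) :: R))
      (fun T R hT => hzero Ψ h _ _ (fieldFun_eq_zero a (by
        have := List.length_pos_of_ne_nil hT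
        simp only [List.length_cons]; omega))) L
    -- The field has degree 0, so its value on T has the shifted degree of T. Hence the Koszul sign
    -- for moving f past T cancels the one for exchanging that value with f.
    have h2 : ∀ t : ℝ × List D.HFun × List D.HFun,
        ((-1 : ℝ) ^ ((f.deg - 1) * wt t.2.1) * t.1) • Ψ ((field a).app t.2.1 :: f :: t.2.2) =
          t.1 • Ψ (f :: (field a).app t.2.1 :: t.2.2) := by
      intro t
      have h3 := h.symm [] t.2.2 ((field a).app t.2.1) f
      simp only [List.nil_append] at h3
      rw [h3, smul_smul, show ((field a).app t.2.1).deg - 1 = wt t.2.1 by simp [Coch.app],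
        mul_comm (wt t.2.1), mul_right_comm, neg_one_zpow_mul_self, one_mul]
    simp only [h2]
    rw [h1, ih (h.cons f), neg_add]
    congr 1
    have h4 := h.head L (-1) (derivH a f) ⟨f.deg, 0, zero_mem _⟩ ((field a).app [f])
      (by simp [derivH, Coch.app, wt]) (by simp [Coch.app, wt])
      (by simp [derivH, Coch.app, field, fieldFun])
    rw [h4, hzero Ψ h ⟨f.deg, 0, zero_mem _⟩ L rfl]
    simp

/-- Both compositions acquire a minus sign from the field -D, and the sign in the commutator is
trivial in degree zero; so [Z, -D] = D ∘ Z minus the sum of insertions of D. This is why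
deformations correspond to -(σ, φ) rather than (σ, φ). -/
theorem bracket_field {d : ℤ} (Z : Coch D d) (hZ : IsMultiLin Z.toFun) (L : List D.HFun) :
    (bracket Z (field a)).toFun L = lieDeriv a Z.toFun L := by
  have h1 : comp Z (field a) L = -insertDeriv a Z.toFun L := sum_splits_field a hZ L
  have h2 : comp (field a) Z L = -derivAlong a (Z.toFun L) := by
    have := sum_splits_nil_right (fun T R => (field a).toFun (Z.app T :: R))
      (fun T R hR => fieldFun_eq_zero a (by
        have := List.length_pos_of_ne_nil hR
        simp only [List.length_cons]; omega)) L
    exact this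
  simp only [bracket, h1, h2, mul_zero, zpow_zero, one_smul, lieDeriv]
  abel

theorem iterBracket_field (k : ℕ) (Z : Σ d, Coch D d) (hZ : IsMultiLin Z.2.toFun) :
    (iterBracket Z (List.replicate k ⟨0, field a⟩)).2.toFun = (lieDeriv a)^[k] Z.2.toFun := by
  induction k generalizing Z with
  | zero => rfl
  | succ k ih =>
    have h1 : (bracket Z.2 (field a)).toFun = lieDeriv a Z.2.toFun :=
      funext (bracket_field a Z.2 hZ)
    have h2 : IsMultiLin (bracket Z.2 (field a)).toFun := h1 ▸ hZ.lieDeriv a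
    have h3 := ih ⟨Z.1 + 0, bracket Z.2 (field a)⟩ h2
    rw [Function.iterate_succ_apply, ← h1]
    exact h3

theorem derivedBracket_field {d : ℤ} (Z : Coch D d) (hZ : IsMultiLin Z.toFun) (k : ℕ)
    (hv : -ofSections a ∈ 𝔞 D 0) (L : List D.Lin) (s : S) :
    derivedBracket Z (List.replicate k ⟨0, -ofSections a, hv⟩) L s =
      D.pull s LinearMap.id 0 ((lieDeriv a)^[k] Z.toFun (L.map linFun) (⟨s, 0⟩ : D.M)) := by
  rw [derivedBracket, List.map_replicate, I_neg_ofSections, P, iterBracket_field a k ⟨d, Z⟩ hZ]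

end Field

end Setup

end

section

/-! ### Functions that are the sum of their Maclaurin series -/

theorem iteratedDeriv_eq_of_hasDerivAt {F : ℕ → ℝ → ℝ}
    (h : ∀ k t, HasDerivAt (F k) (F (k + 1) t) t) (k : ℕ) : iteratedDeriv k (F 0) = F k := by
  induction k with
  | zero => simp
  | succ k ih =>
    rw [iteratedDeriv_succ, ih]
    exact funext fun t => (h k t).deriv

/-- The Maclaurin series of a smooth function converges to its value at `1`. -/
def MaclaurinAtOne (g : ℝ → ℝ) : Prop :=
  ContDiff ℝ ∞ g ∧ HasSum (fun k : ℕ => ((k.factorial : ℝ)⁻¹) * iteratedDeriv k g 0) (g 1)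

namespace MaclaurinAtOne

theorem zero : MaclaurinAtOne fun _ => 0 := by
  refine ⟨contDiff_const, ?_⟩
  simp

theorem add {g g' : ℝ → ℝ} (h : MaclaurinAtOne g) (h' : MaclaurinAtOne g') :
    MaclaurinAtOne fun t => g t + g' t := by
  refine ⟨h.1.add h'.1, ?_⟩
  convert h.2.add h'.2 using 1
  funext k
  rw [← mul_add]
  congr 1
  exact iteratedDeriv_fun_add (h.1.contDiffAt.of_le (by exact_mod_cast le_top))
    (h'.1.contDiffAt.of_le (by exact_mod_cast le_top))

theorem neg {g : ℝ → ℝ} (h : MaclaurinAtOne g) : MaclaurinAtOne fun t => -g t := by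
  refine ⟨h.1.neg, ?_⟩
  have h1 : (fun k : ℕ => ((k.factorial : ℝ)⁻¹) * iteratedDeriv k (fun t => -g t) 0) =
      fun k : ℕ => -(((k.factorial : ℝ)⁻¹) * iteratedDeriv k g 0) := by
    funext k
    rw [iteratedDeriv_fun_neg]
    ring
  rw [h1]
  exact h.2.neg

theorem sum {ι : Type*} (A : Finset ι) {g : ι → ℝ → ℝ} (h : ∀ i ∈ A, MaclaurinAtOne (g i)) :
    MaclaurinAtOne fun t => ∑ i ∈ A, g i t := by
  induction A using Finset.cons_induction with
  | empty => simpa using zero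
  | cons i A hi ih =>
    simp only [Finset.sum_cons]
    exact (h i (by simp)).add (ih fun j hj => h j (by simp [hj]))

/-- Multiplication by t shifts the Maclaurin series by one place, so the sum at t = 1 is unchanged.
-/
theorem id_mul {g : ℝ → ℝ} (h : MaclaurinAtOne g) : MaclaurinAtOne fun t => t * g t := by
  have hd : ∀ k t, HasDerivAt (iteratedDeriv k g) (iteratedDeriv (k + 1) g t) t := fun k t => by
    rw [iteratedDeriv_succ]
    exact (h.1.differentiable_iteratedDeriv k (by exact_mod_cast WithTop.coe_lt_top k) t).hasDerivAt
  -- The Leibniz formula for t g(t). For k = 0 the truncated index k - 1 is harmless because of the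
  -- factor k.
  let F : ℕ → ℝ → ℝ := fun k t => t * iteratedDeriv k g t + k * iteratedDeriv (k - 1) g t
  have hF : ∀ k, iteratedDeriv k (fun t => t * g t) = F k := by
    have h0 : F 0 = fun t => t * g t := by simp [F]
    rw [← h0]
    refine iteratedDeriv_eq_of_hasDerivAt fun k t => ?_
    have h1 := (hasDerivAt_id t).mul (hd k t)
    have h2 : HasDerivAt (fun t => (k : ℝ) * iteratedDeriv (k - 1) g t)
        (k * iteratedDeriv k g t) t := by
      cases k with
      | zero => simpa using hasDerivAt_const t (0 : ℝ)
      | succ k => exact (hd k t).const_mul _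
    refine (h1.add h2).congr_deriv ?_
    simp [F]
    ring
  refine ⟨contDiff_id.mul h.1, ?_⟩
  -- At 0 the derivative of order k + 1 of t g(t) is (k + 1) times the k-th derivative of g, and the
  -- factor is absorbed by (k + 1)!.
  have h1 : (fun k : ℕ => (((k + 1).factorial : ℝ)⁻¹) * F (k + 1) 0) =
      fun k : ℕ => ((k.factorial : ℝ)⁻¹) * iteratedDeriv k g 0 := by
    funext k
    simp only [F, zero_mul, zero_add, Nat.add_sub_cancel, Nat.factorial_succ]
    push_cast
    have : (k.factorial : ℝ) ≠ 0 := by exact_mod_cast k.factorial_ne_zero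
    field_simp
  simp only [hF]
  refine (hasSum_nat_add_iff' 1).1 ?_
  have h2 : 1 * g 1 - ∑ i ∈ Finset.range 1, ((i.factorial : ℝ)⁻¹) * F i 0 = g 1 := by simp [F]
  rw [h2]
  exact h1 ▸ h.2

theorem pow_mul {g : ℝ → ℝ} (h : MaclaurinAtOne g) (j : ℕ) :
    MaclaurinAtOne fun t => t ^ j * g t := by
  induction j with
  | zero => simpa using h
  | succ j ih =>
    have := ih.id_mul
    simpa only [pow_succ', mul_assoc] using this

end MaclaurinAtOne

theorem HasWDeriv.id_smul {R : Type*} [AddCommGroup R] [Module ℝ R] {γ : ℝ → R} {w : R} {t : ℝ}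
    (h : HasWDeriv γ w t) : HasWDeriv (fun t => t • γ t) (γ t + t • w) t := fun c => by
  have := (hasDerivAt_id t).fun_mul (h c)
  simpa using this

variable {n : ℕ} {S : Type u} [TopologicalSpace S] [ChartedSpace (EuclideanSpace ℝ (Fin n)) S]

namespace Setup

variable {D : Setup.{u, v} n S} [T2Space S] [IsManifold (𝓡 n) ∞ S]

/-! ### Taylor expansion of Q along the graphs of tφ over tσ. -/

section Taylor

variable (a : Sec D.N × HomSec D.A D.B)

/-- The pull-back to the graph of `t φ` over `t σ`. -/
def pullAt (s : S) (t : ℝ) (f : D.FunE) : D.FibA s :=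
  D.pull s LinearMap.id (t • a.2.toFun s) (f (⟨s, t • a.1.toFun s⟩ : D.M))

theorem pullAt_zero (s : S) (f : D.FunE) :
    pullAt a s 0 f = D.pull s LinearMap.id 0 (f (⟨s, 0⟩ : D.M)) := by
  have h : ∀ y : D.N.V s, y = 0 → D.pull s LinearMap.id 0 (f (⟨s, y⟩ : D.M)) =
      D.pull s LinearMap.id 0 (f (⟨s, 0⟩ : D.M)) := by
    rintro _ rfl
    rfl
  rw [pullAt, zero_smul]
  exact h _ (zero_smul _ _)

theorem pullAt_one (s : S) (f : D.FunE) :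
    pullAt a s 1 f = D.pull s LinearMap.id (a.2.toFun s) (f (⟨s, a.1.toFun s⟩ : D.M)) := by
  have h : ∀ y : D.N.V s, y = a.1.toFun s → D.pull s LinearMap.id (a.2.toFun s)
      (f (⟨s, y⟩ : D.M)) = D.pull s LinearMap.id (a.2.toFun s) (f (⟨s, a.1.toFun s⟩ : D.M)) := by
    rintro _ rfl
    rfl
  rw [pullAt, one_smul]
  exact h _ (one_smul _ _)

theorem pullAt_add (s : S) (t : ℝ) (f g : D.FunE) :
    pullAt a s t (f + g) = pullAt a s t f + pullAt a s t g := map_add _ _ _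

theorem pullAt_sub (s : S) (t : ℝ) (f g : D.FunE) :
    pullAt a s t (f - g) = pullAt a s t f - pullAt a s t g := map_sub _ _ _

theorem pullAt_smul (s : S) (t c : ℝ) (f : D.FunE) :
    pullAt a s t (c • f) = c • pullAt a s t f :=
  map_smul (D.pull s LinearMap.id (t • a.2.toFun s)) c _

/-- The translate of a function by `-t (σ, φ)`, to first order. -/
def shiftH (t : ℝ) (f : D.HFun) : D.HFun :=
  ⟨f.deg, f.val - t • derivAlong a f.val,
    sub_mem f.mem (Submodule.smul_mem _ _ (derivAlong_mem a f.mem))⟩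

theorem shiftH_zero (f : D.HFun) : shiftH a 0 f = f := HFun.ext' rfl (by simp [shiftH])

theorem shiftH_one_linFun (l : D.Lin) : shiftH a 1 (linFun l) = shiftFun a l :=
  HFun.ext' rfl (by simp [shiftH, linFun, shiftFun, derivAlong_linVal])

theorem IsMultiLin.shiftH_cons {Ψ : List D.HFun → D.FunE} (h : IsMultiLin Ψ) (t : ℝ) (f : D.HFun)
    (L : List D.HFun) : Ψ (shiftH a t f :: L) = Ψ (f :: L) - t • Ψ (derivH a f :: L) := by
  rw [h.head L (-t) (derivH a f) f (shiftH a t f) rfl rfl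
    (by simp only [shiftH, derivH]; module)]
  module

theorem derivAlong_sub_smul {f g : D.FunE} (hf : f ∈ D.smE) (hg : g ∈ D.smE) (t : ℝ) :
    derivAlong a (f - t • g) = derivAlong a f - t • derivAlong a g := by
  have h := derivAlong_lin a hg hf (-t)
  rw [show f - t • g = (-t) • g + f by module, h]
  module

/-- The moving graph contributes D of the value, and each moving argument f - tDf contributes -Df in
its slot: together the Lie derivative. The condition D²f = 0 gives D(f - tDf) = Df, so the inserted
functions do not depend on t. -/
theorem hasWDeriv_pullAt {Ψ : List D.HFun → D.FunE} (h : IsMultiLin Ψ) (L : List D.HFun)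
    (hL : ∀ f ∈ L, derivAlong a (derivAlong a f.val) = 0) (s : S) (t : ℝ) :
    HasWDeriv (fun t => pullAt a s t (Ψ (L.map (shiftH a t))))
      (pullAt a s t (lieDeriv a Ψ (L.map (shiftH a t)))) t := by
  induction L generalizing Ψ with
  | nil =>
    simp only [List.map_nil, lieDeriv, insertDeriv, sub_zero]
    exact hasWDeriv_pull a (h.smooth []) s t
  | cons f L ih =>
    have h1 := ih (h.cons f) fun g hg => hL g (List.mem_cons_of_mem _ hg)
    have h2 := ih (h.cons (derivH a f)) fun g hg => hL g (List.mem_cons_of_mem _ hg)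
    have h3 := h1.add (h2.id_smul.smul (-1))
    have h4 : derivH a (shiftH a t f) = derivH a f := HFun.ext' rfl (by
      simp only [derivH, shiftH]
      rw [derivAlong_sub_smul a f.mem.1 (derivAlong_mem_smE a f.mem.1), hL f (by simp), smul_zero,
        sub_zero])
    have h5 := insertDeriv_lin a (fun L => Ψ (shiftH a t f :: L))
      (fun L => Ψ (derivH a f :: L)) (fun L => Ψ (f :: L)) (-t)
      (fun L => by rw [h.shiftH_cons a t f L]; module) (L.map (shiftH a t))
    convert h3 using 1
    · funext r
      rw [List.map_cons, h.shiftH_cons a r f, pullAt_sub, pullAt_smul]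
      module
    · rw [List.map_cons]
      simp only [lieDeriv, insertDeriv]
      rw [h4, h5, h.shiftH_cons a t f, derivAlong_sub_smul a (h.smooth _) (h.smooth _)]
      simp only [pullAt_sub, pullAt_add, pullAt_smul]
      module

theorem IsMultiLin.iterate_lieDeriv {Ψ : List D.HFun → D.FunE} (h : IsMultiLin Ψ) (k : ℕ) :
    IsMultiLin ((Setup.lieDeriv a)^[k] Ψ) := by
  induction k with
  | zero => exact h
  | succ k ih =>
    rw [Function.iterate_succ_apply']
    exact ih.lieDeriv a

/-- The Taylor coefficients of the pull-back to the graph of `t φ` over `t σ`. -/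
theorem hasDerivAt_pullAt {Ψ : List D.HFun → D.FunE} (h : IsMultiLin Ψ) (L : List D.HFun)
    (hL : ∀ f ∈ L, derivAlong a (derivAlong a f.val) = 0) (s : S)
    (c : Module.Dual ℝ (D.FibA s)) (k : ℕ) (t : ℝ) :
    HasDerivAt (fun t => c (pullAt a s t ((lieDeriv a)^[k] Ψ (L.map (shiftH a t)))))
      (c (pullAt a s t ((lieDeriv a)^[k + 1] Ψ (L.map (shiftH a t))))) t := by
  rw [Function.iterate_succ_apply']
  exact hasWDeriv_pullAt a (h.iterate_lieDeriv a k) L hL s t c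

/-! ### Convergence -/

/-- Multi-brackets that are analytic along the fibres of `p^! N`. -/
structure IsAnalyticMulti (Ψ : List D.HFun → D.FunE) : Prop where
  multiLin : IsMultiLin Ψ
  analytic : ∀ L : List D.HFun, (∀ f ∈ L, f.val ∈ polyAlong D) →
    IsAnalyticAlong fun x => D.toK₀ x.proj (Ψ L x)
  -- The values of Q have two homogeneous parts, from Q₊ and Q₋. Bounds independent of x limit the
  -- powers of t coming from φ.
  bounded : ∀ L : List D.HFun, ∃ m m' : ℤ, ∀ x, ∃ u ∈ GSym.homog D.deg _ m,
    ∃ w ∈ GSym.homog D.deg _ m', Ψ L x = u + w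

theorem IsAnalyticMulti.cons {Ψ : List D.HFun → D.FunE} (h : IsAnalyticMulti Ψ) {f : D.HFun}
    (hf : f.val ∈ polyAlong D) : IsAnalyticMulti fun L => Ψ (f :: L) where
  multiLin := h.multiLin.cons f
  analytic L hL := h.analytic (f :: L) (by
    intro g hg
    rcases List.mem_cons.1 hg with rfl | hg
    · exact hf
    · exact hL g hg)
  bounded _ := h.bounded _

theorem BlendedQ.IsAnalytic.isAnalyticMulti {Q : BlendedQ D} (hQ : Q.IsAnalytic) :
    IsAnalyticMulti Q.eval where
  multiLin := Q.isMultiDer.isMultiLin fun L => add_mem (Q.pos.mem L).1 (Q.neg.mem L).1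
  analytic := hQ
  bounded L := ⟨_, _, fun x => ⟨_, (Q.pos.mem L).2 x, _, (Q.neg.mem L).2 x, rfl⟩⟩

/-- Expanding the restriction in powers of t coming from φ gives finitely many terms t^j g_j(t), in
which g_j depends on t only through the base point tσ. Analyticity applies to each g_j, and the
powers of t preserve the property. -/
theorem maclaurin_pullAt {f : D.FunE} (hf : f ∈ D.smE)
    (ha : IsAnalyticAlong fun x => D.toK₀ x.proj (f x))
    (hb : ∃ m m' : ℤ, ∀ x, ∃ u ∈ GSym.homog D.deg _ m, ∃ w ∈ GSym.homog D.deg _ m', f x = u + w)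
    (s : S) (c : Module.Dual ℝ (D.FibA s)) : MaclaurinAtOne fun t => c (pullAt a s t f) := by
  obtain ⟨m, m', hb⟩ := hb
  let φ := a.2.toFun s
  let M := max m.toNat m'.toNat
  have hdeg : ∀ y : D.N.V s, (D.pullPoly s φ (D.toK₀ s (f (⟨s, y⟩ : D.M)))).natDegree ≤ M := by
    intro y
    obtain ⟨u, hu, w, hw, h⟩ := hb (⟨s, y⟩ : D.M)
    rw [h, map_add, map_add]
    exact (Polynomial.natDegree_add_le _ _).trans (max_le_max
      (pullPoly_natDegree φ (toK₀_homog hu)) (pullPoly_natDegree φ (toK₀_homog hw)))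
  -- Extracting the coefficient of t^j is linear, so `cj j` is a functional on the fibre algebra of
  -- E, as the definition of analyticity requires.
  let cj : ℕ → Module.Dual ℝ (D.FibE s) := fun j =>
    (c.comp ((Polynomial.lcoeff (D.FibA s) j).restrictScalars ℝ)).comp
      (D.pullPoly s φ).toLinearMap
  have hsum : ∀ t : ℝ, c (pullAt a s t f) = ∑ j ∈ Finset.range (M + 1),
      t ^ j * cj j (D.toK₀ s (f (⟨s, t • a.1.toFun s⟩ : D.M))) := by
    intro t
    rw [pullAt, ← pull_toK₀, pull_eq_sum,
      Polynomial.sum_over_range' _ (fun j => smul_zero _) (M + 1) (Nat.lt_succ_of_le (hdeg _)),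
      map_sum]
    refine Finset.sum_congr rfl fun j _ => ?_
    rw [map_smul, smul_eq_mul]
    rfl
  simp only [hsum]
  refine MaclaurinAtOne.sum _ fun j _ => MaclaurinAtOne.pow_mul ⟨?_, ?_⟩ j
  · have := contDiff_smooth_line (toK₀_mem_smE hf) (0 : D.N.V s) (a.1.toFun s) (cj j)
    have h1 : ∀ y z : D.N.V s, y = z → cj j (D.toK₀ s (f (⟨s, y⟩ : D.M))) =
        cj j (D.toK₀ s (f (⟨s, z⟩ : D.M))) := by
      rintro _ _ rfl
      rfl
    exact (funext fun t : ℝ => h1 _ _ (zero_add (t • a.1.toFun s))) ▸ this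
  · have := ha s (a.1.toFun s) (cj j)
    have h1 : ∀ y : D.N.V s, y = a.1.toFun s → cj j (D.toK₀ s (f (⟨s, y⟩ : D.M))) =
        cj j (D.toK₀ s (f (⟨s, a.1.toFun s⟩ : D.M))) := by
      rintro _ rfl
      rfl
    rw [h1 _ (one_smul _ _)]
    exact this

/-- Multilinearity expands the arguments f - tDf into f and -tDf. Both f and Df are polynomial along
the fibres, and the extra factors t are handled by `MaclaurinAtOne.id_mul`. -/
theorem IsAnalyticMulti.maclaurin {Ψ : List D.HFun → D.FunE} (h : IsAnalyticMulti Ψ)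
    (L : List D.HFun)
    (hL : ∀ f ∈ L, f.val ∈ polyAlong D ∧ derivAlong a f.val ∈ polyAlong D)
    (s : S) (c : Module.Dual ℝ (D.FibA s)) :
    MaclaurinAtOne fun t => c (pullAt a s t (Ψ (L.map (shiftH a t)))) := by
  induction L generalizing Ψ with
  | nil =>
    exact maclaurin_pullAt a (h.multiLin.smooth []) (h.analytic [] (by simp)) (h.bounded []) s c
  | cons f L ih =>
    have hL' := fun g hg => hL g (List.mem_cons_of_mem f hg)
    have h1 := ih (h.cons (hL f (by simp)).1) hL'
    have h2 := ih (h.cons (f := derivH a f) (hL f (by simp)).2) hL'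
    convert h1.add h2.id_mul.neg using 2 with t
    rw [List.map_cons, h.multiLin.shiftH_cons a t f, pullAt_sub, pullAt_smul, map_sub, map_smul,
      smul_eq_mul, sub_eq_add_neg]

theorem linVal_mem_polyAlong (l : D.Lin) : linVal l ∈ polyAlong D :=
  Algebra.subset_adjoin (Or.inr ⟨l, rfl⟩)

/-- The Maurer-Cartan series of `-(σ, φ)` converges to the restriction to the graph of the values
of `Q` on the linear coordinates relative to the graph. -/
theorem hasSum_structureMap {Q : BlendedQ D} (hQ : Q.IsAnalytic) (hv : -ofSections a ∈ 𝔞 D 0)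
    (L : List D.Lin) (s : S) (c : Module.Dual ℝ (D.FibA s)) :
    HasSum (fun k : ℕ => ((k.factorial : ℝ)⁻¹) *
      c (structureMap Q (List.replicate k ⟨0, -ofSections a, hv⟩) L s))
      (c (D.pull s LinearMap.id (a.2.toFun s)
        (Q.eval (L.map (shiftFun a)) (⟨s, a.1.toFun s⟩ : D.M)))) := by
  have hpos : IsMultiLin Q.pos.toFun := Q.pos_field.isMultiDer.isMultiLin Q.pos.smooth
  have hneg : IsMultiLin Q.neg.toFun := Q.neg_field.isMultiDer.isMultiLin Q.neg.smooth
  -- One application of D sends a linear coordinate to a function pulled back from A, which D kills.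
  have hL : ∀ f ∈ L.map linFun, derivAlong a (derivAlong a f.val) = 0 := by
    intro f hf
    obtain ⟨l, -, rfl⟩ := List.mem_map.1 hf
    rw [show (linFun l).val = linVal l from rfl, derivAlong_linVal,
      derivAlong_fromA a (graphVal_mem_fromA a l)]
  -- Q₊ and Q₋ are iterated separately, as their derived brackets are defined by degree; analyticity
  -- is available only for their sum, which is `F 0`.
  let F : ℕ → ℝ → ℝ := fun k t =>
    c (pullAt a s t ((lieDeriv a)^[k] Q.pos.toFun ((L.map linFun).map (shiftH a t)))) +
    c (pullAt a s t ((lieDeriv a)^[k] Q.neg.toFun ((L.map linFun).map (shiftH a t))))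
  have hF : ∀ k, iteratedDeriv k (F 0) = F k := iteratedDeriv_eq_of_hasDerivAt fun k t =>
    (hasDerivAt_pullAt a hpos _ hL s c k t).fun_add (hasDerivAt_pullAt a hneg _ hL s c k t)
  have hF0 : F 0 = fun t => c (pullAt a s t (Q.eval ((L.map linFun).map (shiftH a t)))) := by
    funext t
    simp only [F, Function.iterate_zero, id, BlendedQ.eval, pullAt_add, map_add]
  have hm := hQ.isAnalyticMulti.maclaurin a (L.map linFun) (by
    intro f hf
    obtain ⟨l, -, rfl⟩ := List.mem_map.1 hf
    refine ⟨linVal_mem_polyAlong l, ?_⟩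
    rw [show (linFun l).val = linVal l from rfl, derivAlong_linVal]
    exact Algebra.subset_adjoin (Or.inl (graphVal_mem_fromA a l))) s c
  have hsum := hm.2
  rw [← hF0] at hsum
  simp only [hF] at hsum
  convert hsum using 1
  -- At t = 0 the arguments are unshifted and the restriction is the one in P, which gives the
  -- structure maps; at t = 1 the arguments are the linear coordinates relative to the graph.
  · funext k
    congr 1
    simp only [F, structureMap, Pi.add_apply, map_add, derivedBracket_field a _ hpos,
      derivedBracket_field a _ hneg, pullAt_zero]
    rw [List.map_congr_left (fun f _ => shiftH_zero a f), List.map_id']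
  · rw [hF0]
    simp only [pullAt_one, List.map_map]
    rw [List.map_congr_left fun l _ => (shiftH_one_linFun a l).symm]
    rfl

/-- The series always converges, so by uniqueness of sums its vanishing is the vanishing of all
functionals on the restriction of Q to the graph; algebraic functionals separate points. -/
theorem mem_maurerCartan_iff {Q : BlendedQ D} (hQ : Q.IsAnalytic)
    (hv : -ofSections a ∈ abar D 0) : -ofSections a ∈ maurerCartan Q ↔ a ∈ deformations Q := by
  rw [mem_deformations_iff]
  constructor
  · rintro ⟨hv', h⟩ L s
    rw [← Module.forall_dual_apply_eq_zero_iff ℝ]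
    intro c
    exact (hasSum_structureMap a hQ (abar_le 0 hv') L s c).unique (h L s c)
  · intro h
    refine ⟨hv, fun L s c => ?_⟩
    have := hasSum_structureMap a hQ (abar_le 0 hv) L s c
    rwa [h L s, map_zero] at this

end Taylor

end Setup

end

section

variable {n : ℕ} {S : Type u} [TopologicalSpace S] [ChartedSpace (EuclideanSpace ℝ (Fin n)) S]

/-! ### Tensoriality -/

section Tensorial

variable {E : VB.{u, v} n S} {W : Type*} [AddCommGroup W] [Module ℝ W]

/-- Maps from fibrewise linear functions to a vector space that are linear over the smooth
functions, evaluated at `s₀`. -/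
def IsTensorialAt (s₀ : S) (T : DualSec E → W) : Prop :=
  ∀ (h : S → ℝ) (f g e : DualSec E), ContMDiff (𝓡 n) 𝓘(ℝ) ∞ h →
    (∀ s, e.toFun s = h s • f.toFun s + g.toFun s) → T e = h s₀ • T f + T g

namespace IsTensorialAt

variable {s₀ : S} {T : DualSec E → W}

theorem map_zero (hT : IsTensorialAt s₀ T) {f : DualSec E} (hf : ∀ s, f.toFun s = 0) : T f = 0 := by
  have := hT (fun _ => 1) f f f contMDiff_const (fun s => by simp [hf])
  simpa using this

theorem exists_sum (hT : IsTensorialAt s₀ T) {ι : Type*} (A : Finset ι) (g : ι → S → ℝ)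
    (hg : ∀ i, ContMDiff (𝓡 n) 𝓘(ℝ) ∞ (g i)) (e : ι → DualSec E) :
    ∃ F : DualSec E, (∀ s, F.toFun s = ∑ i ∈ A, g i s • (e i).toFun s) ∧
      T F = ∑ i ∈ A, g i s₀ • T (e i) := by
  induction A using Finset.cons_induction with
  | empty => exact ⟨0, fun s => rfl, hT.map_zero fun s => rfl⟩
  | cons i A hi ih =>
    obtain ⟨F, hF, hF'⟩ := ih
    refine ⟨DualSec.mulFun (g i) (hg i) (e i) + F, fun s => ?_, ?_⟩
    · rw [Finset.sum_cons, ← hF]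
      rfl
    · rw [hT (g i) (e i) F _ (hg i) fun s => rfl, hF', Finset.sum_cons]

theorem map_comb (hT : IsTensorialAt s₀ T) (c : ℝ) (f g : DualSec E) :
    T (DualSec.mulFun (fun _ => c) contMDiff_const f + g) = c • T f + T g :=
  hT (fun _ => c) f g _ contMDiff_const fun _ => rfl

variable [T2Space S] [IsManifold (𝓡 n) ∞ S]

theorem map_zero_of_eventually (hT : IsTensorialAt s₀ T) {f : DualSec E}
    (hf : ∀ᶠ s in 𝓝 s₀, f.toFun s = 0) : T f = 0 := by
  obtain ⟨χ, hχ, h1, hs⟩ := exists_smooth_bump (𝓡 n) hf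
  have h2 := hT χ f 0 (DualSec.mulFun χ hχ f) hχ fun s => (add_zero _).symm
  have h0 : T 0 = 0 := hT.map_zero fun _ => rfl
  rw [h1.self_of_nhds, h0, hT.map_zero fun s => ?_] at h2
  · simpa using h2.symm
  · by_cases h : s ∈ tsupport χ
    · have : f.toFun s = 0 := hs h
      simp [DualSec.mulFun, this]
    · simp [DualSec.mulFun, image_eq_zero_of_notMem_tsupport h]

/-- Near s₀, f is the sum of f(τ_i) e_i for global e_i, τ_i that form dual frames there. The
coefficients are smooth and vanish at s₀, and the behaviour of f away from s₀ does not matter. -/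
theorem map_eq_zero (hT : IsTensorialAt s₀ T) {f : DualSec E} (hf : f.toFun s₀ = 0) : T f = 0 := by
  let b := Module.finBasis ℝ E.F
  choose e he using fun i => exists_dualSec_eq (E := E) s₀ (b.coord i)
  choose τ hτ using fun i => exists_sec_eq (E := E) s₀ (b i)
  obtain ⟨F, hF, hF'⟩ := hT.exists_sum Finset.univ (fun i s => f.toFun s ((τ i).toFun s))
    (fun i => f.smooth.comp (τ i).smooth) e
  have h1 : T F = 0 := by
    rw [hF']
    exact Finset.sum_eq_zero fun i _ => by rw [hf]; simp
  have h2 := hT.map_comb (-1) F f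
  rw [h1, hT.map_zero_of_eventually ?_, smul_zero, zero_add] at h2
  · exact h2.symm
  · filter_upwards [Filter.eventually_all.2 he, Filter.eventually_all.2 hτ, E.triv_mem_nhds s₀]
      with s h3 h4 h5
    refine LinearMap.ext fun y => ?_
    change (-1 : ℝ) * F.toFun s y + f.toFun s y = 0
    rw [neg_one_mul, neg_add_eq_zero, hF, eq_comm]
    have h6 : y = ∑ i, b.coord i (E.fib s₀ s y) • (τ i).toFun s := by
      refine (E.fibEquiv h5).injective ?_
      rw [map_sum]
      simp only [map_smul, E.fibEquiv_apply, h4]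
      exact (b.sum_repr _).symm
    conv_lhs => rw [h6, map_sum]
    simp only [LinearMap.sum_apply]
    refine Finset.sum_congr rfl fun i _ => ?_
    rw [h3 i]
    simp [mul_comm]

/-- A tensorial map is induced by a linear map on the dual of the fibre. -/
theorem exists_linearMap (hT : IsTensorialAt s₀ T) :
    ∃ θ : Module.Dual ℝ (E.V s₀) →ₗ[ℝ] W, ∀ f, T f = θ (f.toFun s₀) := by
  have hcongr : ∀ f g : DualSec E, f.toFun s₀ = g.toFun s₀ → T f = T g := by
    intro f g h
    have h1 := hT.map_comb (-1) f g
    rw [hT.map_eq_zero] at h1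
    · rw [neg_one_smul, neg_add_eq_sub, eq_comm, sub_eq_zero] at h1
      exact h1.symm
    · refine LinearMap.ext fun y => ?_
      change (-1 : ℝ) * f.toFun s₀ y + g.toFun s₀ y = 0
      rw [h, neg_one_mul, neg_add_cancel]
  -- The chosen extension `F` need not be linear; its composition with T is, because T depends only
  -- on the value at s₀.
  choose F hF using fun l => exists_dualSec_through (E := E) s₀ l
  have hlin : ∀ (c : ℝ) l l', T (F (c • l + l')) = c • T (F l) + T (F l') := by
    intro c l l'
    rw [← hT.map_comb]
    refine hcongr _ _ ?_
    rw [hF]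
    change _ = c • (F l).toFun s₀ + (F l').toFun s₀
    rw [hF, hF]
  have h0 : T (F 0) = 0 := hT.map_eq_zero (hF 0)
  refine ⟨⟨⟨fun l => T (F l), fun l l' => ?_⟩, fun c l => ?_⟩, fun f => hcongr _ _ (hF _).symm⟩
  · simpa using hlin 1 l l'
  · simpa [h0] using hlin c l 0

end IsTensorialAt

theorem exists_linear_lift {V₁ V₂ V₃ : Type*} [AddCommGroup V₁] [Module ℝ V₁] [AddCommGroup V₂]
    [Module ℝ V₂] [AddCommGroup V₃] [Module ℝ V₃] (G : V₂ →ₗ[ℝ] V₃) (hG : Function.Injective G)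
    (θ : V₁ →ₗ[ℝ] V₃) (h : ∀ x, ∃ y, θ x = G y) : ∃ Ξ : V₁ →ₗ[ℝ] V₂, ∀ x, θ x = G (Ξ x) := by
  have hr : ∀ x, θ x ∈ LinearMap.range G := fun x => by
    obtain ⟨y, hy⟩ := h x
    exact ⟨y, hy.symm⟩
  refine ⟨(LinearEquiv.ofInjective G hG).symm.toLinearMap.comp (θ.codRestrict _ hr), fun x => ?_⟩
  have := (LinearEquiv.ofInjective G hG).apply_symm_apply (θ.codRestrict _ hr x)
  exact (congrArg Subtype.val this).symm

end Tensorial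

/-! ### Elements of degree zero and multiplicity one are pairs of sections. -/

namespace Setup

variable {D : Setup.{u, v} n S}

section OfSections

variable (a : Sec D.N × HomSec D.A D.B)

theorem ofSections_eq_zero {L : List D.Lin} (hL : L.length ≠ 1) : ofSections a L = 0 := by
  match L with
  | [] => rfl
  | [_] => simp at hL
  | .inl _ :: _ :: _ => rfl
  | .inr _ :: _ :: _ => rfl

theorem ofSections_mem : ofSections a ∈ 𝔞' D 0 := by
  refine ⟨⟨fun L => ?_, fun L h f g e _ he s => ?_, fun L h f g e _ he s => ?_,
    fun L L' f g => ?_, 1, fun L hL => ofSections_eq_zero a (by omega)⟩,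
    fun L hL => ofSections_eq_zero a hL⟩
  · match L with
    | [] => exact zero_mem _
    | [.inl f] =>
      have h : (0 : ℤ) + 1 + (([.inl f] : List D.Lin).map fun f => linDeg f - 1).sum = 0 := by
        simp [linDeg]
      rw [h]
      exact ⟨IsSmoothFam.algebraMap (f.contMDiff_apply a.1),
        fun _ => GSym.algebraMap_mem_homog _⟩
    | [.inr f] =>
      have h : (0 : ℤ) + 1 + (([.inr f] : List D.Lin).map fun f => linDeg f - 1).sum = D.j₀ := by
        simp [linDeg]
      rw [h]
      exact ⟨IsSmoothFam.gen (E := fun _ : Unit => D.A) () (f.comp a.2),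
        fun _ => GSym.gen_mem_homog (deg := fun _ : Unit => D.j₀) () _⟩
    | _ :: _ :: _ =>
      rw [ofSections_eq_zero a (by simp)]
      exact zero_mem _
  · match L with
    | [] =>
      change algebraMap ℝ _ (e.toFun s _) = h s • algebraMap ℝ _ (f.toFun s _) +
        algebraMap ℝ _ (g.toFun s _)
      rw [he s, LinearMap.add_apply, LinearMap.smul_apply, map_add, smul_eq_mul, map_mul,
        Algebra.smul_def]
    | k :: L =>
      rw [ofSections_eq_zero, ofSections_eq_zero, ofSections_eq_zero] <;> simp
  · match L with
    | [] =>
      change D.genV _ ((e.toFun s).comp _) = h s • D.genV _ ((f.toFun s).comp _) +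
        D.genV _ ((g.toFun s).comp _)
      rw [he s, LinearMap.add_comp, LinearMap.smul_comp, map_add, map_smul]
    | k :: L =>
      rw [ofSections_eq_zero, ofSections_eq_zero, ofSections_eq_zero] <;> simp
  · rw [ofSections_eq_zero, ofSections_eq_zero]
    · simp
    · simp only [List.length_append, List.length_cons]; omega
    · simp only [List.length_append, List.length_cons]; omega

theorem abar_zero : abar D 0 = 𝔞' D 0 := if_pos rfl

theorem neg_ofSections_mem : -ofSections a ∈ abar D 0 := by
  rw [abar_zero]
  exact neg_mem (ofSections_mem a)

/-- The first order jet at the zero section of a function on `A`. -/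
def jetA (x : D.A.Tot) : D.FibA x.proj →ₐ[ℝ] DualNumber ℝ :=
  GSym.jet fun _ => Module.Dual.eval ℝ (D.A.V x.proj) x.2

theorem jetA_gen (x : D.A.Tot) (ξ : Module.Dual ℝ (D.A.V x.proj)) :
    jetA x (D.genV _ ξ) = TrivSqZeroExt.inr (ξ x.2) := GSym.jet_gen _ _ _

theorem jetA_algebraMap (x : D.A.Tot) (r : ℝ) :
    jetA x (algebraMap ℝ _ r) = TrivSqZeroExt.inl r := AlgHom.commutes _ _

/-- Turns smoothness of families in the fibre algebras, which is defined by local polynomials, into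
smoothness of ordinary functions. Both components are treated at once because the second component
of a product involves the first. -/
theorem contMDiff_jetA {g : D.FunA} (hg : IsSmoothFam (fun _ : Unit => D.j₀)
    (fun _ : Unit => D.A) (𝓡 n) (fun s : S => s) g) :
    ContMDiff ((𝓡 n).prod 𝓘(ℝ, D.A.F)) 𝓘(ℝ) ∞ (fun x : D.A.Tot => (jetA x (g x.proj)).fst) ∧
    ContMDiff ((𝓡 n).prod 𝓘(ℝ, D.A.F)) 𝓘(ℝ) ∞ (fun x : D.A.Tot => (jetA x (g x.proj)).snd) := by
  have key : ∀ g : D.FunA, g ∈ Algebra.adjoin ℝ (basicFun (fun _ : Unit => D.j₀)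
      (fun _ : Unit => D.A) (𝓡 n) (fun s : S => s)) →
      ContMDiff ((𝓡 n).prod 𝓘(ℝ, D.A.F)) 𝓘(ℝ) ∞ (fun x : D.A.Tot => (jetA x (g x.proj)).fst) ∧
      ContMDiff ((𝓡 n).prod 𝓘(ℝ, D.A.F)) 𝓘(ℝ) ∞
        (fun x : D.A.Tot => (jetA x (g x.proj)).snd) := by
    intro g hg
    induction hg using Algebra.adjoin_induction with
    | mem b hb =>
      rcases hb with ⟨h, hh, rfl⟩ | ⟨i, α, rfl⟩
      · simp only [jetA_algebraMap, TrivSqZeroExt.fst_inl, TrivSqZeroExt.snd_inl]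
        exact ⟨hh.comp D.A.contMDiff_totProj, contMDiff_const⟩
      · have h : ∀ x : D.A.Tot, jetA x (D.genV _ (α.toFun x.proj)) =
            TrivSqZeroExt.inr (α.toFun x.proj x.2) := fun x => jetA_gen x _
        refine ⟨?_, ?_⟩
        · refine (contMDiff_const (c := (0 : ℝ))).congr fun x => ?_
          exact congrArg TrivSqZeroExt.fst (h x)
        · exact α.smooth.congr fun x => congrArg TrivSqZeroExt.snd (h x)
    | algebraMap r =>
      simp only [Pi.algebraMap_apply, jetA_algebraMap, TrivSqZeroExt.fst_inl,
        TrivSqZeroExt.snd_inl]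
      exact ⟨contMDiff_const, contMDiff_const⟩
    | add g g' _ _ h h' =>
      simp only [Pi.add_apply, map_add, TrivSqZeroExt.fst_add, TrivSqZeroExt.snd_add]
      exact ⟨h.1.add h'.1, h.2.add h'.2⟩
    | mul g g' _ _ h h' =>
      simp only [Pi.mul_apply, map_mul, TrivSqZeroExt.fst_mul, TrivSqZeroExt.snd_mul,
        smul_eq_mul, MulOpposite.smul_eq_mul_unop, MulOpposite.unop_op]
      exact ⟨h.1.mul h'.1, (h.1.mul h'.2).add (h.2.mul h'.1)⟩
  refine ⟨fun x => ?_, fun x => ?_⟩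
  all_goals
    obtain ⟨g', hg', h⟩ := hg x.proj
    have hx := (D.A.continuous_totProj.tendsto x).eventually h
  · refine ((key g' hg').1 x).congr_of_eventuallyEq ?_
    filter_upwards [hx] with y hy
    rw [hy]
  · refine ((key g' hg').2 x).congr_of_eventuallyEq ?_
    filter_upwards [hx] with y hy
    rw [hy]

variable [T2Space S] [IsManifold (𝓡 n) ∞ S]

/-- In degree zero the values are scalars, so at each point T is a functional on the dual fibre,
that is, evaluation at a vector. Smoothness is tested on fibrewise linear functions. -/
theorem exists_sec_of_tensorial {T : DualSec D.N → D.FunA}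
    (hT : ∀ s, IsTensorialAt s fun f => T f s) (hT' : ∀ f, T f ∈ D.smoothA 0) :
    ∃ σ : Sec D.N, ∀ f s, T f s = algebraMap ℝ _ (f.toFun s (σ.toFun s)) := by
  have h1 : ∀ s, ∃ y : D.N.V s, ∀ f, T f s = algebraMap ℝ _ (f.toFun s y) := by
    intro s
    obtain ⟨θ, hθ⟩ := (hT s).exists_linearMap
    obtain ⟨Ξ, hΞ⟩ := exists_linear_lift (Algebra.linearMap ℝ (D.FibA s))
      GSym.algebraMap_injective θ fun l => by
        obtain ⟨f, rfl⟩ := exists_dualSec_through (E := D.N) s l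
        rw [← hθ]
        exact GSym.exists_of_mem_homog_zero (fun _ => D.one_le_j₀) ((hT' f).2 s)
    refine ⟨(Module.evalEquiv ℝ (D.N.V s)).symm Ξ, fun f => ?_⟩
    rw [hθ, hΞ, Module.apply_evalEquiv_symm_apply]
    rfl
  choose y hy using h1
  refine ⟨⟨y, contMDiff_of_dualSec contMDiff_id fun f => ?_⟩, fun f s => hy s f⟩
  -- The jets are functions on the total space of A; composing with its zero section gives functions
  -- on S.
  have h2 := (contMDiff_jetA (hT' f).1).1.comp
    (contMDiff_zeroSection (n := ∞) (IB := 𝓡 n) ℝ (F := D.A.F) D.A.V)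
  refine h2.congr fun s => ?_
  change f.toFun s (y s) = (jetA (⟨s, 0⟩ : D.A.Tot) (T f s)).fst
  rw [hy s f]
  exact (congrArg TrivSqZeroExt.fst (jetA_algebraMap (⟨s, 0⟩ : D.A.Tot) _)).symm

/-- In degree j₀ the values are linear functions on A, so T is the transpose of a linear map from A
to B at each point. The second component of the jet recovers the pairing with this map. -/
theorem exists_homSec_of_tensorial {T : DualSec D.B → D.FunA}
    (hT : ∀ s, IsTensorialAt s fun f => T f s) (hT' : ∀ f, T f ∈ D.smoothA D.j₀) :
    ∃ φ : HomSec D.A D.B, ∀ f s, T f s = D.genV (D.A.V s) ((f.toFun s).comp (φ.toFun s)) := by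
  have h1 : ∀ s, ∃ φ : D.A.V s →ₗ[ℝ] D.B.V s,
      ∀ f, T f s = D.genV (D.A.V s) ((f.toFun s).comp φ) := by
    intro s
    obtain ⟨θ, hθ⟩ := (hT s).exists_linearMap
    obtain ⟨Ξ, hΞ⟩ := exists_linear_lift (D.genV (D.A.V s)) (GSym.gen_injective _) θ fun l => by
        obtain ⟨f, rfl⟩ := exists_dualSec_through (E := D.B) s l
        rw [← hθ]
        exact GSym.exists_of_mem_homog_deg D.one_le_j₀ ((hT' f).2 s)
    refine ⟨(Module.evalEquiv ℝ (D.B.V s)).symm.toLinearMap.comp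
      (Ξ.dualMap.comp (Module.Dual.eval ℝ (D.A.V s))), fun f => ?_⟩
    rw [hθ, hΞ]
    congr 1
    ext z
    simp [Module.apply_evalEquiv_symm_apply]
  choose φ hφ using h1
  refine ⟨⟨φ, contMDiff_of_dualSec D.A.contMDiff_totProj fun f => ?_⟩, fun f s => hφ s f⟩
  refine (contMDiff_jetA (hT' f).1).2.congr fun x => ?_
  rw [hφ x.proj f]
  exact (congrArg TrivSqZeroExt.snd (jetA_gen x ((f.toFun x.proj).comp (φ x.proj)))).symm

theorem exists_ofSections_eq {α : ACoch D} (hα : α ∈ 𝔞' D 0) :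
    ∃ a : Sec D.N × HomSec D.A D.B, ofSections a = α := by
  obtain ⟨⟨h1, h2, h3, -, -⟩, h4⟩ := hα
  obtain ⟨σ, hσ⟩ := exists_sec_of_tensorial (T := fun f => α [.inl f])
    (fun s h f g e hh he => h2 [] h f g e hh he s) fun f => by simpa [linDeg] using h1 [.inl f]
  obtain ⟨φ, hφ⟩ := exists_homSec_of_tensorial (T := fun f => α [.inr f])
    (fun s h f g e hh he => h3 [] h f g e hh he s) fun f => by simpa [linDeg] using h1 [.inr f]
  refine ⟨(σ, φ), ?_⟩
  funext L
  match L with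
  | [] => rw [h4 [] (by simp), ofSections_eq_zero _ (by simp)]
  | [.inl f] => exact funext fun s => (hσ f s).symm
  | [.inr f] => exact funext fun s => (hφ f s).symm
  | _ :: _ :: _ => rw [h4 _ (by simp), ofSections_eq_zero _ (by simp)]

/-- Every covector at a point extends to a global fibrewise linear function, and scalars and linear
coordinates embed in the fibre algebra of A. -/
theorem ofSections_injective : Function.Injective (ofSections (D := D)) := by
  rintro ⟨⟨σ, hσ⟩, ⟨φ, hφ⟩⟩ ⟨⟨σ', hσ'⟩, ⟨φ', hφ'⟩⟩ h
  have h1 : σ = σ' := by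
    funext s
    rw [← sub_eq_zero, ← Module.forall_dual_apply_eq_zero_iff ℝ]
    intro l
    obtain ⟨f, rfl⟩ := exists_dualSec_through (E := D.N) s l
    rw [map_sub, sub_eq_zero]
    exact GSym.algebraMap_injective (congrFun (congrFun h [.inl f]) s)
  have h2 : φ = φ' := by
    funext s
    ext z
    rw [← sub_eq_zero, ← Module.forall_dual_apply_eq_zero_iff ℝ]
    intro l
    obtain ⟨f, rfl⟩ := exists_dualSec_through (E := D.B) s l
    rw [map_sub, sub_eq_zero]
    have h3 : (f.toFun s).comp (φ s) = (f.toFun s).comp (φ' s) :=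
      GSym.gen_injective (deg := fun _ : Unit => D.j₀)
        (W := fun _ : Unit => Module.Dual ℝ (D.A.V s)) ()
        (congrFun (congrFun h [.inr f]) s)
    exact LinearMap.congr_fun h3 z
  subst h1 h2
  rfl

end OfSections

end Setup

end

end GradedQ

end

/-! ### The bijection between deformations and Maurer-Cartan elements. -/

theorem mainTheorem3 {n : ℕ} {S : Type*} [TopologicalSpace S] [T2Space S]
    [SecondCountableTopology S] [ChartedSpace (EuclideanSpace ℝ (Fin n)) S] [IsManifold (𝓡 n) ∞ S]
    (D : GradedQ.Setup n S) (Q : D.BlendedQ) (hA : GradedQ.Setup.IsCoisotropicBase Q)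
    (hQ : Q.IsAnalytic) :
    Set.BijOn (fun a => - GradedQ.Setup.ofSections a)
      (GradedQ.Setup.deformations Q) (GradedQ.Setup.maurerCartan Q) := by
  refine ⟨fun a ha => ?_, fun a _ b _ h => ?_, fun v hv => ?_⟩
  · exact (GradedQ.Setup.mem_maurerCartan_iff a hQ (GradedQ.Setup.neg_ofSections_mem a)).2 ha
  · exact GradedQ.Setup.ofSections_injective (neg_injective h)
  -- In degree zero the graded subspace is the part of multiplicity one, whose elements are exactly
  -- pairs of sections; the sign is moved onto v first.
  · have hv' : -v ∈ GradedQ.Setup.𝔞' D 0 := by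
      obtain ⟨h, -⟩ := hv
      rw [GradedQ.Setup.abar_zero] at h
      exact neg_mem h
    obtain ⟨a, ha⟩ := GradedQ.Setup.exists_ofSections_eq hv'
    have hva : - GradedQ.Setup.ofSections a = v := by rw [ha, neg_neg]
    refine ⟨a, ?_, hva⟩
    rw [← GradedQ.Setup.mem_maurerCartan_iff a hQ (GradedQ.Setup.neg_ofSections_mem a), hva]
    exact hv
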